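/- Let $\mathcal Y$ and $\mathcal S$ be finite alphabets and let $(X_j,Y_j,S_j)$, $j\in\mathbb Z$, be a strictly stationary process with $X_j\in\{0,1\}$, $Y_j\in\mathcal Y$, $S_j\in\mathcal S$. Assume that it is a finite-state aperiodic irreducible Markov (FAIM) process, that is: for every $j$, conditioned on $S_{j-1}$, the family $(X_k,Y_k,S_k)_{k\ge j}$ is independent of the family $(X_l,Y_l,S_{l-1})_{l<j}$; and the (stationary, homogeneous) Markov chain $(S_j)$ on $\mathcal S$ is irreducible and aperiodic. For a binary random variable $U$ and a random variable $Q$ with a finite alphabet put $Z(U|Q)=2\sum_q\sqrt{P(U=0,Q=q)\,P(U=1,Q=q)}$, and for random variables with finite alphabets let $H(U|Q)=-\sum_{q,u}P(U=u,Q=q)\log_2 P(U=u\mid Q=q)$ be the conditional entropy in bits. For $N=2^n$ let $G_N=B_NG_2^{\otimes n}$ over $\mathbb F_2$, where $G_2=\begin{bmatrix}1&0\\1&1\end{bmatrix}$ and $B_N$ is the $N\times N$ bit-reversal permutation matrix. Put $U_1^N=X_1^NG_N$ and $Q_i=(U_1^{i-1},Y_1^N)$ for $1\le i\le N$. Let $B_1,B_2,\dots$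 be i.i.d. Bernoulli-$1/2$ random variables, on any probability space, and let the Bhattacharyya process be $Z_n=Z(U_i|Q_i)$ for the index $i$ given by $i-1=\sum_{j=1}^nB_j2^{n-j}$. Then the following hold. 1. The process $Z_n$ polarizes fast to $1$ with every $\beta\in(0,1/2)$. That is, $Z_n$ is a sequence of $[0,1]$-valued random variables that converges almost surely to a $\{0,1\}$-valued random variable $Z_\infty$, and $$\lim_{n\to\infty}\Pr\left(Z_n>1-2^{-2^{n\beta}}\right)=\Pr(Z_\infty=1).$$ 2. The conditional entropy rate $H_*(X|Y)=\lim_{N\to\infty}\frac1N H(X_1^N|Y_1^N)$ (the limit over all positive integers $N$) exists, and for every $\beta<1/2$, with $N=2^n$ and $n\to\infty$, $$\lim_{N\to\infty}\frac1N\left|\left\{i\in\{1,\dots,N\}:\ Z(U_i|Q_i)>1-2^{-N^{\beta}}\right\}\right|=H_*(X|Y).$$ -/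

import Mathlib

open MeasureTheory ProbabilityTheory Filter Topology

noncomputable section

namespace Polar

/-! ### Parameters of joint distributions -/

section Parameters

variable {Ω : Type*} [MeasurableSpace Ω]

/-- The joint probability `P(U = u, Q = q)`. -/
def jointProb {α β : Type*} (μ : Measure Ω) (U : Ω → α) (Q : Ω → β) (u : α) (q : β) : ℝ :=
  μ.real {ω | U ω = u ∧ Q ω = q}

/-- The Bhattacharyya parameter `Z(U|Q) = 2 ∑_q √(P(U = 0, Q = q) P(U = 1, Q = q))` of a binary
random variable `U` given a random variable `Q` with a finite alphabet. -/
def bhattacharyya {β : Type*} [Fintype β] (μ : Measure Ω) (U : Ω → ZMod 2) (Q : Ω → β) : ℝ :=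
  2 * ∑ q, Real.sqrt (jointProb μ U Q 0 q * jointProb μ U Q 1 q)

/-- The conditional entropy (in bits)
`H(U|Q) = -∑_q ∑_u P(U = u, Q = q) log₂ (P(U = u, Q = q) / ∑_u' P(U = u', Q = q))`;
as usual, `0 log 0 = 0`. -/
def condEntropy {α β : Type*} [Fintype α] [Fintype β] (μ : Measure Ω) (U : Ω → α) (Q : Ω → β) :
    ℝ :=
  -∑ q, ∑ u, jointProb μ U Q u q *
    Real.logb 2 (jointProb μ U Q u q / ∑ u', jointProb μ U Q u' q)

/-- The block `A_1, …, A_N` of a two-sided sequence, as a vector with `N` entries. -/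
def block {α : Type*} (A : ℤ → Ω → α) (N : ℕ) (ω : Ω) : Fin N → α :=
  fun k => A ((k : ℤ) + 1) ω

end Parameters

/-! ### Arıkan's polarization matrix

Indices in `Fin (2 ^ n)` start from `0`. The equivalence
`finFunctionFinEquiv : (Fin n → Fin 2) ≃ Fin (2 ^ n)` sends `d` to `∑ k, d k * 2 ^ k`, so its inverse
gives the binary digits of an index, the least significant one being digit `0`. -/

/-- Digit `k` (the coefficient of `2 ^ k`) of the index `i`. -/
def digit {n : ℕ} (i : Fin (2 ^ n)) (k : Fin n) : Fin 2 :=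
  finFunctionFinEquiv.symm i k

/-- The kernel `G₂`. -/
def G2 : Matrix (Fin 2) (Fin 2) (ZMod 2) := !![1, 0; 1, 1]

/-- The `n`-fold Kronecker power of `G₂`: its entries are products of entries of `G₂`
over the binary digits of the two indices. -/
def kroneckerPower (n : ℕ) : Matrix (Fin (2 ^ n)) (Fin (2 ^ n)) (ZMod 2) :=
  Matrix.of fun i j => ∏ k : Fin n, G2 (digit i k) (digit j k)

/-- Reversal of the order of the `n` binary digits of an index. -/
def bitReverse {n : ℕ} (i : Fin (2 ^ n)) : Fin (2 ^ n) :=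
  finFunctionFinEquiv fun k : Fin n => digit i k.rev

/-- The bit-reversal permutation matrix. -/
def bitReversal (n : ℕ) : Matrix (Fin (2 ^ n)) (Fin (2 ^ n)) (ZMod 2) :=
  Matrix.of fun i j => if j = bitReverse i then 1 else 0

/-- Arıkan's polarization matrix `G_N = B_N G₂^{⊗ n}`, where `N = 2 ^ n`. -/
def polarMatrix (n : ℕ) : Matrix (Fin (2 ^ n)) (Fin (2 ^ n)) (ZMod 2) :=
  bitReversal n * kroneckerPower n

/-! ### The polar transform of a process -/

section Transform

variable {Ω : Type*} [MeasurableSpace Ω] {𝒴 : Type*}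

/-- `U_1^N = X_1^N G_N`, where `N = 2 ^ n`. -/
def polarU (X : ℤ → Ω → ZMod 2) (n : ℕ) (ω : Ω) : Fin (2 ^ n) → ZMod 2 :=
  Matrix.vecMul (block X (2 ^ n) ω) (polarMatrix n)

/-- The observation consisting of all entries of `U_1^N` strictly before the (0-based) index `i`,
and of `Y_1^N`. In 1-based numbering this is `Q_{i+1} = (U_1^i, Y_1^N)`. -/
def polarQ (X : ℤ → Ω → ZMod 2) (Y : ℤ → Ω → 𝒴) (n : ℕ) (i : Fin (2 ^ n)) (ω : Ω) :
    (Fin (i : ℕ) → ZMod 2) × (Fin (2 ^ n) → 𝒴) :=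
  (fun k => polarU X n ω (Fin.castLE i.isLt.le k), block Y (2 ^ n) ω)

/-- The Bhattacharyya parameter `Z(U_i|Q_i)` (`i` is 0-based here). -/
def polarZ [Fintype 𝒴] (μ : Measure Ω) (X : ℤ → Ω → ZMod 2) (Y : ℤ → Ω → 𝒴) (n : ℕ)
    (i : Fin (2 ^ n)) : ℝ :=
  bhattacharyya μ (fun ω => polarU X n ω i) (polarQ X Y n i)

/-- The 0-based index `(b₁ b₂ ⋯ bₙ)₂`, the first bit being the most significant one;
the bit `b_{j+1}` is the entry `b j`. -/
def polarIndex (b : ℕ → Fin 2) (n : ℕ) : Fin (2 ^ n) :=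
  finFunctionFinEquiv fun k : Fin n => b (k.rev : ℕ)

/-- The Bhattacharyya process: `Z_n = Z(U_i|Q_i)` for the index `i` with
`i - 1 = (B₁ B₂ ⋯ Bₙ)₂`. The bits `B_{j+1}`, here `B j`, live on a probability space of
their own. -/
def bhattacharyyaProcess [Fintype 𝒴] (μ : Measure Ω) (X : ℤ → Ω → ZMod 2) (Y : ℤ → Ω → 𝒴)
    {Ω' : Type*} (B : ℕ → Ω' → Fin 2) (n : ℕ) (ω' : Ω') : ℝ :=
  polarZ μ X Y n (polarIndex (fun j => B j ω') n)

end Transform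

/-- An i.i.d. sequence of Bernoulli-`1/2` random variables. -/
structure IsFairBits {Ω' : Type*} [MeasurableSpace Ω'] (ν : Measure Ω') (B : ℕ → Ω' → Fin 2) :
    Prop where
  measurable : ∀ n, Measurable (B n)
  indep : iIndepFun B ν
  fair : ∀ n b, ν.real (B n ⁻¹' {b}) = 1 / 2

/-! ### Polarization -/

/-- The sequence `A n` of `[0,1]`-valued random variables polarizes to the `{0,1}`-valued random
variable `Ainf`: it converges to it almost surely. -/
structure PolarizesTo {Ω' : Type*} [MeasurableSpace Ω'] (ν : Measure Ω') (A : ℕ → Ω' → ℝ)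
    (Ainf : Ω' → ℝ) : Prop where
  measurable : ∀ n, Measurable (A n)
  mem_Icc : ∀ n ω, A n ω ∈ Set.Icc (0 : ℝ) 1
  measurable_lim : Measurable Ainf
  zero_or_one : ∀ ω, Ainf ω = 0 ∨ Ainf ω = 1
  tendsto : ∀ᵐ ω ∂ν, Tendsto (fun n => A n ω) atTop (𝓝 (Ainf ω))

/-- The sequence `A n` polarizes fast to `1` with exponent `β`. -/
def PolarizesFastToOne {Ω' : Type*} [MeasurableSpace Ω'] (ν : Measure Ω') (A : ℕ → Ω' → ℝ)
    (β : ℝ) : Prop :=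
  ∃ Ainf : Ω' → ℝ, PolarizesTo ν A Ainf ∧
    Tendsto (fun n : ℕ => ν.real {ω | A n ω > 1 - (2 : ℝ) ^ (-(2 : ℝ) ^ ((n : ℝ) * β))}) atTop
      (𝓝 (ν.real {ω | Ainf ω = 1}))

/-! ### Finite-state aperiodic irreducible Markov processes -/

section FAIM

variable {Ω : Type*} [MeasurableSpace Ω] {𝒴 𝒮 : Type*}

/-- The `n`-step transition probability `P(S_n = b | S_0 = a)`
(with value `0` if `P(S_0 = a) = 0`). -/
def transProb (μ : Measure Ω) (S : ℤ → Ω → 𝒮) (n : ℕ) (a b : 𝒮) : ℝ :=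
  (μ[|S 0 ⁻¹' {a}]).real (S n ⁻¹' {b})

/-- Irreducibility: every state leads to every state. -/
def IsIrreducibleChain (μ : Measure Ω) (S : ℤ → Ω → 𝒮) : Prop :=
  ∀ a b : 𝒮, ∃ n : ℕ, 0 < n ∧ 0 < transProb μ S n a b

/-- Aperiodicity: for every state, the possible return times have greatest common divisor `1`. -/
def IsAperiodicChain (μ : Measure Ω) (S : ℤ → Ω → 𝒮) : Prop :=
  ∀ a : 𝒮, ∀ d : ℕ, (∀ n : ℕ, 0 < n → 0 < transProb μ S n a a → d ∣ n) → d = 1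

/-- `(X_j, Y_j, S_j)`, `j ∈ ℤ`, is a finite-state aperiodic irreducible Markov (FAIM) process.
The alphabets `𝒴` and `𝒮` are finite wherever this is used. -/
structure IsFAIM [MeasurableSpace 𝒴] [MeasurableSpace 𝒮] (μ : Measure Ω)
    (X : ℤ → Ω → ZMod 2) (Y : ℤ → Ω → 𝒴) (S : ℤ → Ω → 𝒮) : Prop where
  measurable_X : ∀ j, Measurable (X j)
  measurable_Y : ∀ j, Measurable (Y j)
  measurable_S : ∀ j, Measurable (S j)
  /-- Strict stationarity: every time shift of the process has the law of the process. -/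
  stationary : ∀ m : ℤ,
    IdentDistrib (fun ω (j : ℤ) => (X (j + m) ω, Y (j + m) ω, S (j + m) ω))
      (fun ω (j : ℤ) => (X j ω, Y j ω, S j ω)) μ μ
  /-- Markov property: conditioned on `S_{j-1}`, the variables `X_k, Y_k, S_k` with `k ≥ j` are
  independent of the variables `X_l, Y_l, S_{l-1}` with `l < j`. (For a state of probability
  zero the conditional measure is the zero measure, and nothing is required.) -/
  markov : ∀ (j : ℤ) (s : 𝒮),
    IndepFun (fun ω (k : Set.Ici j) => (X k ω, Y k ω, S k ω))
      (fun ω (l : Set.Iio j) => (X l ω, Y l ω, S ((l : ℤ) - 1) ω)) (μ[|S (j - 1) ⁻¹' {s}])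
  irreducible : IsIrreducibleChain μ S
  aperiodic : IsAperiodicChain μ S

end FAIM

end Polar

end

/-! Write K(U|Q) = ∑_q |P(0,q) - P(1,q)|. The parameter that carries the proof is K̂ = K(U_i | Q_i,
S_0, S_N) (`boundaryTV`), in which the states at both ends of the block are revealed. Given the
state at their common boundary, two adjacent blocks are independent, so one polarization step
becomes a computation with products. With the sum R of `crossSum`, bit 0 gives K̂⁻ ≤ R, bit 1 gives
K̂⁺ ≤ 2K̂ - R, and 0 ≤ R ≤ C K̂², where C bounds the inverse state probabilities.

Along random bits K̂ is therefore a bounded supermartingale and converges almost surely.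
Aperiodicity and irreducibility bound the joint probabilities of distant states below, which yields
K̂ - R ≥ η K̂(1 - K̂) for large blocks. Since bit 0 occurs infinitely often, the limit is 0 or 1.
Where it is 0 (`noiseEvent`), K̂ is squared up to a constant at bit 0 and at most doubled at bit 1.
By the strong law each bit occurs half of the time, so K̂ < 2^{-2^{nβ}} eventually for each β < 1/2.
Hiding the states only lowers K, and Z ≥ 1 - K, so Z ≥ 1 - K̂ tends to 1 at this speed.

Where K̂ tends to 1, the entropy H(U_i | Q_i, S_0, S_N) tends to 0, but hiding the states raises Z
and H. Here an average helps: over the whole block, the two states change the total entropy by O(1),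
so the nonnegative gap between H(U_i | Q_i) and H(U_i | Q_i, S_0, S_N) has mean tending to 0. Both
entropies converge almost surely, so the gap tends to 0, and Z ≤ √(2H) tends to 0 as well. Thus Z_∞
is the indicator of the noise event. The same averages identify the probability of this event with
the entropy rate, which exists by subadditivity.

The second claim covers negative β too. Then the threshold itself tends to 0, and the convergence Z
→ 0 must be fast; this follows from Z⁺ ≤ C Z² and Z⁻ ≤ 2C Z. As the random index is uniform at each
level, fractions of indices are probabilities. -/

set_option linter.unusedSectionVars false

noncomputable section

namespace Polar

/-! ### Laws of random variables with finite alphabets -/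

section Laws

variable {Ω : Type*} [MeasurableSpace Ω] {α β γ δ : Type*}

/-- All fibers are measurable; for a finite alphabet, this is measurability for the discrete
`σ`-algebra. -/
def MeasurableFibers (A : Ω → α) : Prop := ∀ a, MeasurableSet (A ⁻¹' {a})

/-- The probability mass function of `A`. -/
def law (μ : Measure Ω) (A : Ω → α) (a : α) : ℝ := μ.real (A ⁻¹' {a})

lemma law_nonneg (μ : Measure Ω) (A : Ω → α) (a : α) : 0 ≤ law μ A a := measureReal_nonneg

lemma MeasurableFibers.preimage [Finite α] {A : Ω → α} (hA : MeasurableFibers A) (s : Set α) :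
    MeasurableSet (A ⁻¹' s) := by
  rw [← Set.biUnion_preimage_singleton]
  exact s.toFinite.measurableSet_biUnion fun a _ => hA a

lemma MeasurableFibers.comp [Finite α] {A : Ω → α} (hA : MeasurableFibers A) (f : α → β) :
    MeasurableFibers (fun ω => f (A ω)) :=
  fun b => hA.preimage (f ⁻¹' {b})

/-- `FactorsThrough` compares outcomes only. Observations with different alphabets can thus be
ordered by information, or identified, without an explicit map between the alphabets. -/
lemma MeasurableFibers.of_factorsThrough [Finite α] {A : Ω → α} {B : Ω → β}
    (hA : MeasurableFibers A) (h : B.FactorsThrough A) : MeasurableFibers B := by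
  intro b
  have : B ⁻¹' {b} = A ⁻¹' (A '' (B ⁻¹' {b})) := by
    ext ω
    constructor
    · exact fun hω => ⟨ω, hω, rfl⟩
    · rintro ⟨ω', hω', e⟩
      exact (h e).symm.trans hω'
  rw [this]
  exact hA.preimage _

lemma MeasurableFibers.prodMk {A : Ω → α} {B : Ω → β} (hA : MeasurableFibers A)
    (hB : MeasurableFibers B) : MeasurableFibers (fun ω => (A ω, B ω)) := by
  rintro ⟨a, b⟩
  convert (hA a).inter (hB b) using 1
  ext ω
  simp

lemma MeasurableFibers.pi {ι : Type*} [Countable ι] {A : ι → Ω → α}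
    (hA : ∀ i, MeasurableFibers (A i)) : MeasurableFibers (fun ω i => A i ω) := by
  intro a
  convert MeasurableSet.iInter fun i => hA i (a i) using 1
  ext ω
  simp [funext_iff]

lemma _root_.Measurable.measurableFibers [MeasurableSpace α] [MeasurableSingletonClass α]
    {A : Ω → α} (hA : Measurable A) : MeasurableFibers A :=
  fun a => hA (measurableSet_singleton a)

variable {μ : Measure Ω} [IsProbabilityMeasure μ]

lemma measureReal_preimage_eq_sum [Fintype α] {A : Ω → α} (hA : MeasurableFibers A) (s : Set α)
    [DecidablePred (· ∈ s)] :
    μ.real (A ⁻¹' s) = ∑ a, if a ∈ s then law μ A a else 0 := by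
  classical
  rw [← Finset.sum_filter]
  unfold law
  rw [sum_measureReal_preimage_singleton _ fun a _ => hA a]
  simp

lemma law_comp [Fintype α] [DecidableEq β] {A : Ω → α} (hA : MeasurableFibers A) (f : α → β)
    (b : β) : law μ (fun ω => f (A ω)) b = ∑ a, if f a = b then law μ A a else 0 :=
  measureReal_preimage_eq_sum hA {a | f a = b}

lemma sum_law [Fintype α] {A : Ω → α} (hA : MeasurableFibers A) : ∑ a, law μ A a = 1 := by
  have := measureReal_preimage_eq_sum (μ := μ) hA Set.univ
  simpa using this.symm

lemma law_le_one (A : Ω → α) (a : α) : law μ A a ≤ 1 := measureReal_le_one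

lemma sum_law_prod_right [Fintype α] [Fintype β] {A : Ω → α} {B : Ω → β}
    (hA : MeasurableFibers A) (hB : MeasurableFibers B) (a : α) :
    ∑ b, law μ (fun ω => (A ω, B ω)) (a, b) = law μ A a := by
  classical
  rw [law_comp (A := fun ω => (A ω, B ω)) (hA.prodMk hB) Prod.fst a, Fintype.sum_prod_type,
    Finset.sum_comm]
  refine Finset.sum_congr rfl fun b _ => ?_
  simp

lemma sum_law_prod_left [Fintype α] [Fintype β] {A : Ω → α} {B : Ω → β}
    (hA : MeasurableFibers A) (hB : MeasurableFibers B) (b : β) :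
    ∑ a, law μ (fun ω => (A ω, B ω)) (a, b) = law μ B b := by
  classical
  rw [law_comp (A := fun ω => (A ω, B ω)) (hA.prodMk hB) Prod.snd b, Fintype.sum_prod_type]
  refine Finset.sum_congr rfl fun a _ => ?_
  simp

lemma jointProb_eq_law (μ : Measure Ω) (U : Ω → α) (Q : Ω → β) (u : α) (q : β) :
    jointProb μ U Q u q = law μ (fun ω => (U ω, Q ω)) (u, q) := by
  unfold jointProb law
  congr 1
  ext ω
  simp

lemma jointProb_nonneg (μ : Measure Ω) (U : Ω → α) (Q : Ω → β) (u : α) (q : β) :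
    0 ≤ jointProb μ U Q u q := measureReal_nonneg

lemma sum_jointProb [Fintype α] [Fintype β] {U : Ω → α} {Q : Ω → β} (hU : MeasurableFibers U)
    (hQ : MeasurableFibers Q) : ∑ q, ∑ u, jointProb μ U Q u q = 1 := by
  simp_rw [jointProb_eq_law, sum_law_prod_left hU hQ, sum_law hQ]

lemma jointProb_comp [Fintype α] [Fintype β] [DecidableEq γ] {U : Ω → α} {Q : Ω → β}
    (hU : MeasurableFibers U) (hQ : MeasurableFibers Q) (f : β → γ) (u : α) (c : γ) :
    jointProb μ U (fun ω => f (Q ω)) u c = ∑ q, if f q = c then jointProb μ U Q u q else 0 := by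
  classical
  simp_rw [jointProb_eq_law]
  rw [law_comp (A := fun ω => (U ω, Q ω)) (hU.prodMk hQ) (fun p => (p.1, f p.2)) (u, c),
    Fintype.sum_prod_type, Finset.sum_comm]
  refine Finset.sum_congr rfl fun q _ => ?_
  simp only [Prod.mk.injEq, ite_and]
  simp

lemma sum_sum_ite_eq {ι κ : Type*} [Fintype ι] [Fintype κ] [DecidableEq κ] (f : ι → κ)
    (g : ι → ℝ) : ∑ c, ∑ q, (if f q = c then g q else 0) = ∑ q, g q := by
  rw [Finset.sum_comm]
  simp

lemma exists_eq_comp {A : Ω → α} {B : Ω → β} (h : B.FactorsThrough A)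
    (μ : Measure Ω) [IsProbabilityMeasure μ] : ∃ f : α → β, B = fun ω => f (A ω) := by
  have : Nonempty Ω := μ.nonempty_of_neZero
  have : Nonempty β := this.map B
  exact (Function.factorsThrough_iff B).1 h

end Laws

/-! ### Parameters of binary random variables -/

section Binary

variable {Ω : Type*} [MeasurableSpace Ω] {α β γ : Type*}

lemma sum_zmod_two {M : Type*} [AddCommMonoid M] (f : ZMod 2 → M) : ∑ u, f u = f 0 + f 1 :=
  Fin.sum_univ_two f

/-- The total variation parameter `K(U|Q) = ∑_q |P(U = 0, Q = q) - P(U = 1, Q = q)|`. -/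
def tvParam [Fintype β] (μ : Measure Ω) (U : Ω → ZMod 2) (Q : Ω → β) : ℝ :=
  ∑ q, |jointProb μ U Q 0 q - jointProb μ U Q 1 q|

lemma tvParam_nonneg [Fintype β] (μ : Measure Ω) (U : Ω → ZMod 2) (Q : Ω → β) :
    0 ≤ tvParam μ U Q := Finset.sum_nonneg fun _ _ => abs_nonneg _

lemma bhattacharyya_nonneg [Fintype β] (μ : Measure Ω) (U : Ω → ZMod 2) (Q : Ω → β) :
    0 ≤ bhattacharyya μ U Q :=
  mul_nonneg zero_le_two (Finset.sum_nonneg fun _ _ => Real.sqrt_nonneg _)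

variable {μ : Measure Ω} [IsProbabilityMeasure μ] {U : Ω → ZMod 2} {Q : Ω → β} {Q' : Ω → γ}

lemma sum_jointProb_binary [Fintype β] (hU : MeasurableFibers U) (hQ : MeasurableFibers Q) :
    ∑ q, (jointProb μ U Q 0 q + jointProb μ U Q 1 q) = 1 := by
  rw [← sum_jointProb (μ := μ) hU hQ]
  simp_rw [sum_zmod_two]

lemma tvParam_le_one [Fintype β] (hU : MeasurableFibers U) (hQ : MeasurableFibers Q) :
    tvParam μ U Q ≤ 1 := by
  rw [← sum_jointProb_binary (μ := μ) hU hQ]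
  refine Finset.sum_le_sum fun q _ => ?_
  have h0 := jointProb_nonneg μ U Q 0 q
  have h1 := jointProb_nonneg μ U Q 1 q
  exact abs_le.2 ⟨by linarith, by linarith⟩

/-- The triangle inequality on each fiber of the map between observations. States may therefore be
revealed in upper bounds for K. -/
lemma tvParam_le_of_factorsThrough [Fintype β] [Fintype γ] (hU : MeasurableFibers U)
    (hQ' : MeasurableFibers Q') (h : Q.FactorsThrough Q') :
    tvParam μ U Q ≤ tvParam μ U Q' := by
  classical
  obtain ⟨f, rfl⟩ := exists_eq_comp h μ
  unfold tvParam
  rw [← sum_sum_ite_eq f fun q => |jointProb μ U Q' 0 q - jointProb μ U Q' 1 q|]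
  refine Finset.sum_le_sum fun c _ => ?_
  rw [jointProb_comp hU hQ', jointProb_comp hU hQ', ← Finset.sum_sub_distrib]
  refine (Finset.abs_sum_le_sum_abs _ _).trans (Finset.sum_le_sum fun q _ => ?_)
  split_ifs <;> simp

/-- The Cauchy–Schwarz inequality on each fiber; the monotonicity is opposite to that of K. -/
lemma bhattacharyya_le_of_factorsThrough [Fintype β] [Fintype γ] (hU : MeasurableFibers U)
    (hQ' : MeasurableFibers Q') (h : Q.FactorsThrough Q') :
    bhattacharyya μ U Q' ≤ bhattacharyya μ U Q := by
  classical
  obtain ⟨f, rfl⟩ := exists_eq_comp h μ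
  unfold bhattacharyya
  rw [← sum_sum_ite_eq f fun q => √(jointProb μ U Q' 0 q * jointProb μ U Q' 1 q)]
  refine mul_le_mul_of_nonneg_left (Finset.sum_le_sum fun c _ => ?_) zero_le_two
  rw [jointProb_comp hU hQ', jointProb_comp hU hQ']
  simp_rw [← Finset.sum_filter]
  rw [Real.sqrt_mul (Finset.sum_nonneg fun _ _ => jointProb_nonneg _ _ _ _ _)]
  refine le_trans (le_of_eq ?_) (Real.sum_sqrt_mul_sqrt_le _
    (fun q => jointProb_nonneg μ U Q' 0 q) (fun q => jointProb_nonneg μ U Q' 1 q))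
  exact Finset.sum_congr rfl fun q _ => Real.sqrt_mul (jointProb_nonneg _ _ _ _ _) _

lemma bhattacharyya_le_one [Fintype β] (hU : MeasurableFibers U) (hQ : MeasurableFibers Q) :
    bhattacharyya μ U Q ≤ 1 := by
  rw [← sum_jointProb_binary (μ := μ) hU hQ, bhattacharyya, Finset.mul_sum]
  refine Finset.sum_le_sum fun q _ => ?_
  have h0 := jointProb_nonneg μ U Q 0 q
  have h1 := jointProb_nonneg μ U Q 1 q
  rw [Real.sqrt_mul h0]
  nlinarith [Real.sq_sqrt h0, Real.sq_sqrt h1,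
    sq_nonneg (√(jointProb μ U Q 0 q) - √(jointProb μ U Q 1 q))]

/-- The left side is twice the minimum, and the square of the minimum is at most the product. -/
lemma add_sub_abs_le_two_mul_sqrt {x y : ℝ} (hx : 0 ≤ x) (hy : 0 ≤ y) :
    x + y - |x - y| ≤ 2 * √(x * y) := by
  have h : min x y ≤ √(x * y) := by
    refine Real.le_sqrt_of_sq_le ?_
    rw [sq]
    exact mul_le_mul (min_le_left _ _) (min_le_right _ _) (le_min hx hy) hx
  rcases le_total x y with hxy | hxy
  · rw [min_eq_left hxy] at h
    rw [abs_of_nonpos (by linarith)]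
    linarith
  · rw [min_eq_right hxy] at h
    rw [abs_of_nonneg (by linarith)]
    linarith

lemma one_sub_tvParam_le_bhattacharyya [Fintype β] (hU : MeasurableFibers U)
    (hQ : MeasurableFibers Q) : 1 - tvParam μ U Q ≤ bhattacharyya μ U Q := by
  rw [← sum_jointProb_binary (μ := μ) hU hQ, tvParam, bhattacharyya, ← Finset.sum_sub_distrib,
    Finset.mul_sum]
  exact Finset.sum_le_sum fun q _ =>
    add_sub_abs_le_two_mul_sqrt (jointProb_nonneg _ _ _ _ _) (jointProb_nonneg _ _ _ _ _)

/-- From 4xy = (x + y)² - (x - y)², split into two roots whose radicands sum to 1 - K and 1 + K,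
ready for Cauchy–Schwarz. -/
lemma two_mul_sqrt_eq {x y : ℝ} (hx : 0 ≤ x) (hy : 0 ≤ y) :
    2 * √(x * y) = √(x + y - |x - y|) * √(x + y + |x - y|) := by
  rw [← Real.sqrt_mul (by rcases abs_cases (x - y) with h | h <;> linarith)]
  rw [show (x + y - |x - y|) * (x + y + |x - y|) = 2 ^ 2 * (x * y) by
    have := sq_abs (x - y)
    ring_nf at this ⊢
    rw [this]
    ring]
  rw [Real.sqrt_mul (by positivity : (0 : ℝ) ≤ 2 ^ 2), Real.sqrt_sq zero_le_two]

lemma bhattacharyya_le_sqrt [Fintype β] (hU : MeasurableFibers U) (hQ : MeasurableFibers Q) :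
    bhattacharyya μ U Q ≤ √(1 - tvParam μ U Q) * √(1 + tvParam μ U Q) := by
  rw [← sum_jointProb_binary (μ := μ) hU hQ, tvParam, bhattacharyya, ← Finset.sum_sub_distrib,
    ← Finset.sum_add_distrib, Finset.mul_sum]
  refine le_trans (le_of_eq (Finset.sum_congr rfl fun q _ => two_mul_sqrt_eq
    (jointProb_nonneg _ _ _ _ _) (jointProb_nonneg _ _ _ _ _))) ?_
  refine Real.sum_sqrt_mul_sqrt_le _ (fun q => ?_) (fun q => ?_)
  all_goals
    have h0 := jointProb_nonneg μ U Q 0 q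
    have h1 := jointProb_nonneg μ U Q 1 q
    rcases abs_cases (jointProb μ U Q 0 q - jointProb μ U Q 1 q) with h | h <;> linarith

end Binary

/-! ### Entropy -/

section Entropy

variable {Ω : Type*} [MeasurableSpace Ω] {α β γ δ : Type*}

/-- The entropy (in nats) of a random variable with a finite alphabet. -/
def entropy [Fintype α] (μ : Measure Ω) (A : Ω → α) : ℝ := ∑ a, Real.negMulLog (law μ A a)

/-- The logarithm of the sum dominates the logarithm of each positive term. -/
lemma negMulLog_sum_le {ι : Type*} (s : Finset ι) {p : ι → ℝ} (hp : ∀ i, 0 ≤ p i) :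
    Real.negMulLog (∑ i ∈ s, p i) ≤ ∑ i ∈ s, Real.negMulLog (p i) := by
  rw [Real.negMulLog, neg_mul, ← mul_neg, Finset.sum_mul]
  refine Finset.sum_le_sum fun i hi => ?_
  rcases (hp i).eq_or_lt with h | h
  · simp [← h]
  · have := Real.log_le_log h (Finset.single_le_sum (fun j _ => hp j) hi)
    rw [Real.negMulLog]
    nlinarith

lemma entropy_nonneg [Fintype α] (μ : Measure Ω) [IsProbabilityMeasure μ] (A : Ω → α) :
    0 ≤ entropy μ A :=
  Finset.sum_nonneg fun _ _ => Real.negMulLog_nonneg (law_nonneg _ _ _) (law_le_one _ _)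

/-- From -x log x ≤ 1 - x ≤ 1 for each atom. The bound is crude, but it only has to be independent
of the block length. -/
lemma entropy_le_card [Fintype α] (μ : Measure Ω) (A : Ω → α) :
    entropy μ A ≤ Fintype.card α := by
  rw [entropy, Fintype.card, Finset.cast_card]
  refine Finset.sum_le_sum fun a _ => ?_
  rcases (law_nonneg μ A a).eq_or_lt with h | h
  · simp [← h]
  · have := Real.one_sub_inv_le_log_of_pos h
    have h1 : law μ A a * (law μ A a)⁻¹ = 1 := mul_inv_cancel₀ h.ne'
    rw [Real.negMulLog]
    nlinarith

variable {μ : Measure Ω} [IsProbabilityMeasure μ] {A : Ω → α} {B : Ω → β} {C : Ω → γ}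

lemma entropy_le_of_factorsThrough [Fintype α] [Fintype β] (hA : MeasurableFibers A)
    (h : B.FactorsThrough A) : entropy μ B ≤ entropy μ A := by
  classical
  obtain ⟨f, rfl⟩ := exists_eq_comp h μ
  unfold entropy
  rw [← sum_sum_ite_eq f fun a => Real.negMulLog (law μ A a)]
  refine Finset.sum_le_sum fun b _ => ?_
  rw [law_comp hA]
  simp_rw [← Finset.sum_filter]
  exact negMulLog_sum_le _ (law_nonneg μ A)

lemma entropy_congr [Fintype α] [Fintype β] (hA : MeasurableFibers A)
    (h : B.FactorsThrough A) (h' : A.FactorsThrough B) : entropy μ B = entropy μ A :=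
  (entropy_le_of_factorsThrough hA h).antisymm
    (entropy_le_of_factorsThrough (hA.of_factorsThrough h) h')

/-- The inequality log x ≥ 1 - 1/x at x = pt/(rs), for one term of a conditional mutual information.
The bounds by `p` make every quantity positive as soon as `p` is. -/
lemma mul_log_submodular_aux {p r s t : ℝ} (hp : 0 ≤ p) (hr : p ≤ r) (hs : p ≤ s) (ht : p ≤ t) :
    p - r * s / t ≤ p * (Real.log p + Real.log t - Real.log r - Real.log s) := by
  rcases hp.eq_or_lt with h | h
  · subst h
    have : 0 ≤ r * s / t := by positivity
    linarith
  · have hr' := h.trans_le hr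
    have hs' := h.trans_le hs
    have ht' := h.trans_le ht
    have e : Real.log p + Real.log t - Real.log r - Real.log s = Real.log (p * t / (r * s)) := by
      rw [Real.log_div (by positivity) (by positivity), Real.log_mul h.ne' ht'.ne',
        Real.log_mul hr'.ne' hs'.ne']
      ring
    rw [e]
    have := Real.one_sub_inv_le_log_of_pos (x := p * t / (r * s)) (by positivity)
    refine le_trans (le_of_eq ?_) (mul_le_mul_of_nonneg_left this hp)
    field_simp

/-- Strong subadditivity of entropy. -/
lemma entropy_submodular [Fintype α] [Fintype β] [Fintype γ] (hA : MeasurableFibers A)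
    (hB : MeasurableFibers B) (hC : MeasurableFibers C) :
    entropy μ (fun ω => (A ω, B ω, C ω)) + entropy μ C ≤
      entropy μ (fun ω => (A ω, C ω)) + entropy μ (fun ω => (B ω, C ω)) := by
  classical
  set p : α → β → γ → ℝ := fun a b c => law μ (fun ω => (A ω, B ω, C ω)) (a, b, c) with hpdef
  have hp : ∀ a b c, 0 ≤ p a b c := fun _ _ _ => law_nonneg _ _ _
  have hs : ∀ b c, law μ (fun ω => (B ω, C ω)) (b, c) = ∑ a, p a b c := fun b c =>
    (sum_law_prod_left hA (hB.prodMk hC) (b, c)).symm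
  have hr : ∀ a c, law μ (fun ω => (A ω, C ω)) (a, c) = ∑ b, p a b c := fun a c => by
    have := law_comp (μ := μ) (A := fun ω => (A ω, B ω, C ω)) (hA.prodMk (hB.prodMk hC))
      (fun x => (x.1, x.2.2)) (a, c)
    rw [this]
    simp only [Fintype.sum_prod_type, Prod.mk.injEq, ite_and]
    simp [hpdef]
  have ht : ∀ c, law μ C c = ∑ b, ∑ a, p a b c := fun c => by
    rw [← sum_law_prod_left (μ := μ) hB hC c]
    exact Finset.sum_congr rfl fun b _ => hs b c
  set r : α → γ → ℝ := fun a c => ∑ b, p a b c with hrdef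
  set s : β → γ → ℝ := fun b c => ∑ a, p a b c with hsdef
  set t : γ → ℝ := fun c => ∑ b, ∑ a, p a b c with htdef
  have e1 : entropy μ (fun ω => (A ω, B ω, C ω)) =
      -∑ c, ∑ b, ∑ a, p a b c * Real.log (p a b c) := by
    simp only [entropy, Fintype.sum_prod_type, Real.negMulLog, neg_mul, Finset.sum_neg_distrib]
    rw [Finset.sum_comm]
    exact congrArg Neg.neg ((Finset.sum_congr rfl fun b _ => Finset.sum_comm).trans Finset.sum_comm)
  have e2 : entropy μ C = -∑ c, ∑ b, ∑ a, p a b c * Real.log (t c) := by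
    simp only [entropy, Real.negMulLog, neg_mul, Finset.sum_neg_distrib, ht]
    simp_rw [← Finset.sum_mul]
    rfl
  have e3 : entropy μ (fun ω => (A ω, C ω)) = -∑ c, ∑ b, ∑ a, p a b c * Real.log (r a c) := by
    simp only [entropy, Fintype.sum_prod_type, Real.negMulLog, neg_mul, Finset.sum_neg_distrib, hr]
    rw [Finset.sum_comm]
    simp_rw [Finset.sum_comm (s := (Finset.univ : Finset β)), ← Finset.sum_mul]
    rfl
  have e4 : entropy μ (fun ω => (B ω, C ω)) = -∑ c, ∑ b, ∑ a, p a b c * Real.log (s b c) := by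
    simp only [entropy, Fintype.sum_prod_type, Real.negMulLog, neg_mul, Finset.sum_neg_distrib, hs]
    rw [Finset.sum_comm]
    simp_rw [← Finset.sum_mul]
    rfl
  have key : ∀ c b a, p a b c - r a c * s b c / t c ≤
      p a b c * (Real.log (p a b c) + Real.log (t c) - Real.log (r a c) - Real.log (s b c)) := by
    intro c b a
    have h1 : p a b c ≤ r a c := Finset.single_le_sum (f := fun b => p a b c)
      (fun b _ => hp a b c) (Finset.mem_univ b)
    have h2 : p a b c ≤ s b c := Finset.single_le_sum (f := fun a => p a b c)
      (fun a _ => hp a b c) (Finset.mem_univ a)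
    have h3 : s b c ≤ t c := Finset.single_le_sum (f := fun b => s b c)
      (fun b _ => Finset.sum_nonneg fun a _ => hp a b c) (Finset.mem_univ b)
    exact mul_log_submodular_aux (hp a b c) h1 h2 (h2.trans h3)
  -- The conditionally independent law r s / t has the same mass as `p` for each `c`;
  -- `mul_self_div_self` also covers `t c = 0`.
  have tot : ∑ c, ∑ b, ∑ a, (p a b c - r a c * s b c / t c) = 0 := by
    refine Finset.sum_eq_zero fun c _ => ?_
    have hrt : ∑ a, r a c = t c := Finset.sum_comm
    simp_rw [Finset.sum_sub_distrib, ← Finset.sum_div, ← Finset.sum_mul, hrt, ← Finset.mul_sum]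
    change t c - t c * t c / t c = 0
    rw [mul_self_div_self, sub_self]
  have := Finset.sum_le_sum fun c (_ : c ∈ Finset.univ) => Finset.sum_le_sum
    fun b (_ : b ∈ Finset.univ) => Finset.sum_le_sum fun a (_ : a ∈ Finset.univ) => key c b a
  rw [tot] at this
  simp only [mul_sub, mul_add, Finset.sum_sub_distrib, Finset.sum_add_distrib] at this
  rw [e1, e2, e3, e4]
  linarith

lemma entropy_prod_le [Fintype α] [Fintype β] (hA : MeasurableFibers A)
    (hB : MeasurableFibers B) :
    entropy μ (fun ω => (A ω, B ω)) ≤ entropy μ A + entropy μ B := by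
  have hC : MeasurableFibers (fun _ : Ω => ()) := fun a => by simp
  have h := entropy_submodular (μ := μ) hA hB hC
  rw [entropy_congr (μ := μ) (A := A) (B := fun ω => (A ω, ())) hA
      (fun ω ω' e => by simp [e]) (fun ω ω' e => by simpa using e),
    entropy_congr (μ := μ) (A := B) (B := fun ω => (B ω, ())) hB
      (fun ω ω' e => by simp [e]) (fun ω ω' e => by simpa using e),
    entropy_congr (μ := μ) (A := fun ω => (A ω, B ω)) (B := fun ω => (A ω, B ω, ()))
      (hA.prodMk hB) (fun ω ω' e => by simpa using e) (fun ω ω' e => by simpa using e)] at h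
  linarith [entropy_nonneg μ (fun _ : Ω => ())]

lemma condEntropy_eq [Fintype α] [Fintype β] (hA : MeasurableFibers A)
    (hB : MeasurableFibers B) :
    condEntropy μ A B = (entropy μ (fun ω => (A ω, B ω)) - entropy μ B) / Real.log 2 := by
  have hs : ∀ b, ∑ a, jointProb μ A B a b = law μ B b := fun b => by
    simp_rw [jointProb_eq_law]
    exact sum_law_prod_left hA hB b
  have e : entropy μ B = -∑ b, ∑ a, jointProb μ A B a b * Real.log (law μ B b) := by
    simp only [entropy, Real.negMulLog, neg_mul, Finset.sum_neg_distrib, ← Finset.sum_mul, hs]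
  have e' : entropy μ (fun ω => (A ω, B ω)) =
      -∑ b, ∑ a, jointProb μ A B a b * Real.log (jointProb μ A B a b) := by
    simp only [entropy, Real.negMulLog, neg_mul, Finset.sum_neg_distrib, jointProb_eq_law,
      Fintype.sum_prod_type]
    rw [Finset.sum_comm]
  rw [e, e', condEntropy, neg_sub_neg, ← Finset.sum_sub_distrib, Finset.sum_div,
    ← Finset.sum_neg_distrib]
  refine Finset.sum_congr rfl fun b _ => ?_
  rw [hs, ← Finset.sum_sub_distrib, Finset.sum_div, ← Finset.sum_neg_distrib]
  refine Finset.sum_congr rfl fun a _ => ?_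
  rcases (jointProb_nonneg μ A B a b).eq_or_lt with h | h
  · simp [← h]
  · have h' : 0 < law μ B b := by
      rw [← hs b]
      exact h.trans_le (Finset.single_le_sum (f := fun a => jointProb μ A B a b)
        (fun a _ => jointProb_nonneg μ A B a b) (Finset.mem_univ a))
    rw [Real.logb, Real.log_div h.ne' h'.ne']
    ring

lemma log_two_pos : 0 < Real.log 2 := Real.log_pos one_lt_two

lemma condEntropy_nonneg [Fintype α] [Fintype β] (hA : MeasurableFibers A)
    (hB : MeasurableFibers B) : 0 ≤ condEntropy μ A B := by
  rw [condEntropy_eq hA hB]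
  exact div_nonneg (sub_nonneg.2 (entropy_le_of_factorsThrough (hA.prodMk hB)
    fun _ _ e => congrArg Prod.snd e)) log_two_pos.le

/-- Strong subadditivity, where `C` is redundant next to `B`. -/
lemma condEntropy_le_of_factorsThrough [Fintype α] [Fintype β] [Fintype γ]
    (hA : MeasurableFibers A) (hB : MeasurableFibers B) (h : C.FactorsThrough B) :
    condEntropy μ A B ≤ condEntropy μ A C := by
  have hC := hB.of_factorsThrough h
  rw [condEntropy_eq hA hB, condEntropy_eq hA hC]
  refine div_le_div_of_nonneg_right ?_ log_two_pos.le
  have := entropy_submodular (μ := μ) hA hB hC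
  rw [entropy_congr (μ := μ) (A := B) (B := fun ω => (B ω, C ω)) hB
      (fun ω ω' e => by simp [e, h e]) (fun ω ω' e => congrArg Prod.fst e),
    entropy_congr (μ := μ) (A := fun ω => (A ω, B ω)) (B := fun ω => (A ω, B ω, C ω))
      (hA.prodMk hB) (fun ω ω' e => by
        have e1 := congrArg Prod.fst e
        have e2 := congrArg Prod.snd e
        simp only at e1 e2
        simp [e1, e2, h e2])
      (fun ω ω' e => by simp only [Prod.mk.injEq] at e ⊢; exact ⟨e.1, e.2.1⟩)] at this
  linarith

/-- Removing `C` from the observation raises the conditional entropy by at most the entropy of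
`C`. -/
lemma condEntropy_le_condEntropy_prod_add [Fintype α] [Fintype β] [Fintype γ]
    (hA : MeasurableFibers A) (hB : MeasurableFibers B) (hC : MeasurableFibers C) :
    condEntropy μ A B ≤
      condEntropy μ A (fun ω => (B ω, C ω)) + Fintype.card γ / Real.log 2 := by
  rw [condEntropy_eq hA hB, condEntropy_eq hA (hB.prodMk hC), ← add_div]
  refine div_le_div_of_nonneg_right ?_ log_two_pos.le
  have h1 := entropy_prod_le (μ := μ) hB hC
  have h2 := entropy_le_card μ C
  have h3 : entropy μ (fun ω => (A ω, B ω)) ≤ entropy μ (fun ω => (A ω, B ω, C ω)) :=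
    entropy_le_of_factorsThrough (hA.prodMk (hB.prodMk hC)) fun ω ω' e => by
      simp only [Prod.mk.injEq] at e ⊢
      exact ⟨e.1, e.2.1⟩
  linarith

/-- The chain rule. -/
lemma condEntropy_prod [Fintype α] [Fintype β] [Fintype γ]
    (hA : MeasurableFibers A) (hB : MeasurableFibers B) (hC : MeasurableFibers C) :
    condEntropy μ (fun ω => (A ω, B ω)) C =
      condEntropy μ A C + condEntropy μ B (fun ω => (A ω, C ω)) := by
  rw [condEntropy_eq (hA.prodMk hB) hC, condEntropy_eq hA hC, condEntropy_eq hB (hA.prodMk hC),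
    entropy_congr (μ := μ) (A := fun ω => ((A ω, B ω), C ω)) (B := fun ω => (B ω, A ω, C ω))
      ((hA.prodMk hB).prodMk hC)
      (fun ω ω' e => by simp only [Prod.mk.injEq] at e ⊢; tauto)
      (fun ω ω' e => by simp only [Prod.mk.injEq] at e ⊢; tauto)]
  ring

lemma condEntropy_congr [Fintype α] [Fintype β] [Fintype γ] [Fintype δ] {D : Ω → δ}
    (hA : MeasurableFibers A) (hB : MeasurableFibers B)
    (h₁ : (fun ω => (C ω, D ω)).FactorsThrough fun ω => (A ω, B ω))
    (h₂ : (fun ω => (A ω, B ω)).FactorsThrough fun ω => (C ω, D ω))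
    (h₃ : D.FactorsThrough B) (h₄ : B.FactorsThrough D) :
    condEntropy μ C D = condEntropy μ A B := by
  have hCD := (hA.prodMk hB).of_factorsThrough h₁
  rw [condEntropy_eq hA hB, condEntropy_eq (hCD.comp Prod.fst) (hCD.comp Prod.snd),
    entropy_congr (hA.prodMk hB) h₁ h₂, entropy_congr hB h₃ h₄]

/-- The conditional entropy of a pair is at most the sum of the conditional entropies, each one
given a part of the observation. -/
lemma condEntropy_prod_le [Fintype α] [Fintype β] [Fintype γ] [Fintype δ] {D : Ω → δ}
    (hA : MeasurableFibers A) (hB : MeasurableFibers B) (hC : MeasurableFibers C)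
    (hD : MeasurableFibers D) :
    condEntropy μ (fun ω => (A ω, B ω)) (fun ω => (C ω, D ω)) ≤
      condEntropy μ A C + condEntropy μ B D := by
  rw [condEntropy_prod hA hB (hC.prodMk hD)]
  exact add_le_add
    (condEntropy_le_of_factorsThrough hA (hC.prodMk hD) fun _ _ e => congrArg Prod.fst e)
    (condEntropy_le_of_factorsThrough hB (hA.prodMk (hC.prodMk hD))
      fun _ _ e => congrArg (fun x => x.2.2) e)

end Entropy

/-! ### Entropy of a binary variable compared with K and Z -/

section BinaryEntropy

variable {Ω : Type*} [MeasurableSpace Ω] {β : Type*} [Fintype β]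
  {μ : Measure Ω} [IsProbabilityMeasure μ] {U : Ω → ZMod 2} {Q : Ω → β}

/-- The contribution to the conditional entropy (in nats) of an observation with joint
probabilities `x` and `y`. -/
def pairEntropy (x y : ℝ) : ℝ :=
  x * (Real.log (x + y) - Real.log x) + y * (Real.log (x + y) - Real.log y)

lemma condEntropy_binary (hU : MeasurableFibers U) (hQ : MeasurableFibers Q) :
    condEntropy μ U Q =
      (∑ q, pairEntropy (jointProb μ U Q 0 q) (jointProb μ U Q 1 q)) / Real.log 2 := by
  have hs : ∀ q, law μ Q q = jointProb μ U Q 0 q + jointProb μ U Q 1 q := fun q => by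
    rw [← sum_zmod_two (fun u => jointProb μ U Q u q)]
    simp_rw [jointProb_eq_law]
    exact (sum_law_prod_left hU hQ q).symm
  rw [condEntropy_eq hU hQ]
  congr 1
  simp only [entropy, Fintype.sum_prod_type, hs]
  rw [Finset.sum_comm, ← Finset.sum_sub_distrib]
  refine Finset.sum_congr rfl fun q _ => ?_
  rw [sum_zmod_two]
  simp only [← jointProb_eq_law, Real.negMulLog, pairEntropy]
  ring

/-- With t = √(y/x), the ratio 1 + t² is at most (1 + t)², and log (1 + t) ≤ t. -/
lemma mul_log_sub_log_le {x y : ℝ} (hx : 0 ≤ x) (hy : 0 ≤ y) :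
    x * (Real.log (x + y) - Real.log x) ≤ 2 * √(x * y) := by
  rcases hx.eq_or_lt with h | h
  · simp [← h]
  · have hr : 0 < 1 + √(y / x) := by positivity
    rw [← Real.log_div (by positivity) h.ne']
    have h1 : (x + y) / x ≤ (1 + √(y / x)) ^ 2 := by
      have h2 : 0 ≤ √(y / x) := Real.sqrt_nonneg _
      have h3 : √(y / x) ^ 2 = y / x := Real.sq_sqrt (by positivity)
      rw [add_div, div_self h.ne']
      nlinarith
    have h2 : Real.log ((x + y) / x) ≤ 2 * √(y / x) := by
      refine (Real.log_le_log (by positivity) h1).trans ?_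
      rw [Real.log_pow]
      have := Real.log_le_sub_one_of_pos hr
      push_cast
      linarith
    refine (mul_le_mul_of_nonneg_left h2 hx).trans (le_of_eq ?_)
    have : x * √(y / x) = √(x * y) := by
      rw [show x * y = x ^ 2 * (y / x) by field_simp, Real.sqrt_mul (by positivity),
        Real.sqrt_sq hx]
    linarith

lemma pairEntropy_le {x y : ℝ} (hx : 0 ≤ x) (hy : 0 ≤ y) : pairEntropy x y ≤ 4 * √(x * y) := by
  have h1 := mul_log_sub_log_le hx hy
  have h2 := mul_log_sub_log_le hy hx
  rw [add_comm y x, mul_comm y x] at h2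
  unfold pairEntropy
  linarith

/-- By concavity the graph lies above its chord from 0 to 1/2. -/
lemma two_mul_log_two_le_binEntropy {p : ℝ} (h0 : 0 ≤ p) (h1 : p ≤ 1 / 2) :
    2 * p * Real.log 2 ≤ Real.binEntropy p := by
  have hc := Real.strictConcave_binEntropy.concaveOn.2
  have := hc (by simp : (0 : ℝ) ∈ Set.Icc (0 : ℝ) 1)
    (by constructor <;> norm_num : (2⁻¹ : ℝ) ∈ Set.Icc (0 : ℝ) 1)
    (by linarith : 0 ≤ 1 - 2 * p) (by linarith : 0 ≤ 2 * p) (by ring)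
  simp only [smul_eq_mul, Real.binEntropy_zero, Real.binEntropy_two_inv, mul_zero, zero_add] at this
  rwa [show 2 * p * (2⁻¹ : ℝ) = p by ring] at this

lemma pairEntropy_eq {x y : ℝ} (hx : 0 < x) (hy : 0 < y) :
    pairEntropy x y = (x + y) * Real.binEntropy (x / (x + y)) := by
  have e1 : 1 - x / (x + y) = y / (x + y) := by field_simp; ring
  rw [Real.binEntropy, e1, Real.log_inv, Real.log_inv, Real.log_div hx.ne' (by positivity),
    Real.log_div hy.ne' (by positivity)]
  unfold pairEntropy
  field_simp
  ring

lemma pairEntropy_le_log_two {x y : ℝ} (hx : 0 ≤ x) (hy : 0 ≤ y) :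
    pairEntropy x y ≤ (x + y) * Real.log 2 := by
  have h0 : 0 ≤ (x + y) * Real.log 2 := mul_nonneg (add_nonneg hx hy) log_two_pos.le
  rcases hx.eq_or_lt with h | h
  · simpa [← h, pairEntropy] using h0
  rcases hy.eq_or_lt with h' | h'
  · simpa [← h', pairEntropy] using h0
  rw [pairEntropy_eq h h']
  exact mul_le_mul_of_nonneg_left Real.binEntropy_le_log_two (by positivity)

lemma two_mul_log_two_le_pairEntropy {x y : ℝ} (hx : 0 ≤ x) (hxy : x ≤ y) :
    2 * x * Real.log 2 ≤ pairEntropy x y := by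
  rcases hx.eq_or_lt with h | h
  · simp [← h, pairEntropy]
  · have hy := h.trans_le hxy
    have hp := two_mul_log_two_le_binEntropy (p := x / (x + y)) (by positivity) (by
      rw [div_le_div_iff₀ (by positivity) (by norm_num)]
      linarith)
    rw [pairEntropy_eq h hy]
    refine le_trans (le_of_eq ?_) (mul_le_mul_of_nonneg_left hp (by positivity : 0 ≤ x + y))
    field_simp

lemma log_two_mul_le_pairEntropy {x y : ℝ} (hx : 0 ≤ x) (hy : 0 ≤ y) :
    (x + y - |x - y|) * Real.log 2 ≤ pairEntropy x y := by
  rcases le_total x y with h | h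
  · rw [abs_of_nonpos (by linarith)]
    convert two_mul_log_two_le_pairEntropy hx h using 2
    ring
  · rw [abs_of_nonneg (by linarith)]
    have := two_mul_log_two_le_pairEntropy hy h
    unfold pairEntropy at this ⊢
    rw [add_comm y x] at this
    linarith

lemma one_sub_tvParam_le_condEntropy (hU : MeasurableFibers U) (hQ : MeasurableFibers Q) :
    1 - tvParam μ U Q ≤ condEntropy μ U Q := by
  rw [condEntropy_binary hU hQ, le_div_iff₀ log_two_pos, ← sum_jointProb_binary (μ := μ) hU hQ,
    tvParam, ← Finset.sum_sub_distrib, Finset.sum_mul]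
  exact Finset.sum_le_sum fun q _ =>
    log_two_mul_le_pairEntropy (jointProb_nonneg _ _ _ _ _) (jointProb_nonneg _ _ _ _ _)

lemma condEntropy_le_bhattacharyya (hU : MeasurableFibers U) (hQ : MeasurableFibers Q) :
    condEntropy μ U Q ≤ 2 / Real.log 2 * bhattacharyya μ U Q := by
  rw [condEntropy_binary hU hQ, div_mul_eq_mul_div]
  refine div_le_div_of_nonneg_right ?_ log_two_pos.le
  rw [bhattacharyya, ← mul_assoc, Finset.mul_sum]
  refine Finset.sum_le_sum fun q _ => ?_
  have := pairEntropy_le (jointProb_nonneg μ U Q 0 q) (jointProb_nonneg μ U Q 1 q)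
  linarith

/-- Z² ≤ (1 - K)(1 + K) ≤ 2(1 - K) ≤ 2H. -/
lemma bhattacharyya_le_sqrt_condEntropy (hU : MeasurableFibers U) (hQ : MeasurableFibers Q) :
    bhattacharyya μ U Q ≤ √(2 * condEntropy μ U Q) := by
  refine (bhattacharyya_le_sqrt hU hQ).trans ?_
  rw [← Real.sqrt_mul (by linarith [tvParam_le_one (μ := μ) hU hQ])]
  refine Real.sqrt_le_sqrt ?_
  have h1 := one_sub_tvParam_le_condEntropy (μ := μ) hU hQ
  have h2 := tvParam_le_one (μ := μ) hU hQ
  have h3 := tvParam_nonneg μ U Q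
  nlinarith

lemma condEntropy_binary_le_one (hU : MeasurableFibers U) (hQ : MeasurableFibers Q) :
    condEntropy μ U Q ≤ 1 := by
  rw [condEntropy_binary hU hQ, div_le_one log_two_pos, ← one_mul (Real.log 2),
    ← sum_jointProb_binary (μ := μ) hU hQ, Finset.sum_mul]
  exact Finset.sum_le_sum fun q _ =>
    pairEntropy_le_log_two (jointProb_nonneg _ _ _ _ _) (jointProb_nonneg _ _ _ _ _)

end BinaryEntropy

/-! ### The recursive structure of the polar transform -/

section Recursion

/-- The index whose last binary digit is `c` and whose other digits are those of `j`. -/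
def childIndex {n : ℕ} (j : Fin (2 ^ n)) (c : Fin 2) : Fin (2 ^ (n + 1)) :=
  finFunctionFinEquiv (Fin.cons c (digit j) : Fin (n + 1) → Fin 2)

/-- The index of entry `i` of the first half (`b = 0`) or the second half (`b = 1`). -/
def halfIndex {n : ℕ} (i : Fin (2 ^ n)) (b : Fin 2) : Fin (2 ^ (n + 1)) :=
  finFunctionFinEquiv (Fin.snoc (digit i) b : Fin (n + 1) → Fin 2)

lemma digit_injective {n : ℕ} : Function.Injective (digit : Fin (2 ^ n) → Fin n → Fin 2) :=
  finFunctionFinEquiv.symm.injective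

lemma val_eq_sum_digit {n : ℕ} (i : Fin (2 ^ n)) :
    (i : ℕ) = ∑ k : Fin n, (digit i k : ℕ) * 2 ^ (k : ℕ) := by
  conv_lhs => rw [← finFunctionFinEquiv.apply_symm_apply i]
  rw [finFunctionFinEquiv_apply]
  rfl

lemma childIndex_val {n : ℕ} (j : Fin (2 ^ n)) (c : Fin 2) :
    (childIndex j c : ℕ) = 2 * j + c := by
  rw [childIndex, finFunctionFinEquiv_apply, Fin.sum_univ_succ, val_eq_sum_digit j,
    Finset.mul_sum, add_comm]
  simp only [Fin.cons_succ, Fin.cons_zero, Fin.val_succ, Fin.val_zero, pow_zero, mul_one]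
  congr 1
  exact Finset.sum_congr rfl fun k _ => by ring

lemma halfIndex_val {n : ℕ} (i : Fin (2 ^ n)) (b : Fin 2) :
    (halfIndex i b : ℕ) = i + 2 ^ n * b := by
  rw [halfIndex, finFunctionFinEquiv_apply, Fin.sum_univ_castSucc, val_eq_sum_digit i]
  simp [mul_comm]

lemma digit_childIndex {n : ℕ} (j : Fin (2 ^ n)) (c : Fin 2) :
    digit (childIndex j c) = Fin.cons c (digit j) :=
  finFunctionFinEquiv.symm_apply_apply _

lemma digit_halfIndex {n : ℕ} (i : Fin (2 ^ n)) (b : Fin 2) :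
    digit (halfIndex i b) = Fin.snoc (digit i) b :=
  finFunctionFinEquiv.symm_apply_apply _

lemma childIndex_bijective (n : ℕ) :
    Function.Bijective fun p : Fin (2 ^ n) × Fin 2 => childIndex p.1 p.2 := by
  rw [Fintype.bijective_iff_injective_and_card]
  refine ⟨fun p q h => ?_, by simp [pow_succ]⟩
  have := Fin.cons_injective2 (finFunctionFinEquiv.injective h)
  exact Prod.ext (digit_injective this.2) this.1

lemma halfIndex_bijective (n : ℕ) :
    Function.Bijective fun p : Fin (2 ^ n) × Fin 2 => halfIndex p.1 p.2 := by
  rw [Fintype.bijective_iff_injective_and_card]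
  refine ⟨fun p q h => ?_, by simp [pow_succ]⟩
  have := Fin.snoc_injective2 (finFunctionFinEquiv.injective h)
  exact Prod.ext (digit_injective this.1) this.2

lemma sum_childIndex {M : Type*} [AddCommMonoid M] {n : ℕ} (f : Fin (2 ^ (n + 1)) → M) :
    ∑ i, f i = ∑ j : Fin (2 ^ n), (f (childIndex j 0) + f (childIndex j 1)) := by
  rw [← (childIndex_bijective n).sum_comp f, Fintype.sum_prod_type]
  simp [Fin.sum_univ_two]

lemma sum_halfIndex {M : Type*} [AddCommMonoid M] {n : ℕ} (f : Fin (2 ^ (n + 1)) → M) :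
    ∑ i, f i = ∑ j : Fin (2 ^ n), (f (halfIndex j 0) + f (halfIndex j 1)) := by
  rw [← (halfIndex_bijective n).sum_comp f, Fintype.sum_prod_type]
  simp [Fin.sum_univ_two]

lemma polarIndex_succ (b : ℕ → Fin 2) (n : ℕ) :
    polarIndex b (n + 1) = childIndex (polarIndex b n) (b n) := by
  unfold polarIndex childIndex
  congr 1
  funext k
  refine Fin.cases ?_ (fun k => ?_) k
  · simp
  · simp only [Fin.cons_succ, digit, Equiv.symm_apply_apply]
    congr 1
    simp [Fin.val_rev]

lemma polarMatrix_apply (n : ℕ) (i j : Fin (2 ^ n)) :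
    polarMatrix n i j = ∏ k : Fin n, G2 (digit i k.rev) (digit j k) := by
  rw [polarMatrix, Matrix.mul_apply]
  simp only [bitReversal, kroneckerPower, Matrix.of_apply, ite_mul, one_mul, zero_mul,
    Finset.sum_ite_eq', Finset.mem_univ, if_true]
  simp [digit, bitReverse]

/-- Bit reversal pairs the most significant digit of the row with the least significant digit of the
column. Hence the inputs split into halves of the block while the outputs split by the parity of the
0-based index. -/
lemma polarMatrix_halfIndex_childIndex {n : ℕ} (i j : Fin (2 ^ n)) (b c : Fin 2) :
    polarMatrix (n + 1) (halfIndex i b) (childIndex j c) = G2 b c * polarMatrix n i j := by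
  rw [polarMatrix_apply, polarMatrix_apply, Fin.prod_univ_succ, digit_childIndex, digit_halfIndex]
  simp [Fin.rev_succ]

variable {Ω : Type*} {𝒴 : Type*}

lemma polarU_childIndex (X : ℤ → Ω → ZMod 2) (n : ℕ) (ω : Ω) (j : Fin (2 ^ n)) (c : Fin 2) :
    polarU X (n + 1) ω (childIndex j c) =
      polarU X n ω j * G2 0 c + polarU (fun k => X (k + ((2 ^ n : ℕ) : ℤ))) n ω j := by
  have hG : G2 1 c = 1 := by fin_cases c <;> simp [G2]
  simp only [polarU, Matrix.vecMul, dotProduct]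
  rw [sum_halfIndex, Finset.sum_mul, ← Finset.sum_add_distrib]
  refine Finset.sum_congr rfl fun i _ => ?_
  rw [polarMatrix_halfIndex_childIndex, polarMatrix_halfIndex_childIndex, hG]
  simp only [block, halfIndex_val]
  push_cast
  simp only [Fin.val_zero, Fin.val_one, Nat.cast_zero, Nat.cast_one, mul_zero, add_zero, mul_one,
    one_mul]
  rw [show ((i : ℕ) : ℤ) + 2 ^ n + 1 = (i : ℕ) + 1 + 2 ^ n by ring]
  ring

lemma polarU_childIndex_zero (X : ℤ → Ω → ZMod 2) (n : ℕ) (ω : Ω) (j : Fin (2 ^ n)) :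
    polarU X (n + 1) ω (childIndex j 0) =
      polarU X n ω j + polarU (fun k => X (k + ((2 ^ n : ℕ) : ℤ))) n ω j := by
  rw [polarU_childIndex]
  simp [G2]

lemma polarU_childIndex_one (X : ℤ → Ω → ZMod 2) (n : ℕ) (ω : Ω) (j : Fin (2 ^ n)) :
    polarU X (n + 1) ω (childIndex j 1) = polarU (fun k => X (k + ((2 ^ n : ℕ) : ℤ))) n ω j := by
  rw [polarU_childIndex]
  simp [G2]

/-- The alphabet of Q_i depends on `i` and `n`. Stating when two outcomes give the same observation
avoids bijections between these alphabets and is the form that `FactorsThrough` needs. -/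
lemma polarQ_eq_iff (X : ℤ → Ω → ZMod 2) (Y : ℤ → Ω → 𝒴) (n : ℕ) (i : Fin (2 ^ n)) (ω ω' : Ω) :
    polarQ X Y n i ω = polarQ X Y n i ω' ↔
      (∀ k < i, polarU X n ω k = polarU X n ω' k) ∧ block Y (2 ^ n) ω = block Y (2 ^ n) ω' := by
  rw [polarQ, polarQ, Prod.mk.injEq, funext_iff]
  refine and_congr_left fun _ => ⟨fun h k hk => h ⟨k, hk⟩, fun h k => h _ ?_⟩
  exact Fin.lt_def.2 k.2

lemma block_add_eq_iff (Y : ℤ → Ω → 𝒴) (N M : ℕ) (ω ω' : Ω) :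
    block Y (N + M) ω = block Y (N + M) ω' ↔
      block Y N ω = block Y N ω' ∧
        block (fun k => Y (k + (N : ℤ))) M ω = block (fun k => Y (k + (N : ℤ))) M ω' := by
  have h1 : ∀ (i : Fin M) (ω : Ω), block Y (N + M) ω (Fin.natAdd N i) =
      block (fun k => Y (k + (N : ℤ))) M ω i := fun i ω => by
    simp only [block, Fin.val_natAdd]
    push_cast
    rw [add_comm (N : ℤ), add_right_comm]
  constructor
  · intro h
    exact ⟨funext fun i => congrFun h (Fin.castAdd M i),
      funext fun i => by rw [← h1, ← h1, h]⟩
  · rintro ⟨e0, e1⟩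
    funext k
    refine Fin.addCases (fun i => ?_) (fun i => ?_) k
    · exact congrFun e0 i
    · rw [h1, h1, e1]

lemma block_succ_eq_iff (Y : ℤ → Ω → 𝒴) (n : ℕ) (ω ω' : Ω) :
    block Y (2 ^ (n + 1)) ω = block Y (2 ^ (n + 1)) ω' ↔
      block Y (2 ^ n) ω = block Y (2 ^ n) ω' ∧
        block (fun k => Y (k + ((2 ^ n : ℕ) : ℤ))) (2 ^ n) ω =
          block (fun k => Y (k + ((2 ^ n : ℕ) : ℤ))) (2 ^ n) ω' := by
  rw [pow_succ, mul_two]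
  exact block_add_eq_iff Y _ _ ω ω'

lemma childIndex_lt_childIndex_zero {n : ℕ} {j i : Fin (2 ^ n)} {c : Fin 2} :
    childIndex j c < childIndex i 0 ↔ j < i := by
  rw [Fin.lt_def, Fin.lt_def, childIndex_val, childIndex_val]
  have := c.2
  simp only [Fin.val_zero]
  omega

lemma childIndex_lt_childIndex_one {n : ℕ} {j i : Fin (2 ^ n)} {c : Fin 2} :
    childIndex j c < childIndex i 1 ↔ j < i ∨ (j = i ∧ c = 0) := by
  rw [Fin.lt_def, Fin.lt_def, childIndex_val, childIndex_val, Fin.ext_iff, Fin.ext_iff]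
  have := c.2
  simp only [Fin.val_zero, Fin.val_one]
  omega

lemma polarU_children_eq_iff (X : ℤ → Ω → ZMod 2) (n : ℕ) (j : Fin (2 ^ n)) (ω ω' : Ω) :
    (∀ c, polarU X (n + 1) ω (childIndex j c) = polarU X (n + 1) ω' (childIndex j c)) ↔
      polarU X n ω j = polarU X n ω' j ∧
        polarU (fun k => X (k + ((2 ^ n : ℕ) : ℤ))) n ω j =
          polarU (fun k => X (k + ((2 ^ n : ℕ) : ℤ))) n ω' j := by
  rw [Fin.forall_fin_two, polarU_childIndex_zero, polarU_childIndex_zero, polarU_childIndex_one,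
    polarU_childIndex_one]
  constructor
  · rintro ⟨h0, h1⟩
    rw [h1] at h0
    exact ⟨add_right_cancel h0, h1⟩
  · rintro ⟨h0, h1⟩
    rw [h0, h1]
    exact ⟨rfl, rfl⟩

/-- The indices before the even child of `i` are exactly the children of all `j < i`, and the two
children of `j` carry the same information as entry `j` of both half blocks. -/
lemma polarQ_childIndex_zero_eq_iff (X : ℤ → Ω → ZMod 2) (Y : ℤ → Ω → 𝒴) (n : ℕ)
    (i : Fin (2 ^ n)) (ω ω' : Ω) :
    polarQ X Y (n + 1) (childIndex i 0) ω = polarQ X Y (n + 1) (childIndex i 0) ω' ↔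
      polarQ X Y n i ω = polarQ X Y n i ω' ∧
        polarQ (fun k => X (k + ((2 ^ n : ℕ) : ℤ))) (fun k => Y (k + ((2 ^ n : ℕ) : ℤ))) n i ω =
          polarQ (fun k => X (k + ((2 ^ n : ℕ) : ℤ)))
            (fun k => Y (k + ((2 ^ n : ℕ) : ℤ))) n i ω' := by
  rw [polarQ_eq_iff, polarQ_eq_iff, polarQ_eq_iff, block_succ_eq_iff, and_and_and_comm]
  refine and_congr_left fun _ => ?_
  rw [← forall₂_and]
  simp_rw [← polarU_children_eq_iff]
  constructor
  · exact fun h j hj c => h _ (childIndex_lt_childIndex_zero.2 hj)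
  · intro h k hk
    obtain ⟨⟨j, c⟩, rfl⟩ := (childIndex_bijective n).2 k
    exact h j (childIndex_lt_childIndex_zero.1 hk) c

lemma polarQ_childIndex_one_eq_iff (X : ℤ → Ω → ZMod 2) (Y : ℤ → Ω → 𝒴) (n : ℕ)
    (i : Fin (2 ^ n)) (ω ω' : Ω) :
    polarQ X Y (n + 1) (childIndex i 1) ω = polarQ X Y (n + 1) (childIndex i 1) ω' ↔
      polarU X (n + 1) ω (childIndex i 0) = polarU X (n + 1) ω' (childIndex i 0) ∧
        polarQ X Y (n + 1) (childIndex i 0) ω = polarQ X Y (n + 1) (childIndex i 0) ω' := by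
  rw [polarQ_eq_iff, polarQ_eq_iff, ← and_assoc]
  refine and_congr_left fun _ => ?_
  constructor
  · exact fun h => ⟨h _ (childIndex_lt_childIndex_one.2 (.inr ⟨rfl, rfl⟩)),
      fun k hk => h k (hk.trans (childIndex_lt_childIndex_one.2 (.inr ⟨rfl, rfl⟩)))⟩
  · rintro ⟨h0, h⟩ k hk
    obtain ⟨⟨j, c⟩, rfl⟩ := (childIndex_bijective n).2 k
    rcases childIndex_lt_childIndex_one.1 hk with hj | ⟨rfl, rfl⟩
    · exact h _ (childIndex_lt_childIndex_zero.2 hj)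
    · exact h0

/-- The polar transform is invertible. -/
lemma polarU_eq_iff (X : ℤ → Ω → ZMod 2) (n : ℕ) (ω ω' : Ω) :
    polarU X n ω = polarU X n ω' ↔ block X (2 ^ n) ω = block X (2 ^ n) ω' := by
  refine ⟨fun h => ?_, fun h => by rw [polarU, polarU, h]⟩
  induction n generalizing X with
  | zero =>
    funext k
    have := congrFun h k
    simp only [polarU, Matrix.vecMul, dotProduct, polarMatrix_apply, Finset.univ_eq_empty,
      Finset.prod_empty, mul_one] at this
    have hk : ∀ j : Fin (2 ^ 0), j = k := fun j => Subsingleton.elim (α := Fin 1) j k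
    rwa [Finset.sum_eq_single k (fun j _ hj => absurd (hk j) hj)
        (fun h => absurd (Finset.mem_univ k) h),
      Finset.sum_eq_single k (fun j _ hj => absurd (hk j) hj)
        (fun h => absurd (Finset.mem_univ k) h)] at this
  | succ n ih =>
    have hc := fun j => (polarU_children_eq_iff X n j ω ω').1 fun c => congrFun h _
    exact (block_succ_eq_iff X n ω ω').2
      ⟨ih X (funext fun j => (hc j).1), ih _ (funext fun j => (hc j).2)⟩

end Recursion

/-! ### Windows of a FAIM process -/

section Windows

variable {Ω : Type*} [MeasurableSpace Ω] {𝒴 𝒮 : Type*}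

/-- `(X_{m+1}^{m+N}, Y_{m+1}^{m+N}, S_m, S_{m+N})`. -/
def window (X : ℤ → Ω → ZMod 2) (Y : ℤ → Ω → 𝒴) (S : ℤ → Ω → 𝒮) (m : ℤ) (N : ℕ) (ω : Ω) :
    (Fin N → ZMod 2) × (Fin N → 𝒴) × 𝒮 × 𝒮 :=
  (block (fun j => X (j + m)) N ω, block (fun j => Y (j + m)) N ω, S m ω, S (m + N) ω)

lemma window_zero (X : ℤ → Ω → ZMod 2) (Y : ℤ → Ω → 𝒴) (S : ℤ → Ω → 𝒮) (N : ℕ) (ω : Ω) :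
    window X Y S 0 N ω = (block X N ω, block Y N ω, S 0 ω, S N ω) := by
  simp [window]

variable {μ : Measure Ω} [IsProbabilityMeasure μ]
  [Fintype 𝒴] [MeasurableSpace 𝒴] [DiscreteMeasurableSpace 𝒴]
  [Fintype 𝒮] [MeasurableSpace 𝒮] [DiscreteMeasurableSpace 𝒮]
  {X : ℤ → Ω → ZMod 2} {Y : ℤ → Ω → 𝒴} {S : ℤ → Ω → 𝒮}

namespace IsFAIM

lemma measurableFibers_window (h : IsFAIM μ X Y S) (m : ℤ) (N : ℕ) :
    MeasurableFibers (window X Y S m N) :=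
  MeasurableFibers.prodMk (.pi fun _ => (h.measurable_X _).measurableFibers)
    (.prodMk (.pi fun _ => (h.measurable_Y _).measurableFibers)
      (.prodMk (h.measurable_S _).measurableFibers (h.measurable_S _).measurableFibers))

lemma measurableFibers_S (h : IsFAIM μ X Y S) (m : ℤ) : MeasurableFibers (S m) :=
  (h.measurable_S m).measurableFibers

lemma law_window (h : IsFAIM μ X Y S) (m : ℤ) (N : ℕ) :
    law μ (window X Y S m N) = law μ (window X Y S 0 N) := by
  funext w
  let F : (ℤ → ZMod 2 × 𝒴 × 𝒮) → (Fin N → ZMod 2) × (Fin N → 𝒴) × 𝒮 × 𝒮 := fun p =>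
    (fun k => (p ((k : ℤ) + 1)).1, fun k => (p ((k : ℤ) + 1)).2.1, (p 0).2.2, (p N).2.2)
  have hF : Measurable F := by fun_prop
  have := (h.stationary m).measure_mem_eq (hF (measurableSet_singleton w))
  unfold law Measure.real
  congr 1
  convert this using 2
  · ext ω
    simp only [window, F, Set.mem_preimage, Set.mem_singleton_iff, zero_add, add_comm m]
    rfl
  · ext ω
    simp only [window_zero, F, Set.mem_preimage, Set.mem_singleton_iff]
    rfl

lemma law_comp_window {α : Type*} (h : IsFAIM μ X Y S) (m : ℤ) (N : ℕ)
    (Φ : (Fin N → ZMod 2) × (Fin N → 𝒴) × 𝒮 × 𝒮 → α) :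
    law μ (fun ω => Φ (window X Y S m N ω)) = law μ (fun ω => Φ (window X Y S 0 N ω)) := by
  classical
  funext a
  rw [law_comp (h.measurableFibers_window m N), law_comp (h.measurableFibers_window 0 N),
    h.law_window]

/-- Two consecutive windows are conditionally independent given the state between them. -/
lemma law_two_windows {α β : Type*} (h : IsFAIM μ X Y S) {N M : ℕ} (hN : 0 < N) (hM : 0 < M)
    (Φ : (Fin N → ZMod 2) × (Fin N → 𝒴) × 𝒮 × 𝒮 → α)
    (Ψ : (Fin M → ZMod 2) × (Fin M → 𝒴) × 𝒮 × 𝒮 → β) (a : α) (s : 𝒮) (b : β) :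
    law μ (fun ω => (Φ (window X Y S 0 N ω), S N ω, Ψ (window X Y S N M ω))) (a, s, b) *
        law μ (S N) s =
      law μ (fun ω => (Φ (window X Y S 0 N ω), S N ω)) (a, s) *
        law μ (fun ω => (Ψ (window X Y S N M ω), S N ω)) (b, s) := by
  let F : (Set.Ici ((N : ℤ) + 1) → ZMod 2 × 𝒴 × 𝒮) → (Fin M → ZMod 2) × (Fin M → 𝒴) × 𝒮 :=
    fun p => (fun k => (p ⟨(k : ℤ) + 1 + N, by simp only [Set.mem_Ici]; omega⟩).1,
      fun k => (p ⟨(k : ℤ) + 1 + N, by simp only [Set.mem_Ici]; omega⟩).2.1,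
      (p ⟨(N : ℤ) + M, by simp only [Set.mem_Ici]; omega⟩).2.2)
  -- The past carries S_{l-1}, so S_0 is its state at `l = 1`, which lies in the range because `0 <
  -- N`. The middle state is absent from `F` and `G`: it equals `s` on the conditioning event.
  let G : (Set.Iio ((N : ℤ) + 1) → ZMod 2 × 𝒴 × 𝒮) → (Fin N → ZMod 2) × (Fin N → 𝒴) × 𝒮 :=
    fun p => (fun k => (p ⟨(k : ℤ) + 1, by simp only [Set.mem_Iio]; omega⟩).1,
      fun k => (p ⟨(k : ℤ) + 1, by simp only [Set.mem_Iio]; omega⟩).2.1,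
      (p ⟨1, by simp only [Set.mem_Iio]; omega⟩).2.2)
  have hF : Measurable F := by fun_prop
  have hG : Measurable G := by fun_prop
  have key := (h.markov (N + 1) s).measure_inter_preimage_eq_mul _ _
    (hF (Set.toFinite {w | Ψ (w.1, w.2.1, s, w.2.2) = b}).measurableSet)
    (hG (Set.toFinite {w | Φ (w.1, w.2.1, w.2.2, s) = a}).measurableSet)
  rw [add_sub_cancel_right] at key
  set E₁ := (fun ω (k : Set.Ici ((N : ℤ) + 1)) => (X k ω, Y k ω, S k ω)) ⁻¹'
    (F ⁻¹' {w | Ψ (w.1, w.2.1, s, w.2.2) = b})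
  set E₂ := (fun ω (l : Set.Iio ((N : ℤ) + 1)) => (X l ω, Y l ω, S ((l : ℤ) - 1) ω)) ⁻¹'
    (G ⁻¹' {w | Φ (w.1, w.2.1, w.2.2, s) = a})
  have hS : MeasurableSet (S N ⁻¹' {s}) := h.measurableFibers_S N s
  have e1 : (fun ω => (Φ (window X Y S 0 N ω), S N ω, Ψ (window X Y S N M ω))) ⁻¹' {(a, s, b)} =
      S N ⁻¹' {s} ∩ (E₁ ∩ E₂) := by
    simp only [window_zero]
    ext ω
    simp only [Set.mem_preimage, Set.mem_singleton_iff, Prod.mk.injEq, Set.mem_inter_iff, E₁, E₂,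
      F, G, window, Set.mem_ofPred_eq, sub_self]
    constructor
    · rintro ⟨rfl, rfl, rfl⟩
      exact ⟨rfl, rfl, rfl⟩
    · rintro ⟨rfl, rfl, rfl⟩
      exact ⟨rfl, rfl, rfl⟩
  have e2 : (fun ω => (Φ (window X Y S 0 N ω), S N ω)) ⁻¹' {(a, s)} = S N ⁻¹' {s} ∩ E₂ := by
    simp only [window_zero]
    ext ω
    simp only [Set.mem_preimage, Set.mem_singleton_iff, Prod.mk.injEq, Set.mem_inter_iff, E₂,
      G, Set.mem_ofPred_eq, sub_self]
    constructor
    · rintro ⟨rfl, rfl⟩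
      exact ⟨rfl, rfl⟩
    · rintro ⟨rfl, rfl⟩
      exact ⟨rfl, rfl⟩
  have e3 : (fun ω => (Ψ (window X Y S N M ω), S N ω)) ⁻¹' {(b, s)} = S N ⁻¹' {s} ∩ E₁ := by
    ext ω
    simp only [Set.mem_preimage, Set.mem_singleton_iff, Prod.mk.injEq, Set.mem_inter_iff, E₁,
      F, window, Set.mem_ofPred_eq]
    constructor
    · rintro ⟨rfl, rfl⟩
      exact ⟨rfl, rfl⟩
    · rintro ⟨rfl, rfl⟩
      exact ⟨rfl, rfl⟩
  unfold law Measure.real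
  rw [e1, e2, e3, ← ENNReal.toReal_mul, ← ENNReal.toReal_mul]
  congr 1
  rw [← cond_mul_eq_inter hS, ← cond_mul_eq_inter hS, ← cond_mul_eq_inter hS, key]
  ring

/-! #### Transition probabilities -/

/-- `P(S_0 = a, S_N = b)`. -/
def _root_.Polar.pairLaw (μ : Measure Ω) (S : ℤ → Ω → 𝒮) (N : ℕ) (a b : 𝒮) : ℝ :=
  law μ (fun ω => (S 0 ω, S N ω)) (a, b)

lemma law_S (h : IsFAIM μ X Y S) (m : ℤ) : law μ (S m) = law μ (S 0) :=
  h.law_comp_window m 0 fun w => w.2.2.1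

lemma sum_pairLaw_right (h : IsFAIM μ X Y S) (N : ℕ) (a : 𝒮) :
    ∑ b, pairLaw μ S N a b = law μ (S 0) a :=
  sum_law_prod_right (h.measurableFibers_S 0) (h.measurableFibers_S N) a

lemma sum_pairLaw_left (h : IsFAIM μ X Y S) (N : ℕ) (b : 𝒮) :
    ∑ a, pairLaw μ S N a b = law μ (S 0) b := by
  rw [← h.law_S N]
  exact sum_law_prod_left (h.measurableFibers_S 0) (h.measurableFibers_S N) b

lemma transProb_pos_iff (h : IsFAIM μ X Y S) (N : ℕ) (a b : 𝒮) :
    0 < transProb μ S N a b ↔ 0 < pairLaw μ S N a b := by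
  have e : (fun ω => (S 0 ω, S N ω)) ⁻¹' {(a, b)} = S 0 ⁻¹' {a} ∩ S N ⁻¹' {b} := by
    ext ω
    simp
  unfold transProb pairLaw law Measure.real
  rw [e, ← cond_mul_eq_inter (h.measurableFibers_S 0 a), ENNReal.toReal_mul]
  refine ⟨fun hp => mul_pos hp ?_, fun hp => pos_of_mul_pos_left hp ENNReal.toReal_nonneg⟩
  refine ENNReal.toReal_pos (fun h0 => ?_) (measure_ne_top _ _)
  rw [cond_eq_zero_of_meas_eq_zero h0] at hp
  simp at hp

/-- From a null state all values of `transProb` are zero by convention, so irreducibility excludes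
null states. -/
lemma law_S_pos (h : IsFAIM μ X Y S) (a : 𝒮) : 0 < law μ (S 0) a := by
  obtain ⟨N, -, hN⟩ := h.irreducible a a
  rw [h.transProb_pos_iff] at hN
  rw [← h.sum_pairLaw_right N a]
  exact hN.trans_le (Finset.single_le_sum (f := fun b => pairLaw μ S N a b)
    (fun b _ => law_nonneg _ _ _) (Finset.mem_univ a))

/-- The Chapman–Kolmogorov equation. -/
lemma pairLaw_add (h : IsFAIM μ X Y S) {N M : ℕ} (hN : 0 < N) (hM : 0 < M) (a c : 𝒮) :
    pairLaw μ S (N + M) a c = ∑ b, pairLaw μ S N a b * pairLaw μ S M b c / law μ (S 0) b := by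
  classical
  have e2 : ∀ b, law μ (fun ω => (S (N + M) ω, S N ω)) (c, b) = pairLaw μ S M b c := fun b => by
    have h1 := congrFun (h.law_comp_window N M fun w => (w.2.2.2, w.2.2.1)) (c, b)
    simp only [window_zero] at h1
    refine h1.trans ?_
    rw [pairLaw]
    unfold law
    congr 1
    ext ω
    simp [and_comm]
  have key : ∀ b, law μ (fun ω => (S 0 ω, S N ω, S (N + M) ω)) (a, b, c) =
      pairLaw μ S N a b * pairLaw μ S M b c / law μ (S 0) b := fun b => by
    rw [eq_div_iff (h.law_S_pos b).ne', ← e2 b, ← h.law_S N]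
    exact h.law_two_windows hN hM (fun w => w.2.2.1) (fun w => w.2.2.2) a b c
  simp_rw [← key]
  have := law_comp (μ := μ) (A := fun ω => (S 0 ω, S N ω, S (N + M) ω))
    ((h.measurableFibers_S _).prodMk ((h.measurableFibers_S _).prodMk (h.measurableFibers_S _)))
    (fun x => (x.1, x.2.2)) (a, c)
  rw [pairLaw]
  push_cast
  rw [this]
  simp only [Fintype.sum_prod_type, Prod.mk.injEq, ite_and]
  simp

lemma pairLaw_add_pos (h : IsFAIM μ X Y S) {N M : ℕ} (hN : 0 < N) (hM : 0 < M) {a b c : 𝒮}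
    (h1 : 0 < pairLaw μ S N a b) (h2 : 0 < pairLaw μ S M b c) :
    0 < pairLaw μ S (N + M) a c := by
  rw [h.pairLaw_add hN hM]
  have hb := h.law_S_pos b
  refine lt_of_lt_of_le (by positivity : 0 < pairLaw μ S N a b * pairLaw μ S M b c / law μ (S 0) b)
    (Finset.single_le_sum (f := fun b => pairLaw μ S N a b * pairLaw μ S M b c / law μ (S 0) b)
    (fun b _ => ?_) (Finset.mem_univ b))
  exact div_nonneg (mul_nonneg (law_nonneg _ _ _) (law_nonneg _ _ _)) (law_nonneg _ _ _)

/-- Possible return times are closed under addition and have greatest common divisor 1, so they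
contain all large integers. -/
lemma eventually_pairLaw_self_pos (h : IsFAIM μ X Y S) (a : 𝒮) :
    ∃ n₀ : ℕ, ∀ n, n₀ ≤ n → 0 < n → 0 < pairLaw μ S n a a := by
  set R : Set ℕ := {n | 0 < n ∧ 0 < pairLaw μ S n a a} with hR
  have hd : Nat.setGcd R = 1 := h.aperiodic a _ fun n hn hp =>
    Nat.setGcd_dvd_of_mem ⟨hn, (h.transProb_pos_iff n a a).1 hp⟩
  obtain ⟨n₀, hn₀⟩ := Nat.exists_mem_closure_of_ge R
  have hcl : ∀ m ∈ AddSubmonoid.closure R, m = 0 ∨ m ∈ R := by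
    intro m hm
    induction hm using AddSubmonoid.closure_induction with
    | mem x hx => exact .inr hx
    | zero => exact .inl rfl
    | add x y _ _ hx hy =>
      rcases hx with rfl | hx
      · simpa using hy
      rcases hy with rfl | hy
      · exact .inr (by simpa using hx)
      exact .inr ⟨Nat.add_pos_left hx.1 y, h.pairLaw_add_pos hx.1 hy.1 hx.2 hy.2⟩
  refine ⟨n₀, fun n hn hpos => ?_⟩
  rcases hcl n (hn₀ n hn (by rw [hd]; exact one_dvd n)) with h0 | h0
  · omega
  · exact h0.2

/-- The joint probabilities of two distant states are bounded away from zero. -/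
lemma exists_pairLaw_lower_bound (h : IsFAIM μ X Y S) :
    ∃ ε > 0, ∃ n₀ : ℕ, ∀ n, n₀ ≤ n → ∀ a b, ε ≤ pairLaw μ S n a b := by
  have hpair : ∀ p : 𝒮 × 𝒮, ∃ n₀ : ℕ, ∀ n, n₀ ≤ n → 0 < pairLaw μ S n p.1 p.2 := by
    rintro ⟨a, b⟩
    obtain ⟨n₁, hn₁⟩ := h.eventually_pairLaw_self_pos a
    obtain ⟨k, hk, hkp⟩ := h.irreducible a b
    rw [h.transProb_pos_iff] at hkp
    refine ⟨n₁ + 1 + k, fun n hn => ?_⟩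
    obtain ⟨r, rfl⟩ : ∃ r, n = r + k := ⟨n - k, by omega⟩
    exact h.pairLaw_add_pos (by omega) hk (hn₁ r (by omega) (by omega)) hkp
  choose f hf using hpair
  -- The sum dominates every individual threshold.
  set n₀ := ∑ p, f p with hn₀
  have hpos : ∀ p : 𝒮 × 𝒮, 0 < pairLaw μ S (n₀ + 1) p.1 p.2 := fun p => hf p _
    ((Finset.single_le_sum (f := f) (fun _ _ => Nat.zero_le _) (Finset.mem_univ p)).trans
      (Nat.le_succ _))
  have hne : Nonempty 𝒮 := μ.nonempty_of_neZero.map (S 0)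
  obtain ⟨p₀, hp₀⟩ := Finite.exists_min fun p : 𝒮 × 𝒮 => pairLaw μ S (n₀ + 1) p.1 p.2
  set ε := pairLaw μ S (n₀ + 1) p₀.1 p₀.2
  have hε : 0 < ε := hpos p₀
  -- One factor bounds P(S_0 = a) below, the other the probability of reaching `b` in the last `n₀ +
  -- 1` steps. The threshold `n₀ + 2` leaves a positive number of steps before these, as
  -- Chapman–Kolmogorov requires here.
  refine ⟨ε * ε, mul_pos hε hε, n₀ + 2, fun n hn a b => ?_⟩
  obtain ⟨r, rfl⟩ : ∃ r, n = r + (n₀ + 1) := ⟨n - (n₀ + 1), by omega⟩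
  rw [h.pairLaw_add (by omega) (by omega)]
  have hπ : ε ≤ law μ (S 0) a := by
    rw [← h.sum_pairLaw_right (n₀ + 1) a]
    exact (hp₀ (a, a)).trans (Finset.single_le_sum (f := fun b => pairLaw μ S (n₀ + 1) a b)
      (fun b _ => law_nonneg _ _ _) (Finset.mem_univ a))
  calc ε * ε ≤ law μ (S 0) a * ε := mul_le_mul_of_nonneg_right hπ hε.le
    _ = ∑ c, pairLaw μ S r a c * ε := by rw [← h.sum_pairLaw_right r a, Finset.sum_mul]
    _ ≤ _ := Finset.sum_le_sum fun c _ => by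
      rw [le_div_iff₀ (h.law_S_pos c), mul_assoc]
      refine mul_le_mul_of_nonneg_left ?_ (law_nonneg _ _ _)
      exact (mul_le_of_le_one_right hε.le (law_le_one _ _)).trans (hp₀ (c, b))

end IsFAIM

end Windows

/-! ### Parameters of the sum of two binary random variables -/

section PairStep

variable {Ω : Type*} [MeasurableSpace Ω] {μ : Measure Ω} [IsProbabilityMeasure μ]
  {ρ : Type*} [Fintype ρ] {V W : Ω → ZMod 2} {R : Ω → ρ}

lemma jointProb_add (hV : MeasurableFibers V) (hW : MeasurableFibers W) (hR : MeasurableFibers R)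
    (u : ZMod 2) (r : ρ) :
    jointProb μ (fun ω => V ω + W ω) R u r =
      law μ (fun ω => (V ω, W ω, R ω)) (u, 0, r) +
        law μ (fun ω => (V ω, W ω, R ω)) (u + 1, 1, r) := by
  classical
  rw [jointProb_eq_law, law_comp (A := fun ω => (V ω, W ω, R ω)) (hV.prodMk (hW.prodMk hR))
    (fun x => (x.1 + x.2.1, x.2.2)) (u, r)]
  simp only [Fintype.sum_prod_type, Prod.mk.injEq, ite_and]
  simp only [sum_zmod_two]
  have h2 : (1 : ZMod 2) + 1 = 0 := rfl
  obtain rfl | rfl : u = 0 ∨ u = 1 := by fin_cases u; exacts [.inl rfl, .inr rfl]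
  · simp [h2]
  · simp [h2, add_comm]

lemma jointProb_right_add (μ : Measure Ω) (V W : Ω → ZMod 2) (R : Ω → ρ) (w t : ZMod 2) (r : ρ) :
    jointProb μ W (fun ω => (V ω + W ω, R ω)) w (t, r) =
      law μ (fun ω => (V ω, W ω, R ω)) (t - w, w, r) := by
  unfold jointProb law
  congr 1
  ext ω
  simp only [Prod.mk.injEq, Set.mem_ofPred_eq, Set.mem_preimage, Set.mem_singleton_iff,
    eq_sub_iff_add_eq]
  constructor
  · rintro ⟨rfl, rfl, rfl⟩
    exact ⟨rfl, rfl, rfl⟩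
  · rintro ⟨rfl, rfl, rfl⟩
    exact ⟨rfl, rfl, rfl⟩

lemma tvParam_add (hV : MeasurableFibers V) (hW : MeasurableFibers W) (hR : MeasurableFibers R) :
    tvParam μ (fun ω => V ω + W ω) R =
      ∑ r, |law μ (fun ω => (V ω, W ω, R ω)) (0, 0, r) + law μ (fun ω => (V ω, W ω, R ω)) (1, 1, r)
        - (law μ (fun ω => (V ω, W ω, R ω)) (1, 0, r) +
          law μ (fun ω => (V ω, W ω, R ω)) (0, 1, r))| := by
  unfold tvParam
  simp_rw [jointProb_add hV hW hR]
  rfl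

lemma bhattacharyya_add (hV : MeasurableFibers V) (hW : MeasurableFibers W)
    (hR : MeasurableFibers R) :
    bhattacharyya μ (fun ω => V ω + W ω) R =
      2 * ∑ r, √((law μ (fun ω => (V ω, W ω, R ω)) (0, 0, r) +
          law μ (fun ω => (V ω, W ω, R ω)) (1, 1, r)) *
        (law μ (fun ω => (V ω, W ω, R ω)) (1, 0, r) +
          law μ (fun ω => (V ω, W ω, R ω)) (0, 1, r))) := by
  unfold bhattacharyya
  simp_rw [jointProb_add hV hW hR]
  rfl

lemma tvParam_right_add (μ : Measure Ω) (V W : Ω → ZMod 2) (R : Ω → ρ) :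
    tvParam μ W (fun ω => (V ω + W ω, R ω)) =
      ∑ r, (|law μ (fun ω => (V ω, W ω, R ω)) (0, 0, r) -
          law μ (fun ω => (V ω, W ω, R ω)) (1, 1, r)| +
        |law μ (fun ω => (V ω, W ω, R ω)) (1, 0, r) -
          law μ (fun ω => (V ω, W ω, R ω)) (0, 1, r)|) := by
  unfold tvParam
  simp_rw [Fintype.sum_prod_type, sum_zmod_two, jointProb_right_add, ← Finset.sum_add_distrib]
  rfl

lemma bhattacharyya_right_add (μ : Measure Ω) (V W : Ω → ZMod 2) (R : Ω → ρ) :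
    bhattacharyya μ W (fun ω => (V ω + W ω, R ω)) =
      2 * ∑ r, (√(law μ (fun ω => (V ω, W ω, R ω)) (0, 0, r) *
          law μ (fun ω => (V ω, W ω, R ω)) (1, 1, r)) +
        √(law μ (fun ω => (V ω, W ω, R ω)) (1, 0, r) *
          law μ (fun ω => (V ω, W ω, R ω)) (0, 1, r))) := by
  unfold bhattacharyya
  simp_rw [Fintype.sum_prod_type, sum_zmod_two, jointProb_right_add, ← Finset.sum_add_distrib]
  rfl

/-- With sums s, s' and differences d, d' of the two pairs, the left side is max (|d| s', s |d'|),
and the smaller of these two products is at least |d| |d'|. -/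
lemma abs_sub_mul_add_abs_sub_mul_le {x₀ x₁ y₀ y₁ : ℝ} (hx₀ : 0 ≤ x₀) (hx₁ : 0 ≤ x₁)
    (hy₀ : 0 ≤ y₀) (hy₁ : 0 ≤ y₁) :
    |x₀ * y₀ - x₁ * y₁| + |x₁ * y₀ - x₀ * y₁| ≤
      |x₀ - x₁| * (y₀ + y₁) + (x₀ + x₁) * |y₀ - y₁| - |x₀ - x₁| * |y₀ - y₁| := by
  rcases abs_cases (x₀ - x₁) with ⟨e1, h1⟩ | ⟨e1, h1⟩ <;>
  rcases abs_cases (y₀ - y₁) with ⟨e2, h2⟩ | ⟨e2, h2⟩ <;>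
  rcases abs_cases (x₀ * y₀ - x₁ * y₁) with ⟨e3, h3⟩ | ⟨e3, h3⟩ <;>
  rcases abs_cases (x₁ * y₀ - x₀ * y₁) with ⟨e4, h4⟩ | ⟨e4, h4⟩ <;>
  rw [e1, e2, e3, e4] <;> nlinarith

lemma sqrt_cross_le {x₀ x₁ y₀ y₁ : ℝ} (hx₀ : 0 ≤ x₀) (hx₁ : 0 ≤ x₁)
    (hy₀ : 0 ≤ y₀) (hy₁ : 0 ≤ y₁) :
    √((x₀ * y₀ + x₁ * y₁) * (x₁ * y₀ + x₀ * y₁)) ≤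
      (x₀ + x₁) * √(y₀ * y₁) + √(x₀ * x₁) * (y₀ + y₁) := by
  refine Real.sqrt_le_iff.2 ⟨by positivity, ?_⟩
  have h1 := Real.sq_sqrt (mul_nonneg hy₀ hy₁)
  have h2 := Real.sq_sqrt (mul_nonneg hx₀ hx₁)
  have h3 : 0 ≤ (x₀ + x₁) * √(y₀ * y₁) * (√(x₀ * x₁) * (y₀ + y₁)) := by positivity
  rw [add_sq, mul_pow, mul_pow, h1, h2]
  have h4 : 0 ≤ x₀ * x₁ * (y₀ * y₁) := by positivity
  nlinarith

end PairStep

/-! ### Total variation through a Markov boundary: the finite sums -/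

section BoundarySums

variable {κ σ : Type*} [Fintype κ] [Fintype σ]

/-- The sum that bounds both total variation parameters after one polarization step. Here `D q a b`
is the absolute difference of the two probabilities for the observation `q` and the
boundary states `a`, `b`. -/
def crossSum (D : κ → σ → σ → ℝ) (π : σ → ℝ) : ℝ :=
  ∑ b, (∑ a, ∑ q, D q a b) * (∑ c, ∑ q, D q b c) / π b

variable {D s : κ → σ → σ → ℝ} {π : σ → ℝ}

/-- For a fixed middle state the two factors depend on separate variables, so the sum factors. -/
lemma sum_boundary_mul (f g : κ → σ → σ → ℝ) (π : σ → ℝ) :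
    ∑ r : (κ × σ) × σ × (κ × σ), f r.1.1 r.1.2 r.2.1 * g r.2.2.1 r.2.1 r.2.2.2 / π r.2.1 =
      ∑ b, (∑ a, ∑ q, f q a b) * (∑ c, ∑ q, g q b c) / π b := by
  have h1 : ∀ b, ∑ a, ∑ q, f q a b = ∑ p : κ × σ, f p.1 p.2 b := fun b =>
    (Fintype.sum_prod_type_right fun p : κ × σ => f p.1 p.2 b).symm
  have h2 : ∀ b, ∑ c, ∑ q, g q b c = ∑ p : κ × σ, g p.1 b p.2 := fun b =>
    (Fintype.sum_prod_type_right fun p : κ × σ => g p.1 b p.2).symm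
  simp_rw [h1, h2, Finset.sum_mul_sum, Finset.sum_div]
  rw [Fintype.sum_prod_type]
  simp_rw [Fintype.sum_prod_type (α₁ := σ)]
  rw [Finset.sum_comm]

lemma crossSum_nonneg (hD : ∀ q a b, 0 ≤ D q a b) (hπ : ∀ b, 0 < π b) : 0 ≤ crossSum D π :=
  Finset.sum_nonneg fun b _ => div_nonneg
    (mul_nonneg (Finset.sum_nonneg fun _ _ => Finset.sum_nonneg fun _ _ => hD _ _ _)
      (Finset.sum_nonneg fun _ _ => Finset.sum_nonneg fun _ _ => hD _ _ _)) (hπ b).le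

lemma crossSum_le_sq (hD : ∀ q a b, 0 ≤ D q a b) (hπ : ∀ b, 0 < π b) {C : ℝ}
    (hC : ∀ b, (π b)⁻¹ ≤ C) :
    crossSum D π ≤ C * (∑ b, ∑ a, ∑ q, D q a b) ^ 2 := by
  set K := ∑ b, ∑ a, ∑ q, D q a b with hK
  have hK' : K = ∑ b, ∑ c, ∑ q, D q b c := Finset.sum_comm
  have hR : ∀ b, ∑ c, ∑ q, D q b c ≤ K := fun b => by
    rw [hK']
    exact Finset.single_le_sum (f := fun b => ∑ c, ∑ q, D q b c)
      (fun _ _ => Finset.sum_nonneg fun _ _ => Finset.sum_nonneg fun _ _ => hD _ _ _)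
      (Finset.mem_univ b)
  have hL : ∀ b, 0 ≤ ∑ a, ∑ q, D q a b :=
    fun b => Finset.sum_nonneg fun _ _ => Finset.sum_nonneg fun _ _ => hD _ _ _
  have hR0 : ∀ b, 0 ≤ ∑ c, ∑ q, D q b c :=
    fun b => Finset.sum_nonneg fun _ _ => Finset.sum_nonneg fun _ _ => hD _ _ _
  calc crossSum D π ≤ ∑ b, C * ((∑ a, ∑ q, D q a b) * K) := by
        refine Finset.sum_le_sum fun b _ => ?_
        rw [div_eq_inv_mul]
        have h0 : 0 ≤ (π b)⁻¹ := inv_nonneg.2 (hπ b).le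
        exact mul_le_mul (hC b) (mul_le_mul_of_nonneg_left (hR b) (hL b))
          (mul_nonneg (hL b) (hR0 b)) (h0.trans (hC b))
    _ = C * K ^ 2 := by rw [← Finset.mul_sum, ← Finset.sum_mul, sq]

/-- Both marginals of `s` are `π`, so each mixed term collapses to the total of `D`. -/
lemma sum_boundary_sub_crossSum (hπ : ∀ b, 0 < π b) (hl : ∀ b, ∑ a, ∑ q, s q a b = π b)
    (hr : ∀ b, ∑ c, ∑ q, s q b c = π b) :
    ∑ r : (κ × σ) × σ × (κ × σ), (D r.1.1 r.1.2 r.2.1 * s r.2.2.1 r.2.1 r.2.2.2 +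
      s r.1.1 r.1.2 r.2.1 * D r.2.2.1 r.2.1 r.2.2.2 -
      D r.1.1 r.1.2 r.2.1 * D r.2.2.1 r.2.1 r.2.2.2) / π r.2.1 =
      2 * (∑ b, ∑ a, ∑ q, D q a b) - crossSum D π := by
  simp_rw [sub_div, add_div, Finset.sum_sub_distrib, Finset.sum_add_distrib]
  rw [sum_boundary_mul, sum_boundary_mul, sum_boundary_mul]
  simp_rw [hl, hr, mul_div_cancel_right₀ _ (hπ _).ne', mul_div_cancel_left₀ _ (hπ _).ne']
  rw [Finset.sum_comm (f := fun b c => ∑ q, D q b c), two_mul]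
  rfl

/-- If the joint probabilities of boundary states are bounded below, then the decrease of the
parameter controls its distance from `{0, 1}`. -/
lemma mul_one_sub_le_sub_crossSum (hD : ∀ q a b, 0 ≤ D q a b) (hs : ∀ q a b, D q a b ≤ s q a b)
    (hπ : ∀ b, 0 < π b) (hl : ∀ b, ∑ a, ∑ q, s q a b = π b)
    (hr : ∀ b, ∑ c, ∑ q, s q b c = π b) (hsum : ∑ b, π b = 1) {ε : ℝ} (hε : 0 < ε)
    (hlow : ∀ a b, ε ≤ ∑ q, s q a b) :
    ε / (4 * (Fintype.card σ : ℝ) ^ 4) *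
      ((∑ b, ∑ a, ∑ q, D q a b) * (1 - ∑ b, ∑ a, ∑ q, D q a b)) ≤
      (∑ b, ∑ a, ∑ q, D q a b) - crossSum D π := by
  set k : σ → σ → ℝ := fun a b => ∑ q, D q a b with hk
  set r : σ → σ → ℝ := fun a b => ∑ q, s q a b with hr'
  have hk0 : ∀ a b, 0 ≤ k a b := fun a b => Finset.sum_nonneg fun _ _ => hD _ _ _
  have hkr : ∀ a b, k a b ≤ r a b := fun a b => Finset.sum_le_sum fun _ _ => hs _ _ _
  have hr0 : ∀ a b, 0 ≤ r a b := fun a b => (hk0 a b).trans (hkr a b)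
  have hπ1 : ∀ b, π b ≤ 1 := fun b => by
    rw [← hsum]
    exact Finset.single_le_sum (fun b _ => (hπ b).le) (Finset.mem_univ b)
  have hr1 : ∀ a b, r a b ≤ 1 := fun a b => by
    refine le_trans ?_ (hπ1 b)
    rw [← hl b]
    exact Finset.single_le_sum (f := fun a => r a b) (fun a _ => hr0 a b) (Finset.mem_univ a)
  set K := ∑ b, ∑ a, k a b with hK
  have hK' : K = ∑ b, ∑ c, k b c := Finset.sum_comm
  change _ ≤ K - crossSum D π
  set G := K - crossSum D π with hG
  -- The marginal conditions express the gap through nonnegative terms, each coupling `k` on one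
  -- side of a state `b` with the defect `r - k` on the other side.
  have hG2 : 2 * G = ∑ b, ((∑ a, k a b) * (∑ c, (r b c - k b c)) +
      (∑ a, (r a b - k a b)) * ∑ c, k b c) / π b := by
    have e : ∀ b, ((∑ a, k a b) * (∑ c, (r b c - k b c)) +
        (∑ a, (r a b - k a b)) * ∑ c, k b c) / π b =
        ∑ a, k a b + ∑ c, k b c - 2 * ((∑ a, k a b) * (∑ c, k b c) / π b) := fun b => by
      rw [Finset.sum_sub_distrib, Finset.sum_sub_distrib]
      change ((∑ a, k a b) * (∑ c, r b c - _) + (∑ a, r a b - _) * _) / π b = _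
      rw [show ∑ c, r b c = π b from hr b, show ∑ a, r a b = π b from hl b]
      have := (hπ b).ne'
      field_simp
      ring
    simp_rw [e]
    rw [Finset.sum_sub_distrib, Finset.sum_add_distrib, ← hK', ← hK, ← Finset.mul_sum, hG, crossSum]
    ring
  have hterm0 : ∀ b, 0 ≤ ((∑ a, k a b) * (∑ c, (r b c - k b c)) +
      (∑ a, (r a b - k a b)) * ∑ c, k b c) / π b := fun b => by
    refine div_nonneg (add_nonneg (mul_nonneg ?_ ?_) (mul_nonneg ?_ ?_)) (hπ b).le <;>
    refine Finset.sum_nonneg fun _ _ => ?_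
    exacts [hk0 _ _, sub_nonneg.2 (hkr _ _), sub_nonneg.2 (hkr _ _), hk0 _ _]
  have hG0 : 0 ≤ G := by
    have : 0 ≤ 2 * G := by
      rw [hG2]
      exact Finset.sum_nonneg fun b _ => hterm0 b
    linarith
  have hb : ∀ a b c, k a b * (r b c - k b c) ≤ 2 * G := fun a b c => by
    have i1 : k a b ≤ ∑ a, k a b :=
      Finset.single_le_sum (f := fun a => k a b) (fun a _ => hk0 a b) (Finset.mem_univ a)
    have i2 : r b c - k b c ≤ ∑ c, (r b c - k b c) :=
      Finset.single_le_sum (f := fun c => r b c - k b c) (fun c _ => sub_nonneg.2 (hkr b c))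
        (Finset.mem_univ c)
    have i3 : 0 ≤ (∑ a, (r a b - k a b)) * ∑ c, k b c := mul_nonneg
      (Finset.sum_nonneg fun _ _ => sub_nonneg.2 (hkr _ _)) (Finset.sum_nonneg fun _ _ => hk0 _ _)
    have i4 := mul_le_mul i1 i2 (sub_nonneg.2 (hkr b c)) ((hk0 a b).trans i1)
    have i5 := Finset.single_le_sum (f := fun b => ((∑ a, k a b) * (∑ c, (r b c - k b c)) +
      (∑ a, (r a b - k a b)) * ∑ c, k b c) / π b) (fun b _ => hterm0 b) (Finset.mem_univ b)
    rw [← hG2] at i5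
    have i6 := div_le_iff₀ (hπ b) |>.1 i5
    have i7 := hπ1 b
    nlinarith
  -- Two links without a common state are joined through the link from `b` to `c`: its weight is at
  -- least `ε` and splits as `r = (r - k) + k`, and each part forms an adjacent product bounded by
  -- `hb`.
  have hquad : ∀ a b c d, k a b * (r c d - k c d) ≤ 4 * G / ε := by
    intro a b c d
    rw [le_div_iff₀ hε]
    have h1 := hb a b c
    have h2 := hb b c d
    have h3 := hlow b c
    have h4 := hk0 a b
    have h5 := hkr a b
    have h6 := hk0 b c
    have h7 := hkr b c
    have h8 := hk0 c d
    have h9 := hkr c d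
    have hcd := hr1 c d
    have hab := hr1 a b
    change ε ≤ r b c at h3
    have hz : 0 ≤ r c d - k c d := sub_nonneg.2 h9
    calc k a b * (r c d - k c d) * ε ≤ k a b * (r c d - k c d) * r b c :=
          mul_le_mul_of_nonneg_left h3 (mul_nonneg h4 hz)
      _ = k a b * (r b c - k b c) * (r c d - k c d) + k b c * (r c d - k c d) * k a b := by ring
      _ ≤ k a b * (r b c - k b c) * 1 + k b c * (r c d - k c d) * 1 :=
          add_le_add
            (mul_le_mul_of_nonneg_left (by linarith) (mul_nonneg h4 (sub_nonneg.2 h7)))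
            (mul_le_mul_of_nonneg_left (by linarith) (mul_nonneg h6 hz))
      _ ≤ 4 * G := by linarith
  -- `1 - K` is the total defect, so the product is a sum over quadruples of states.
  have hprod : K * (1 - K) ≤ (Fintype.card σ : ℝ) ^ 4 * (4 * G / ε) := by
    have e1 : 1 - K = ∑ d, ∑ c, (r c d - k c d) := by
      simp_rw [Finset.sum_sub_distrib]
      rw [← hsum, hK]
      congr 1
      exact Finset.sum_congr rfl fun d _ => (hl d).symm
    rw [e1, hK, Finset.sum_mul]
    simp_rw [Finset.sum_mul, Finset.mul_sum]
    refine (Finset.sum_le_sum fun b _ => Finset.sum_le_sum fun a _ => Finset.sum_le_sum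
      fun d _ => Finset.sum_le_sum fun c _ => hquad a b c d).trans (le_of_eq ?_)
    simp only [Finset.sum_const, Finset.card_univ, nsmul_eq_mul]
    ring
  have hne : 0 < (Fintype.card σ : ℝ) := by
    have : Nonempty σ := by
      by_contra hne
      rw [not_nonempty_iff] at hne
      simp at hsum
    exact_mod_cast Fintype.card_pos
  rw [div_mul_eq_mul_div, div_le_iff₀ (by positivity)]
  calc ε * (K * (1 - K)) ≤ ε * ((Fintype.card σ : ℝ) ^ 4 * (4 * G / ε)) :=
        mul_le_mul_of_nonneg_left hprod hε.le
    _ = G * (4 * (Fintype.card σ : ℝ) ^ 4) := by field_simp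

end BoundarySums

/-! ### One polarization step of a FAIM process -/

section Step

variable {Ω : Type*} [MeasurableSpace Ω] {𝒴 𝒮 : Type*}
  [Fintype 𝒴] [MeasurableSpace 𝒴] [DiscreteMeasurableSpace 𝒴]
  [Fintype 𝒮] [MeasurableSpace 𝒮] [DiscreteMeasurableSpace 𝒮]

/-- The observation `Q_i` together with the states at the two ends of the block. -/
def boundaryQ (X : ℤ → Ω → ZMod 2) (Y : ℤ → Ω → 𝒴) (S : ℤ → Ω → 𝒮) (n : ℕ) (i : Fin (2 ^ n))
    (ω : Ω) : ((Fin (i : ℕ) → ZMod 2) × (Fin (2 ^ n) → 𝒴)) × 𝒮 × 𝒮 :=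
  (polarQ X Y n i ω, S 0 ω, S ((2 ^ n : ℕ) : ℤ) ω)

/-- The total variation parameter of `U_i` given `Q_i` and the boundary states. -/
def boundaryTV (μ : Measure Ω) (X : ℤ → Ω → ZMod 2) (Y : ℤ → Ω → 𝒴) (S : ℤ → Ω → 𝒮) (n : ℕ)
    (i : Fin (2 ^ n)) : ℝ :=
  tvParam μ (fun ω => polarU X n ω i) (boundaryQ X Y S n i)

/-- The conditional entropy `H(U_i|Q_i)`. -/
def polarEntropy (μ : Measure Ω) (X : ℤ → Ω → ZMod 2) (Y : ℤ → Ω → 𝒴) (n : ℕ)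
    (i : Fin (2 ^ n)) : ℝ :=
  condEntropy μ (fun ω => polarU X n ω i) (polarQ X Y n i)

/-- The entry `i` of the polar transform and the observation, as a function of a window. -/
def windowUQ {n : ℕ} (i : Fin (2 ^ n)) (w : (Fin (2 ^ n) → ZMod 2) × (Fin (2 ^ n) → 𝒴) × 𝒮 × 𝒮) :
    ZMod 2 × ((Fin (i : ℕ) → ZMod 2) × (Fin (2 ^ n) → 𝒴)) :=
  (Matrix.vecMul w.1 (polarMatrix n) i,
    (fun k => Matrix.vecMul w.1 (polarMatrix n) (Fin.castLE i.isLt.le k), w.2.1))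

lemma windowUQ_window (X : ℤ → Ω → ZMod 2) (Y : ℤ → Ω → 𝒴) (S : ℤ → Ω → 𝒮) (m : ℤ) {n : ℕ}
    (i : Fin (2 ^ n)) (ω : Ω) :
    windowUQ i (window X Y S m (2 ^ n) ω) =
      (polarU (fun k => X (k + m)) n ω i,
        polarQ (fun k => X (k + m)) (fun k => Y (k + m)) n i ω) := rfl

lemma windowUQ_window_zero (X : ℤ → Ω → ZMod 2) (Y : ℤ → Ω → 𝒴) (S : ℤ → Ω → 𝒮) {n : ℕ}
    (i : Fin (2 ^ n)) (ω : Ω) :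
    windowUQ i (window X Y S 0 (2 ^ n) ω) = (polarU X n ω i, polarQ X Y n i ω) := by
  rw [windowUQ_window]
  simp

lemma window_state_left (X : ℤ → Ω → ZMod 2) (Y : ℤ → Ω → 𝒴) (S : ℤ → Ω → 𝒮) (m : ℤ) (N : ℕ)
    (ω : Ω) : (window X Y S m N ω).2.2.1 = S m ω := rfl

lemma window_state_right (X : ℤ → Ω → ZMod 2) (Y : ℤ → Ω → 𝒴) (S : ℤ → Ω → 𝒮) (m : ℤ) (N : ℕ)
    (ω : Ω) : (window X Y S m N ω).2.2.2 = S (m + N) ω := rfl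

lemma two_pow_add_self (n : ℕ) :
    ((2 ^ n : ℕ) : ℤ) + ((2 ^ n : ℕ) : ℤ) = ((2 ^ (n + 1) : ℕ) : ℤ) := by
  push_cast
  ring

lemma law_congr {α β : Type*} {μ : Measure Ω} {A : Ω → α} {B : Ω → β} {a : α} {b : β}
    (h : ∀ ω, A ω = a ↔ B ω = b) : law μ A a = law μ B b := by
  unfold law
  congr 1
  ext ω
  exact h ω

variable {μ : Measure Ω} [IsProbabilityMeasure μ]
  {X : ℤ → Ω → ZMod 2} {Y : ℤ → Ω → 𝒴} {S : ℤ → Ω → 𝒮}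

namespace IsFAIM

lemma measurableFibers_polarU (h : IsFAIM μ X Y S) (n : ℕ) (i : Fin (2 ^ n)) :
    MeasurableFibers fun ω => polarU X n ω i := by
  have := (h.measurableFibers_window 0 (2 ^ n)).comp fun w => (windowUQ i w).1
  simpa only [windowUQ_window_zero] using this

lemma measurableFibers_polarQ (h : IsFAIM μ X Y S) (n : ℕ) (i : Fin (2 ^ n)) :
    MeasurableFibers (polarQ X Y n i) := by
  have := (h.measurableFibers_window 0 (2 ^ n)).comp fun w => (windowUQ i w).2
  simpa only [windowUQ_window_zero] using this

lemma measurableFibers_polarU_shift (h : IsFAIM μ X Y S) (m : ℤ) (n : ℕ) (i : Fin (2 ^ n)) :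
    MeasurableFibers fun ω => polarU (fun k => X (k + m)) n ω i :=
  (h.measurableFibers_window m (2 ^ n)).comp fun w => (windowUQ i w).1

lemma measurableFibers_polarQ_shift (h : IsFAIM μ X Y S) (m : ℤ) (n : ℕ) (i : Fin (2 ^ n)) :
    MeasurableFibers (polarQ (fun k => X (k + m)) (fun k => Y (k + m)) n i) :=
  (h.measurableFibers_window m (2 ^ n)).comp fun w => (windowUQ i w).2

lemma measurableFibers_boundaryQ (h : IsFAIM μ X Y S) (n : ℕ) (i : Fin (2 ^ n)) :
    MeasurableFibers (boundaryQ X Y S n i) :=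
  (h.measurableFibers_polarQ n i).prodMk
    ((h.measurableFibers_S _).prodMk (h.measurableFibers_S _))

lemma jointProb_polar_shift (h : IsFAIM μ X Y S) (m : ℤ) (n : ℕ) (i : Fin (2 ^ n)) (u : ZMod 2)
    (q : (Fin (i : ℕ) → ZMod 2) × (Fin (2 ^ n) → 𝒴)) :
    jointProb μ (fun ω => polarU (fun k => X (k + m)) n ω i)
        (polarQ (fun k => X (k + m)) (fun k => Y (k + m)) n i) u q =
      jointProb μ (fun ω => polarU X n ω i) (polarQ X Y n i) u q := by
  rw [jointProb_eq_law, jointProb_eq_law]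
  have := congrFun (h.law_comp_window m (2 ^ n) (windowUQ i)) (u, q)
  simp only [windowUQ_window_zero] at this
  exact this

/-- The Markov property at the middle state, combined with stationarity for the second block. The
nesting of the tuple matches `sum_boundary_mul`. -/
lemma law_two_blocks_boundary (h : IsFAIM μ X Y S) (n : ℕ) (i : Fin (2 ^ n)) (v w : ZMod 2)
    (q q' : (Fin (i : ℕ) → ZMod 2) × (Fin (2 ^ n) → 𝒴)) (a b c : 𝒮) :
    law μ (fun ω => (polarU X n ω i, polarU (fun k => X (k + ((2 ^ n : ℕ) : ℤ))) n ω i,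
        ((polarQ X Y n i ω, S 0 ω), S ((2 ^ n : ℕ) : ℤ) ω,
          (polarQ (fun k => X (k + ((2 ^ n : ℕ) : ℤ))) (fun k => Y (k + ((2 ^ n : ℕ) : ℤ))) n i ω,
            S (((2 ^ n : ℕ) : ℤ) + ((2 ^ n : ℕ) : ℤ)) ω)))) (v, w, ((q, a), b, (q', c))) =
      jointProb μ (fun ω => polarU X n ω i) (boundaryQ X Y S n i) v (q, a, b) *
        jointProb μ (fun ω => polarU X n ω i) (boundaryQ X Y S n i) w (q', b, c) /
        law μ (S 0) b := by
  have hN : 0 < 2 ^ n := by positivity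
  have key := h.law_two_windows hN hN (fun w => (windowUQ i w, w.2.2.1))
    (fun w => (windowUQ i w, w.2.2.2)) ((v, q), a) b ((w, q'), c)
  have st := congrFun (h.law_comp_window ((2 ^ n : ℕ) : ℤ) (2 ^ n)
    fun w => ((windowUQ i w, w.2.2.2), w.2.2.1)) (((w, q'), c), b)
  simp only [windowUQ_window_zero, window_state_left, window_state_right, zero_add] at key st
  simp only [windowUQ_window] at key st
  rw [eq_div_iff (h.law_S_pos b).ne', ← h.law_S ((2 ^ n : ℕ) : ℤ)]
  refine Eq.trans ?_ (key.trans ?_)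
  · congr 1
    refine law_congr fun ω => ?_
    simp only [Prod.mk.injEq]
    tauto
  · congr 1
    · rw [jointProb_eq_law]
      refine law_congr fun ω => ?_
      simp only [Prod.mk.injEq, boundaryQ]
      tauto
    · refine Eq.trans ?_ (st.trans ?_)
      · rfl
      · rw [jointProb_eq_law]
        refine law_congr fun ω => ?_
        simp only [Prod.mk.injEq, boundaryQ]
        tauto

/-- Two consecutive blocks are independent up to a constant factor. -/
lemma law_two_blocks_le (h : IsFAIM μ X Y S) {C : ℝ} (hC : ∀ b, (law μ (S 0) b)⁻¹ ≤ C)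
    (n : ℕ) (i : Fin (2 ^ n)) (v w : ZMod 2)
    (q q' : (Fin (i : ℕ) → ZMod 2) × (Fin (2 ^ n) → 𝒴)) :
    law μ (fun ω => (polarU X n ω i, polarU (fun k => X (k + ((2 ^ n : ℕ) : ℤ))) n ω i,
        (polarQ X Y n i ω,
          polarQ (fun k => X (k + ((2 ^ n : ℕ) : ℤ))) (fun k => Y (k + ((2 ^ n : ℕ) : ℤ))) n i ω)))
        (v, w, (q, q')) ≤
      C * (jointProb μ (fun ω => polarU X n ω i) (polarQ X Y n i) v q *
        jointProb μ (fun ω => polarU X n ω i) (polarQ X Y n i) w q') := by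
  classical
  have hN : 0 < 2 ^ n := by positivity
  set A : Ω → _ := fun ω => windowUQ i (window X Y S 0 (2 ^ n) ω) with hA
  set B : Ω → _ := fun ω => windowUQ i (window X Y S ((2 ^ n : ℕ) : ℤ) (2 ^ n) ω) with hB
  have mA : MeasurableFibers A := (h.measurableFibers_window _ _).comp _
  have mB : MeasurableFibers B := (h.measurableFibers_window _ _).comp _
  have mS := h.measurableFibers_S ((2 ^ n : ℕ) : ℤ)
  have e1 : jointProb μ (fun ω => polarU X n ω i) (polarQ X Y n i) v q = law μ A (v, q) := by
    rw [jointProb_eq_law, hA]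
    simp only [windowUQ_window_zero]
  have e2 : jointProb μ (fun ω => polarU X n ω i) (polarQ X Y n i) w q' = law μ B (w, q') := by
    rw [← h.jointProb_polar_shift ((2 ^ n : ℕ) : ℤ), jointProb_eq_law]
    rfl
  have e3 : law μ (fun ω => (polarU X n ω i, polarU (fun k => X (k + ((2 ^ n : ℕ) : ℤ))) n ω i,
        (polarQ X Y n i ω,
          polarQ (fun k => X (k + ((2 ^ n : ℕ) : ℤ))) (fun k => Y (k + ((2 ^ n : ℕ) : ℤ))) n i ω)))
        (v, w, (q, q')) =
      ∑ s, law μ (fun ω => (A ω, S ((2 ^ n : ℕ) : ℤ) ω, B ω)) ((v, q), s, (w, q')) := by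
    have := sum_law_prod_left (μ := μ) mS (mA.prodMk mB) ((v, q), (w, q'))
    refine Eq.trans (law_congr fun ω => ?_) (this.symm.trans
      (Finset.sum_congr rfl fun s _ => law_congr fun ω => ?_))
    · simp only [hA, hB, windowUQ_window_zero]
      simp only [windowUQ_window, Prod.mk.injEq]
      tauto
    · simp only [Prod.mk.injEq]
      tauto
  have hB' : ∀ s, law μ (fun ω => (B ω, S ((2 ^ n : ℕ) : ℤ) ω)) ((w, q'), s) ≤ law μ B (w, q') := by
    intro s
    rw [← sum_law_prod_right (μ := μ) mB mS]
    exact Finset.single_le_sum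
      (f := fun s => law μ (fun ω => (B ω, S ((2 ^ n : ℕ) : ℤ) ω)) ((w, q'), s))
      (fun _ _ => law_nonneg _ _ _) (Finset.mem_univ s)
  rw [e1, e2, e3, ← sum_law_prod_right (μ := μ) mA mS (v, q), Finset.sum_mul, Finset.mul_sum]
  refine Finset.sum_le_sum fun s _ => ?_
  have hs := h.law_S_pos s
  have key := h.law_two_windows hN hN (windowUQ i) (windowUQ i) (v, q) s (w, q')
  rw [h.law_S] at key
  rw [← eq_div_iff hs.ne'] at key
  refine key.trans_le ?_
  rw [div_eq_inv_mul]
  have hs' := inv_nonneg.2 hs.le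
  exact mul_le_mul (hC s) (mul_le_mul_of_nonneg_left (hB' s) (law_nonneg _ _ _))
    (mul_nonneg (law_nonneg _ _ _) (law_nonneg _ _ _)) (hs'.trans (hC s))

/-! #### The total variation parameter -/

lemma boundaryTV_eq (n : ℕ) (i : Fin (2 ^ n)) :
    boundaryTV μ X Y S n i = ∑ b, ∑ a, ∑ q,
      |jointProb μ (fun ω => polarU X n ω i) (boundaryQ X Y S n i) 0 (q, a, b) -
        jointProb μ (fun ω => polarU X n ω i) (boundaryQ X Y S n i) 1 (q, a, b)| := by
  rw [boundaryTV, tvParam, Fintype.sum_prod_type_right]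
  simp_rw [Fintype.sum_prod_type_right (α₁ := 𝒮)]

lemma sum_jointProb_boundary (h : IsFAIM μ X Y S) (n : ℕ) (i : Fin (2 ^ n)) (a b : 𝒮) :
    ∑ q, (jointProb μ (fun ω => polarU X n ω i) (boundaryQ X Y S n i) 0 (q, a, b) +
        jointProb μ (fun ω => polarU X n ω i) (boundaryQ X Y S n i) 1 (q, a, b)) =
      pairLaw μ S (2 ^ n) a b := by
  rw [pairLaw, ← sum_law_prod_left (μ := μ) (h.measurableFibers_polarQ n i)
    ((h.measurableFibers_S 0).prodMk (h.measurableFibers_S ((2 ^ n : ℕ) : ℤ)))]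
  refine Finset.sum_congr rfl fun q _ => ?_
  rw [← sum_zmod_two
    (fun u => jointProb μ (fun ω => polarU X n ω i) (boundaryQ X Y S n i) u (q, a, b))]
  simp_rw [jointProb_eq_law]
  exact sum_law_prod_left (h.measurableFibers_polarU n i) (h.measurableFibers_boundaryQ n i) _

/-- The sum that separates the two total variation parameters after one step. -/
def _root_.Polar.boundaryCross (μ : Measure Ω) (X : ℤ → Ω → ZMod 2) (Y : ℤ → Ω → 𝒴)
    (S : ℤ → Ω → 𝒮) (n : ℕ) (i : Fin (2 ^ n)) : ℝ :=
  crossSum (fun q a b =>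
    |jointProb μ (fun ω => polarU X n ω i) (boundaryQ X Y S n i) 0 (q, a, b) -
      jointProb μ (fun ω => polarU X n ω i) (boundaryQ X Y S n i) 1 (q, a, b)|) (law μ (S 0))

lemma boundaryCross_nonneg (h : IsFAIM μ X Y S) (n : ℕ) (i : Fin (2 ^ n)) :
    0 ≤ boundaryCross μ X Y S n i :=
  crossSum_nonneg (fun _ _ _ => abs_nonneg _) h.law_S_pos

lemma boundaryCross_le_sq (h : IsFAIM μ X Y S) {C : ℝ} (hC : ∀ b, (law μ (S 0) b)⁻¹ ≤ C) (n : ℕ)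
    (i : Fin (2 ^ n)) : boundaryCross μ X Y S n i ≤ C * boundaryTV μ X Y S n i ^ 2 := by
  rw [boundaryTV_eq]
  exact crossSum_le_sq (fun _ _ _ => abs_nonneg _) h.law_S_pos hC

/-- Revealing the middle state can only raise K. Then the difference of probabilities factors: (x₀y₀
+ x₁y₁) - (x₁y₀ + x₀y₁) = (x₀ - x₁)(y₀ - y₁). -/
lemma boundaryTV_childIndex_zero_le (h : IsFAIM μ X Y S) (n : ℕ) (i : Fin (2 ^ n)) :
    boundaryTV μ X Y S (n + 1) (childIndex i 0) ≤ boundaryCross μ X Y S n i := by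
  have hfac : (boundaryQ X Y S (n + 1) (childIndex i 0)).FactorsThrough (fun ω =>
      ((polarQ X Y n i ω, S 0 ω), S ((2 ^ n : ℕ) : ℤ) ω,
          (polarQ (fun k => X (k + ((2 ^ n : ℕ) : ℤ))) (fun k => Y (k + ((2 ^ n : ℕ) : ℤ))) n i ω,
            S (((2 ^ n : ℕ) : ℤ) + ((2 ^ n : ℕ) : ℤ)) ω))) := by
    intro ω ω' e
    simp only [Prod.mk.injEq, two_pow_add_self] at e
    simp only [boundaryQ, Prod.mk.injEq, polarQ_childIndex_zero_eq_iff]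
    tauto
  rw [boundaryTV]
  simp_rw [polarU_childIndex_zero]
  have mV := h.measurableFibers_polarU n i
  have mW := h.measurableFibers_polarU_shift ((2 ^ n : ℕ) : ℤ) n i
  have mR := (((h.measurableFibers_polarQ n i).prodMk (h.measurableFibers_S 0)).prodMk
    ((h.measurableFibers_S ((2 ^ n : ℕ) : ℤ)).prodMk
    ((h.measurableFibers_polarQ_shift ((2 ^ n : ℕ) : ℤ) n i).prodMk
      (h.measurableFibers_S (((2 ^ n : ℕ) : ℤ) + ((2 ^ n : ℕ) : ℤ))))))
  refine (tvParam_le_of_factorsThrough ((mV.prodMk mW).comp fun x => x.1 + x.2) mR hfac).trans ?_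
  rw [tvParam_add mV mW mR, boundaryCross, crossSum, ← sum_boundary_mul]
  refine Finset.sum_le_sum fun ⟨⟨q, a⟩, b, q', c⟩ _ => ?_
  simp only [h.law_two_blocks_boundary]
  have hb := h.law_S_pos b
  rw [← abs_mul, ← add_div, ← add_div, ← sub_div, abs_div, abs_of_pos hb]
  refine div_le_div_of_nonneg_right (le_of_eq ?_) hb.le
  congr 1
  ring

/-- With the middle state revealed, `abs_sub_mul_add_abs_sub_mul_le` applies termwise. Its negative
term sums to the same quantity that bounds the other child, so the pair satisfies the
supermartingale inequality. -/
lemma boundaryTV_childIndex_one_le (h : IsFAIM μ X Y S) (n : ℕ) (i : Fin (2 ^ n)) :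
    boundaryTV μ X Y S (n + 1) (childIndex i 1) ≤
      2 * boundaryTV μ X Y S n i - boundaryCross μ X Y S n i := by
  have hfac : (boundaryQ X Y S (n + 1) (childIndex i 1)).FactorsThrough (fun ω =>
      (polarU X n ω i + polarU (fun k => X (k + ((2 ^ n : ℕ) : ℤ))) n ω i,
      ((polarQ X Y n i ω, S 0 ω), S ((2 ^ n : ℕ) : ℤ) ω,
          (polarQ (fun k => X (k + ((2 ^ n : ℕ) : ℤ))) (fun k => Y (k + ((2 ^ n : ℕ) : ℤ))) n i ω,
            S (((2 ^ n : ℕ) : ℤ) + ((2 ^ n : ℕ) : ℤ)) ω)))) := by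
    intro ω ω' e
    simp only [Prod.mk.injEq, two_pow_add_self] at e
    simp only [boundaryQ, Prod.mk.injEq, polarQ_childIndex_one_eq_iff,
      polarQ_childIndex_zero_eq_iff, polarU_childIndex_zero]
    tauto
  rw [boundaryTV]
  simp_rw [polarU_childIndex_one]
  have mV := h.measurableFibers_polarU n i
  have mW := h.measurableFibers_polarU_shift ((2 ^ n : ℕ) : ℤ) n i
  have mR := (((h.measurableFibers_polarQ n i).prodMk (h.measurableFibers_S 0)).prodMk
    ((h.measurableFibers_S ((2 ^ n : ℕ) : ℤ)).prodMk
    ((h.measurableFibers_polarQ_shift ((2 ^ n : ℕ) : ℤ) n i).prodMk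
      (h.measurableFibers_S (((2 ^ n : ℕ) : ℤ) + ((2 ^ n : ℕ) : ℤ))))))
  refine (tvParam_le_of_factorsThrough mW
    (((mV.prodMk mW).comp fun x => x.1 + x.2).prodMk mR) hfac).trans ?_
  have hl : ∀ b, ∑ a, ∑ q,
      (jointProb μ (fun ω => polarU X n ω i) (boundaryQ X Y S n i) 0 (q, a, b) +
        jointProb μ (fun ω => polarU X n ω i) (boundaryQ X Y S n i) 1 (q, a, b)) =
        law μ (S 0) b := fun b => by
    simp_rw [h.sum_jointProb_boundary, h.sum_pairLaw_left]
  have hr : ∀ b, ∑ c, ∑ q,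
      (jointProb μ (fun ω => polarU X n ω i) (boundaryQ X Y S n i) 0 (q, b, c) +
        jointProb μ (fun ω => polarU X n ω i) (boundaryQ X Y S n i) 1 (q, b, c)) =
        law μ (S 0) b := fun b => by
    simp_rw [h.sum_jointProb_boundary, h.sum_pairLaw_right]
  rw [tvParam_right_add, boundaryCross, boundaryTV_eq,
    ← sum_boundary_sub_crossSum h.law_S_pos hl hr]
  refine Finset.sum_le_sum fun ⟨⟨q, a⟩, b, q', c⟩ _ => ?_
  simp only [h.law_two_blocks_boundary]
  have hb := h.law_S_pos b
  rw [← sub_div, ← sub_div, abs_div, abs_div, abs_of_pos hb, ← add_div]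
  exact div_le_div_of_nonneg_right (abs_sub_mul_add_abs_sub_mul_le (jointProb_nonneg _ _ _ _ _)
    (jointProb_nonneg _ _ _ _ _) (jointProb_nonneg _ _ _ _ _) (jointProb_nonneg _ _ _ _ _)) hb.le

lemma mul_one_sub_le_sub_boundaryCross (h : IsFAIM μ X Y S) {ε : ℝ} (hε : 0 < ε) (n : ℕ)
    (i : Fin (2 ^ n)) (hlow : ∀ a b, ε ≤ pairLaw μ S (2 ^ n) a b) :
    ε / (4 * (Fintype.card 𝒮 : ℝ) ^ 4) *
      (boundaryTV μ X Y S n i * (1 - boundaryTV μ X Y S n i)) ≤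
      boundaryTV μ X Y S n i - boundaryCross μ X Y S n i := by
  rw [boundaryCross, boundaryTV_eq]
  refine mul_one_sub_le_sub_crossSum (s := fun q a b =>
    jointProb μ (fun ω => polarU X n ω i) (boundaryQ X Y S n i) 0 (q, a, b) +
      jointProb μ (fun ω => polarU X n ω i) (boundaryQ X Y S n i) 1 (q, a, b))
    (fun _ _ _ => abs_nonneg _) (fun q a b => ?_) h.law_S_pos (fun b => ?_) (fun b => ?_)
    (sum_law (h.measurableFibers_S 0)) hε (fun a b => ?_)
  · have h0 := jointProb_nonneg μ (fun ω => polarU X n ω i) (boundaryQ X Y S n i) 0 (q, a, b)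
    have h1 := jointProb_nonneg μ (fun ω => polarU X n ω i) (boundaryQ X Y S n i) 1 (q, a, b)
    exact abs_le.2 ⟨by linarith, by linarith⟩
  · simp_rw [h.sum_jointProb_boundary, h.sum_pairLaw_left]
  · simp_rw [h.sum_jointProb_boundary, h.sum_pairLaw_right]
  · rw [h.sum_jointProb_boundary]
    exact hlow a b

/-! #### The Bhattacharyya parameter -/

/-- Revealing states lowers Z and is of no use for an upper bound. Instead the joint law of the two
blocks is dominated by `C` times the product law, for which the sum is a square. -/
lemma polarZ_childIndex_one_le (h : IsFAIM μ X Y S) {C : ℝ} (hC : ∀ b, (law μ (S 0) b)⁻¹ ≤ C)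
    (hC0 : 0 ≤ C) (n : ℕ) (i : Fin (2 ^ n)) :
    polarZ μ X Y (n + 1) (childIndex i 1) ≤ C * polarZ μ X Y n i ^ 2 := by
  have hfac : (fun ω =>
      (polarU X n ω i + polarU (fun k => X (k + ((2 ^ n : ℕ) : ℤ))) n ω i,
        (polarQ X Y n i ω, polarQ (fun k => X (k + ((2 ^ n : ℕ) : ℤ)))
          (fun k => Y (k + ((2 ^ n : ℕ) : ℤ))) n i ω))).FactorsThrough
      (polarQ X Y (n + 1) (childIndex i 1)) := by
    intro ω ω' e
    simpa only [Prod.mk.injEq, polarQ_childIndex_one_eq_iff, polarQ_childIndex_zero_eq_iff,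
      polarU_childIndex_zero] using e
  rw [polarZ]
  simp_rw [polarU_childIndex_one]
  refine (bhattacharyya_le_of_factorsThrough (h.measurableFibers_polarU_shift _ n i)
    (h.measurableFibers_polarQ (n + 1) (childIndex i 1)) hfac).trans ?_
  rw [bhattacharyya_right_add, polarZ, bhattacharyya]
  set p := jointProb μ (fun ω => polarU X n ω i) (polarQ X Y n i) with hp
  have hp0 : ∀ u q, 0 ≤ p u q := jointProb_nonneg _ _ _
  have hbound : ∀ r : ((Fin (i : ℕ) → ZMod 2) × (Fin (2 ^ n) → 𝒴)) ×
      ((Fin (i : ℕ) → ZMod 2) × (Fin (2 ^ n) → 𝒴)), ∀ v w v' w',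
      √(law μ (fun ω => (polarU X n ω i, polarU (fun k => X (k + ((2 ^ n : ℕ) : ℤ))) n ω i,
        (polarQ X Y n i ω, polarQ (fun k => X (k + ((2 ^ n : ℕ) : ℤ)))
          (fun k => Y (k + ((2 ^ n : ℕ) : ℤ))) n i ω))) (v, w, r) *
        law μ (fun ω => (polarU X n ω i, polarU (fun k => X (k + ((2 ^ n : ℕ) : ℤ))) n ω i,
        (polarQ X Y n i ω, polarQ (fun k => X (k + ((2 ^ n : ℕ) : ℤ)))
          (fun k => Y (k + ((2 ^ n : ℕ) : ℤ))) n i ω))) (v', w', r)) ≤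
      C * (√(p v r.1 * p v' r.1) * √(p w r.2 * p w' r.2)) := by
    intro r v w v' w'
    have i1 := h.law_two_blocks_le hC n i v w r.1 r.2
    have i2 := h.law_two_blocks_le hC n i v' w' r.1 r.2
    refine (Real.sqrt_le_sqrt (mul_le_mul i1 i2 (law_nonneg _ _ _)
      ((law_nonneg _ _ _).trans i1))).trans (le_of_eq ?_)
    rw [← hp, show C * (p v r.1 * p w r.2) * (C * (p v' r.1 * p w' r.2)) =
      C ^ 2 * ((p v r.1 * p v' r.1) * (p w r.2 * p w' r.2)) by ring,
      Real.sqrt_mul (sq_nonneg C), Real.sqrt_sq hC0,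
      Real.sqrt_mul (mul_nonneg (hp0 _ _) (hp0 _ _))]
  calc _ ≤ 2 * ∑ r : ((Fin (i : ℕ) → ZMod 2) × (Fin (2 ^ n) → 𝒴)) ×
      ((Fin (i : ℕ) → ZMod 2) × (Fin (2 ^ n) → 𝒴)),
        2 * C * (√(p 0 r.1 * p 1 r.1) * √(p 0 r.2 * p 1 r.2)) := by
        refine mul_le_mul_of_nonneg_left (Finset.sum_le_sum fun r _ => ?_) zero_le_two
        have i1 := hbound r 0 0 1 1
        have i2 := hbound r 1 0 0 1
        rw [mul_comm (p 1 r.1)] at i2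
        linarith
    _ = C * (2 * ∑ q, √(p 0 q * p 1 q)) ^ 2 := by
        rw [Fintype.sum_prod_type, mul_pow, sq (∑ q, √(p 0 q * p 1 q)), Finset.sum_mul_sum]
        simp_rw [← Finset.mul_sum]
        ring

lemma polarZ_childIndex_zero_le (h : IsFAIM μ X Y S) {C : ℝ} (hC : ∀ b, (law μ (S 0) b)⁻¹ ≤ C)
    (hC0 : 0 ≤ C) (n : ℕ) (i : Fin (2 ^ n)) :
    polarZ μ X Y (n + 1) (childIndex i 0) ≤ 2 * C * polarZ μ X Y n i := by
  have hfac : (fun ω => (polarQ X Y n i ω, polarQ (fun k => X (k + ((2 ^ n : ℕ) : ℤ)))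
          (fun k => Y (k + ((2 ^ n : ℕ) : ℤ))) n i ω)).FactorsThrough
      (polarQ X Y (n + 1) (childIndex i 0)) := by
    intro ω ω' e
    simpa only [Prod.mk.injEq, polarQ_childIndex_zero_eq_iff] using e
  rw [polarZ]
  simp_rw [polarU_childIndex_zero]
  have mV := h.measurableFibers_polarU n i
  have mW := h.measurableFibers_polarU_shift ((2 ^ n : ℕ) : ℤ) n i
  refine (bhattacharyya_le_of_factorsThrough ((mV.prodMk mW).comp fun x => x.1 + x.2)
    (h.measurableFibers_polarQ (n + 1) (childIndex i 0)) hfac).trans ?_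
  rw [bhattacharyya_add mV mW ((h.measurableFibers_polarQ n i).prodMk
    (h.measurableFibers_polarQ_shift ((2 ^ n : ℕ) : ℤ) n i)), polarZ, bhattacharyya]
  set p := jointProb μ (fun ω => polarU X n ω i) (polarQ X Y n i) with hp
  have hp0 : ∀ u q, 0 ≤ p u q := jointProb_nonneg _ _ _
  have hsum : ∑ q, (p 0 q + p 1 q) = 1 :=
    sum_jointProb_binary mV (h.measurableFibers_polarQ n i)
  calc _ ≤ 2 * ∑ r : ((Fin (i : ℕ) → ZMod 2) × (Fin (2 ^ n) → 𝒴)) ×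
      ((Fin (i : ℕ) → ZMod 2) × (Fin (2 ^ n) → 𝒴)),
        C * ((p 0 r.1 + p 1 r.1) * √(p 0 r.2 * p 1 r.2) +
          √(p 0 r.1 * p 1 r.1) * (p 0 r.2 + p 1 r.2)) := by
        refine mul_le_mul_of_nonneg_left (Finset.sum_le_sum fun r _ => ?_) zero_le_two
        have i1 := add_le_add (h.law_two_blocks_le hC n i 0 0 r.1 r.2)
          (h.law_two_blocks_le hC n i 1 1 r.1 r.2)
        have i2 := add_le_add (h.law_two_blocks_le hC n i 1 0 r.1 r.2)
          (h.law_two_blocks_le hC n i 0 1 r.1 r.2)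
        have i3 := mul_le_mul i1 i2 (add_nonneg (law_nonneg _ _ _) (law_nonneg _ _ _))
          ((add_nonneg (law_nonneg _ _ _) (law_nonneg _ _ _)).trans i1)
        refine (Real.sqrt_le_sqrt i3).trans ?_
        rw [← hp, ← mul_add, ← mul_add, mul_mul_mul_comm, Real.sqrt_mul (mul_self_nonneg C),
          Real.sqrt_mul_self hC0]
        exact mul_le_mul_of_nonneg_left
          (sqrt_cross_le (hp0 _ _) (hp0 _ _) (hp0 _ _) (hp0 _ _)) hC0
    _ = 2 * C * (2 * ∑ q, √(p 0 q * p 1 q)) := by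
        rw [Fintype.sum_prod_type]
        simp_rw [← Finset.mul_sum, Finset.sum_add_distrib]
        simp_rw [← Finset.mul_sum, ← Finset.sum_mul]
        rw [hsum, one_mul, mul_one]
        ring

/-! #### The conditional entropy -/

/-- By the chain rule the left side is the joint entropy of the entries of both half blocks given
both observations. Dependence between the blocks can only reduce it. -/
lemma polarEntropy_children_le (h : IsFAIM μ X Y S) (n : ℕ) (i : Fin (2 ^ n)) :
    polarEntropy μ X Y (n + 1) (childIndex i 0) + polarEntropy μ X Y (n + 1) (childIndex i 1) ≤
      2 * polarEntropy μ X Y n i := by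
  have mV := h.measurableFibers_polarU n i
  have mW := h.measurableFibers_polarU_shift ((2 ^ n : ℕ) : ℤ) n i
  have mQ := h.measurableFibers_polarQ n i
  have mQ' := h.measurableFibers_polarQ_shift ((2 ^ n : ℕ) : ℤ) n i
  have m0 := h.measurableFibers_polarU (n + 1) (childIndex i 0)
  have m1 := h.measurableFibers_polarU (n + 1) (childIndex i 1)
  have mR := h.measurableFibers_polarQ (n + 1) (childIndex i 0)
  have e1 : polarEntropy μ X Y (n + 1) (childIndex i 1) =
      condEntropy μ (fun ω => polarU X (n + 1) ω (childIndex i 1))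
        (fun ω => (polarU X (n + 1) ω (childIndex i 0),
          polarQ X Y (n + 1) (childIndex i 0) ω)) := by
    refine condEntropy_congr m1 (m0.prodMk mR) ?_ ?_ ?_ ?_ <;> intro ω ω' e <;>
    simp only [Prod.mk.injEq, polarQ_childIndex_one_eq_iff] at e ⊢ <;> exact e
  have e2 : condEntropy μ (fun ω => (polarU X (n + 1) ω (childIndex i 0),
        polarU X (n + 1) ω (childIndex i 1))) (polarQ X Y (n + 1) (childIndex i 0)) =
      condEntropy μ (fun ω => (polarU X n ω i,
          polarU (fun k => X (k + ((2 ^ n : ℕ) : ℤ))) n ω i))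
        (fun ω => (polarQ X Y n i ω, polarQ (fun k => X (k + ((2 ^ n : ℕ) : ℤ)))
          (fun k => Y (k + ((2 ^ n : ℕ) : ℤ))) n i ω)) := by
    have hc := fun ω ω' => polarU_children_eq_iff X n i ω ω'
    simp only [Fin.forall_fin_two] at hc
    refine condEntropy_congr (mV.prodMk mW) (mQ.prodMk mQ') ?_ ?_ ?_ ?_ <;> intro ω ω' e <;>
    simp only [Prod.mk.injEq, polarQ_childIndex_zero_eq_iff, hc] at e ⊢ <;> exact e
  have e3 : condEntropy μ (fun ω => polarU (fun k => X (k + ((2 ^ n : ℕ) : ℤ))) n ω i)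
      (polarQ (fun k => X (k + ((2 ^ n : ℕ) : ℤ))) (fun k => Y (k + ((2 ^ n : ℕ) : ℤ))) n i) =
      polarEntropy μ X Y n i := by
    unfold polarEntropy condEntropy
    simp_rw [h.jointProb_polar_shift]
  rw [e1, polarEntropy, ← condEntropy_prod m0 m1 mR, e2, two_mul]
  refine (condEntropy_prod_le mV mW mQ mQ').trans (le_of_eq ?_)
  rw [e3, polarEntropy]

end IsFAIM

end Step

/-! ### The entropy rate -/

section Rate

variable {Ω : Type*} [MeasurableSpace Ω] {𝒴 𝒮 : Type*}
  [Fintype 𝒴] [MeasurableSpace 𝒴] [DiscreteMeasurableSpace 𝒴]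
  [Fintype 𝒮] [MeasurableSpace 𝒮] [DiscreteMeasurableSpace 𝒮]
  {μ : Measure Ω} [IsProbabilityMeasure μ]
  {X : ℤ → Ω → ZMod 2} {Y : ℤ → Ω → 𝒴} {S : ℤ → Ω → 𝒮}

/-- The chain rule for the entries of a random vector. -/
lemma sum_condEntropy_prefix {δ : Type*} [Fintype δ] {N : ℕ} {U : Ω → Fin N → ZMod 2} {D : Ω → δ}
    (hU : ∀ i, MeasurableFibers fun ω => U ω i) (hD : MeasurableFibers D) :
    ∑ i : Fin N, condEntropy μ (fun ω => U ω i)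
        (fun ω => ((fun k : Fin (i : ℕ) => U ω (Fin.castLE i.isLt.le k)), D ω)) =
      condEntropy μ U D := by
  -- The default value beyond `N` is never used; it allows induction on the length of the prefix.
  set g : ℕ → ℝ := fun k => if hk : k < N then condEntropy μ (fun ω => U ω ⟨k, hk⟩)
    (fun ω => ((fun j : Fin k => U ω (Fin.castLE hk.le j)), D ω)) else 0 with hg
  have hpre : ∀ k (hk : k ≤ N), MeasurableFibers fun ω (j : Fin k) => U ω (Fin.castLE hk j) :=
    fun k hk => .pi fun j => hU _
  have key : ∀ k (hk : k ≤ N), ∑ j ∈ Finset.range k, g j =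
      condEntropy μ (fun ω (j : Fin k) => U ω (Fin.castLE hk j)) D := by
    intro k
    induction k with
    | zero =>
      intro hk
      rw [Finset.range_zero, Finset.sum_empty, condEntropy_eq (hpre 0 hk) hD,
        entropy_congr (μ := μ) (A := D) hD (fun ω ω' e => by
          rw [Prod.mk.injEq]
          exact ⟨Subsingleton.elim _ _, e⟩) (fun ω ω' e => congrArg Prod.snd e), sub_self, zero_div]
    | succ k ih =>
      intro hk
      rw [Finset.sum_range_succ, ih (by omega), hg]
      simp only [dif_pos (show k < N by omega)]
      rw [← condEntropy_prod (hpre k (by omega)) (hU _) hD]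
      refine condEntropy_congr (hpre (k + 1) hk) hD ?_ ?_ (fun ω ω' e => e) (fun ω ω' e => e)
      · intro ω ω' e
        simp only [Prod.mk.injEq] at e ⊢
        exact ⟨⟨funext fun j => congrFun e.1 (Fin.castSucc j), congrFun e.1 (Fin.last k)⟩, e.2⟩
      · intro ω ω' e
        simp only [Prod.mk.injEq] at e ⊢
        refine ⟨funext fun j => ?_, e.2⟩
        refine Fin.lastCases ?_ (fun j => ?_) j
        · exact e.1.2
        · exact congrFun e.1.1 j
  refine Eq.trans ?_ ((key N le_rfl).trans rfl)
  rw [← Fin.sum_univ_eq_sum_range]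
  exact Finset.sum_congr rfl fun i _ => by simp only [hg, dif_pos i.isLt, Fin.eta]

namespace IsFAIM

lemma measurableFibers_blockX (h : IsFAIM μ X Y S) (N : ℕ) : MeasurableFibers (block X N) :=
  .pi fun _ => (h.measurable_X _).measurableFibers

lemma measurableFibers_blockY (h : IsFAIM μ X Y S) (N : ℕ) : MeasurableFibers (block Y N) :=
  .pi fun _ => (h.measurable_Y _).measurableFibers

/-- The conditional entropy of `U_i` given `Q_i` and the boundary states. -/
def _root_.Polar.boundaryEntropy (μ : Measure Ω) (X : ℤ → Ω → ZMod 2) (Y : ℤ → Ω → 𝒴)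
    (S : ℤ → Ω → 𝒮) (n : ℕ) (i : Fin (2 ^ n)) : ℝ :=
  condEntropy μ (fun ω => polarU X n ω i) (boundaryQ X Y S n i)

lemma sum_polarEntropy (h : IsFAIM μ X Y S) (n : ℕ) :
    ∑ i, polarEntropy μ X Y n i = condEntropy μ (block X (2 ^ n)) (block Y (2 ^ n)) := by
  have mX := h.measurableFibers_blockX (2 ^ n)
  have mY := h.measurableFibers_blockY (2 ^ n)
  refine (sum_condEntropy_prefix (h.measurableFibers_polarU n) mY).trans ?_
  refine condEntropy_congr mX mY ?_ ?_ (fun _ _ e => e) (fun _ _ e => e) <;>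
  · intro ω ω' e
    simpa only [Prod.mk.injEq, polarU_eq_iff] using e

lemma sum_boundaryEntropy (h : IsFAIM μ X Y S) (n : ℕ) :
    ∑ i, boundaryEntropy μ X Y S n i = condEntropy μ (block X (2 ^ n))
      (fun ω => (block Y (2 ^ n) ω, S 0 ω, S ((2 ^ n : ℕ) : ℤ) ω)) := by
  have mX := h.measurableFibers_blockX (2 ^ n)
  have mD : MeasurableFibers (fun ω => (block Y (2 ^ n) ω, S 0 ω, S ((2 ^ n : ℕ) : ℤ) ω)) :=
    (h.measurableFibers_blockY (2 ^ n)).prodMk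
      ((h.measurableFibers_S 0).prodMk (h.measurableFibers_S _))
  have e1 : ∀ i : Fin (2 ^ n), boundaryEntropy μ X Y S n i = condEntropy μ
      (fun ω => polarU X n ω i)
      (fun ω => ((fun k : Fin (i : ℕ) => polarU X n ω (Fin.castLE i.isLt.le k)),
        (block Y (2 ^ n) ω, S 0 ω, S ((2 ^ n : ℕ) : ℤ) ω))) := fun i => by
    have mP : MeasurableFibers
        fun ω (k : Fin (i : ℕ)) => polarU X n ω (Fin.castLE i.isLt.le k) :=
      .pi fun k => h.measurableFibers_polarU n _
    refine condEntropy_congr (h.measurableFibers_polarU n i) (mP.prodMk mD) ?_ ?_ ?_ ?_ <;>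
    intro ω ω' e <;> simp only [boundaryQ, polarQ, Prod.mk.injEq] at e ⊢ <;> tauto
  simp_rw [e1]
  refine (sum_condEntropy_prefix (h.measurableFibers_polarU n) mD).trans ?_
  refine condEntropy_congr mX mD ?_ ?_ (fun _ _ e => e) (fun _ _ e => e) <;>
  · intro ω ω' e
    simpa only [Prod.mk.injEq, polarU_eq_iff] using e

lemma condEntropy_block_shift (h : IsFAIM μ X Y S) (m : ℤ) (N : ℕ) :
    condEntropy μ (block (fun k => X (k + m)) N) (block (fun k => Y (k + m)) N) =
      condEntropy μ (block X N) (block Y N) := by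
  have e : ∀ x y, jointProb μ (block (fun k => X (k + m)) N) (block (fun k => Y (k + m)) N) x y =
      jointProb μ (block X N) (block Y N) x y := fun x y => by
    rw [jointProb_eq_law, jointProb_eq_law]
    have := congrFun (h.law_comp_window m N fun w => (w.1, w.2.1)) (x, y)
    simp only [window_zero] at this
    exact this
  unfold condEntropy
  simp_rw [e]

lemma subadditive_condEntropy_block (h : IsFAIM μ X Y S) :
    Subadditive fun N => condEntropy μ (block X N) (block Y N) := by
  intro N M
  have mX := h.measurableFibers_blockX N
  have mY := h.measurableFibers_blockY N
  have mX' : MeasurableFibers (block (fun k => X (k + (N : ℤ))) M) :=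
    .pi fun _ => (h.measurable_X _).measurableFibers
  have mY' : MeasurableFibers (block (fun k => Y (k + (N : ℤ))) M) :=
    .pi fun _ => (h.measurable_Y _).measurableFibers
  beta_reduce
  rw [← h.condEntropy_block_shift N M]
  refine le_trans (le_of_eq ?_) (condEntropy_prod_le mX mX' mY mY')
  refine condEntropy_congr (mX.prodMk mX') (mY.prodMk mY') ?_ ?_ ?_ ?_ <;> intro ω ω' e <;>
  simp only [Prod.mk.injEq, block_add_eq_iff] at e ⊢ <;> exact e

/-- The conditional entropy rate exists. -/
lemma exists_entropyRate (h : IsFAIM μ X Y S) :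
    ∃ r : ℝ, Tendsto (fun N : ℕ => (1 / (N : ℝ)) * condEntropy μ (block X N) (block Y N))
      atTop (𝓝 r) := by
  refine ⟨h.subadditive_condEntropy_block.lim, ?_⟩
  refine (h.subadditive_condEntropy_block.tendsto_lim ⟨0, ?_⟩).congr fun N => by
    rw [one_div, inv_mul_eq_div]
  rintro _ ⟨N, rfl⟩
  exact div_nonneg (condEntropy_nonneg (h.measurableFibers_blockX N) (h.measurableFibers_blockY N))
    (Nat.cast_nonneg N)

lemma boundaryEntropy_le_polarEntropy (h : IsFAIM μ X Y S) (n : ℕ) (i : Fin (2 ^ n)) :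
    boundaryEntropy μ X Y S n i ≤ polarEntropy μ X Y n i :=
  condEntropy_le_of_factorsThrough (h.measurableFibers_polarU n i)
    (h.measurableFibers_boundaryQ n i) fun _ _ e => congrArg Prod.fst e

lemma tendsto_average_polarEntropy (h : IsFAIM μ X Y S) {r : ℝ}
    (hr : Tendsto (fun N : ℕ => (1 / (N : ℝ)) * condEntropy μ (block X N) (block Y N))
      atTop (𝓝 r)) :
    Tendsto (fun n : ℕ => (∑ i, polarEntropy μ X Y n i) / 2 ^ n) atTop (𝓝 r) := by
  refine (hr.comp (tendsto_pow_atTop_atTop_of_one_lt one_lt_two)).congr fun n => ?_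
  simp only [Function.comp, h.sum_polarEntropy]
  push_cast
  rw [one_div, inv_mul_eq_div]

/-- Revealing two states lowers the entropy of the whole block by at most a constant, which vanishes
after division by `2 ^ n`. -/
lemma tendsto_average_boundaryEntropy (h : IsFAIM μ X Y S) {r : ℝ}
    (hr : Tendsto (fun N : ℕ => (1 / (N : ℝ)) * condEntropy μ (block X N) (block Y N))
      atTop (𝓝 r)) :
    Tendsto (fun n : ℕ => (∑ i, boundaryEntropy μ X Y S n i) / 2 ^ n) atTop (𝓝 r) := by
  have h1 := h.tendsto_average_polarEntropy hr
  have h2 : Tendsto (fun n : ℕ => (Fintype.card (𝒮 × 𝒮) / Real.log 2 : ℝ) / 2 ^ n) atTop (𝓝 0) :=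
    tendsto_const_nhds.div_atTop (tendsto_pow_atTop_atTop_of_one_lt one_lt_two)
  have h3 := h1.sub h2
  rw [sub_zero] at h3
  refine tendsto_of_tendsto_of_tendsto_of_le_of_le h3 h1 (fun n => ?_) (fun n => ?_)
  · rw [← sub_div, h.sum_polarEntropy, h.sum_boundaryEntropy]
    refine div_le_div_of_nonneg_right ?_ (by positivity)
    exact sub_le_iff_le_add.2 (condEntropy_le_condEntropy_prod_add (h.measurableFibers_blockX _)
      (h.measurableFibers_blockY _)
      ((h.measurableFibers_S 0).prodMk (h.measurableFibers_S ((2 ^ n : ℕ) : ℤ))))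
  · exact div_le_div_of_nonneg_right
      (Finset.sum_le_sum fun i _ => h.boundaryEntropy_le_polarEntropy n i) (by positivity)

end IsFAIM

end Rate

/-! ### Processes on the binary tree -/

section Tree

variable {Ω' : Type*} [MeasurableSpace Ω'] {ν : Measure Ω'} [IsProbabilityMeasure ν]
  {B : ℕ → Ω' → Fin 2}

/-- The random index with binary digits `B`. -/
def randomIndex (B : ℕ → Ω' → Fin 2) (n : ℕ) (ω : Ω') : Fin (2 ^ n) :=
  polarIndex (fun j => B j ω) n

/-- The index without its last binary digit. -/
def parentIndex {n : ℕ} (i : Fin (2 ^ (n + 1))) : Fin (2 ^ n) :=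
  finFunctionFinEquiv (Fin.tail (digit i))

lemma parentIndex_childIndex {n : ℕ} (j : Fin (2 ^ n)) (c : Fin 2) :
    parentIndex (childIndex j c) = j := by
  rw [parentIndex, digit_childIndex, Fin.tail_cons]
  exact finFunctionFinEquiv.apply_symm_apply j

lemma randomIndex_succ (B : ℕ → Ω' → Fin 2) (n : ℕ) (ω : Ω') :
    randomIndex B (n + 1) ω = childIndex (randomIndex B n ω) (B n ω) :=
  polarIndex_succ _ n

lemma parentIndex_randomIndex (B : ℕ → Ω' → Fin 2) (n : ℕ) (ω : Ω') :
    parentIndex (randomIndex B (n + 1) ω) = randomIndex B n ω := by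
  rw [randomIndex_succ, parentIndex_childIndex]

namespace IsFairBits

lemma measurable_randomIndex (hB : IsFairBits ν B) (n : ℕ) : Measurable (randomIndex B n) :=
  (Measurable.of_discrete (f := (finFunctionFinEquiv : (Fin n → Fin 2) ≃ Fin (2 ^ n)))).comp
    (measurable_pi_lambda _ fun _ => hB.measurable _)

lemma real_randomIndex_eq (hB : IsFairBits ν B) (n : ℕ) (i : Fin (2 ^ n)) :
    ν.real (randomIndex B n ⁻¹' {i}) = 1 / 2 ^ n := by
  have hinj : Function.Injective fun k : Fin n => ((k.rev : Fin n) : ℕ) := fun a b h =>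
    Fin.rev_injective (Fin.ext h)
  have hind := hB.indep.precomp hinj
  have key := hind.measure_inter_preimage_eq_mul Finset.univ (sets := fun k => {digit i k})
    (fun k _ => measurableSet_singleton _)
  have e : randomIndex B n ⁻¹' {i} =
      ⋂ k ∈ (Finset.univ : Finset (Fin n)), B ((k.rev : Fin n) : ℕ) ⁻¹' {digit i k} := by
    ext ω
    simp only [Set.mem_preimage, Set.mem_singleton_iff, Finset.mem_univ, Set.iInter_true,
      Set.mem_iInter]
    rw [randomIndex, polarIndex, ← Equiv.eq_symm_apply, funext_iff]
    rfl
  rw [e, Measure.real, key, ENNReal.toReal_prod]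
  calc _ = ∏ k : Fin n, (1 / 2 : ℝ) := Finset.prod_congr rfl fun k _ => hB.fair _ _
    _ = _ := by simp

lemma integral_randomIndex (hB : IsFairBits ν B) (n : ℕ) (f : Fin (2 ^ n) → ℝ) :
    ∫ ω, f (randomIndex B n ω) ∂ν = (∑ i, f i) / 2 ^ n := by
  have hm := hB.measurable_randomIndex n
  rw [← integral_map (φ := randomIndex B n) (f := f) hm.aemeasurable
    (Measurable.of_discrete).aestronglyMeasurable]
  have : IsProbabilityMeasure (ν.map (randomIndex B n)) :=
    Measure.isProbabilityMeasure_map hm.aemeasurable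
  rw [integral_fintype Integrable.of_finite, Finset.sum_div]
  refine Finset.sum_congr rfl fun i _ => ?_
  rw [map_measureReal_apply hm (measurableSet_singleton i), hB.real_randomIndex_eq, smul_eq_mul]
  ring

lemma integrable_randomIndex (hB : IsFairBits ν B) (n : ℕ) (f : Fin (2 ^ n) → ℝ) :
    Integrable (fun ω => f (randomIndex B n ω)) ν := by
  have hm := hB.measurable_randomIndex n
  have : IsProbabilityMeasure (ν.map (randomIndex B n)) :=
    Measure.isProbabilityMeasure_map hm.aemeasurable
  exact (Integrable.of_finite (f := f) (μ := ν.map (randomIndex B n))).comp_measurable hm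

lemma real_randomIndex_preimage (hB : IsFairBits ν B) (n : ℕ) (T : Set (Fin (2 ^ n))) :
    ν.real (randomIndex B n ⁻¹' T) = 1 / 2 ^ n * (T.ncard : ℝ) := by
  classical
  rw [← integral_indicator_one (hB.measurable_randomIndex n (Set.toFinite T).measurableSet)]
  have := hB.integral_randomIndex n (T.indicator 1)
  refine Eq.trans ?_ (this.trans ?_)
  · rfl
  · rw [Finset.sum_indicator_eq_sum_filter, Set.ncard_eq_toFinset_card']
    simp [div_eq_inv_mul]

/-- The filtration generated by the random indices. -/
def filtration (hB : IsFairBits ν B) : Filtration ℕ (inferInstance : MeasurableSpace Ω') where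
  seq n := MeasurableSpace.comap (randomIndex B n) ⊤
  mono' := monotone_nat_of_le_succ fun n => by
    rintro _ ⟨T, -, rfl⟩
    refine ⟨parentIndex ⁻¹' T, trivial, ?_⟩
    ext ω
    simp [parentIndex_randomIndex]
  le' n := by
    rintro _ ⟨T, -, rfl⟩
    exact hB.measurable_randomIndex n (Set.toFinite T).measurableSet

/-- A bounded process on the binary tree that does not increase on average converges almost
surely. -/
lemma ae_exists_tendsto (hB : IsFairBits ν B) {f : ∀ n, Fin (2 ^ n) → ℝ} {R : ℝ}
    (hR : ∀ n i, |f n i| ≤ R)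
    (hf : ∀ n i, f (n + 1) (childIndex i 0) + f (n + 1) (childIndex i 1) ≤ 2 * f n i) :
    ∀ᵐ ω ∂ν, ∃ l, Tendsto (fun n => f n (randomIndex B n ω)) atTop (𝓝 l) := by
  classical
  have hsuper : Supermartingale (fun n ω => f n (randomIndex B n ω)) hB.filtration ν := by
    refine supermartingale_of_setIntegral_succ_le (fun n => ?_)
      (fun n => hB.integrable_randomIndex n (f n)) ?_
    · refine Measurable.stronglyMeasurable ?_
      intro s _
      exact ⟨f n ⁻¹' s, trivial, rfl⟩
    -- Events of the filtration are sets of indices, so both set integrals are finite sums and can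
    -- be compared index by index.
    · rintro n _ ⟨T, -, rfl⟩
      have hT : MeasurableSet (randomIndex B n ⁻¹' T) :=
        hB.measurable_randomIndex n (Set.toFinite T).measurableSet
      rw [← integral_indicator hT, ← integral_indicator hT]
      have e1 : (randomIndex B n ⁻¹' T).indicator (fun ω => f n (randomIndex B n ω)) =
          fun ω => (fun i => if i ∈ T then f n i else 0) (randomIndex B n ω) := by
        ext ω
        simp [Set.indicator_apply]
      have e2 : (randomIndex B n ⁻¹' T).indicator
          (fun ω => f (n + 1) (randomIndex B (n + 1) ω)) =
          fun ω => (fun i => if parentIndex i ∈ T then f (n + 1) i else 0)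
            (randomIndex B (n + 1) ω) := by
        ext ω
        simp [Set.indicator_apply, parentIndex_randomIndex]
      rw [e1, e2, hB.integral_randomIndex, hB.integral_randomIndex, sum_childIndex, pow_succ,
        mul_comm, ← div_div]
      refine div_le_div_of_nonneg_right ?_ (by positivity)
      rw [div_le_iff₀ two_pos, Finset.sum_mul]
      refine Finset.sum_le_sum fun i _ => ?_
      simp only [parentIndex_childIndex]
      split_ifs
      · linarith [hf n i]
      · simp
  have hbdd : ∀ n, eLpNorm ((-fun n ω => f n (randomIndex B n ω)) n) 1 ν ≤
      (R.toNNReal : ENNReal) := by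
    intro n
    refine (eLpNorm_le_of_ae_bound (C := R) (Eventually.of_forall fun ω => ?_)).trans ?_
    · simpa using hR n _
    · simp [ENNReal.ofReal]
  filter_upwards [hsuper.neg.ae_tendsto_limitProcess hbdd] with ω hω
  have hneg := hω.neg
  simp only [Pi.neg_apply, neg_neg] at hneg
  exact ⟨_, hneg⟩

/-- The strong law of large numbers for fair bits. -/
lemma ae_tendsto_average (hB : IsFairBits ν B) :
    ∀ᵐ ω ∂ν, Tendsto (fun n : ℕ => (∑ j ∈ Finset.range n, ((B j ω : ℕ) : ℝ)) / n) atTop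
      (𝓝 (1 / 2)) := by
  have hm : Measurable fun b : Fin 2 => ((b : ℕ) : ℝ) := Measurable.of_discrete
  have hlaw : ∀ j, ν.map (B j) = ν.map (B 0) := fun j => by
    refine Measure.ext_of_singleton fun b => ?_
    rw [Measure.map_apply (hB.measurable j) (measurableSet_singleton b),
      Measure.map_apply (hB.measurable 0) (measurableSet_singleton b)]
    have := (hB.fair j b).trans (hB.fair 0 b).symm
    exact (ENNReal.toReal_eq_toReal_iff' (measure_ne_top _ _) (measure_ne_top _ _)).1 this
  have hP : IsProbabilityMeasure (ν.map (B 0)) :=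
    Measure.isProbabilityMeasure_map (hB.measurable 0).aemeasurable
  have hint : Integrable (fun ω => ((B 0 ω : ℕ) : ℝ)) ν :=
    (Integrable.of_finite (f := fun b : Fin 2 => ((b : ℕ) : ℝ))
      (μ := ν.map (B 0))).comp_measurable (hB.measurable 0)
  have hmean : ∫ ω, ((B 0 ω : ℕ) : ℝ) ∂ν = 1 / 2 := by
    rw [← integral_map (φ := B 0) (f := fun b : Fin 2 => ((b : ℕ) : ℝ))
      (hB.measurable 0).aemeasurable hm.aestronglyMeasurable, integral_fintype Integrable.of_finite,
      Fin.sum_univ_two, map_measureReal_apply (hB.measurable 0) (measurableSet_singleton 1),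
      hB.fair]
    simp
  have := strong_law_ae_real (μ := ν) (fun j ω => ((B j ω : ℕ) : ℝ)) hint
    (fun i j hij => (hB.indep.indepFun hij).comp hm hm)
    (fun j => (IdentDistrib.mk (hB.measurable j).aemeasurable (hB.measurable 0).aemeasurable
      (hlaw j)).comp hm)
  rw [hmean] at this
  exact this

end IsFairBits

/-- The law of a fair bit. -/
def fairBit : Measure (Fin 2) := (PMF.uniformOfFintype (Fin 2)).toMeasure

instance : IsProbabilityMeasure fairBit := by
  unfold fairBit
  infer_instance

lemma isFairBits_infinitePi :
    IsFairBits (Measure.infinitePi fun _ : ℕ => fairBit) fun n ω => ω n where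
  measurable n := measurable_pi_apply n
  indep := iIndepFun_infinitePi (X := fun _ b => b) fun _ => measurable_id
  fair n b := by
    have hmp := (measurePreserving_eval_infinitePi (fun _ : ℕ => fairBit) n).measure_preimage
      (measurableSet_singleton b).nullMeasurableSet
    unfold Measure.real
    refine (congrArg ENNReal.toReal hmp).trans ?_
    rw [fairBit, PMF.toMeasure_apply_singleton _ _ (measurableSet_singleton b)]
    simp

end Tree

/-! ### Fast polarization along a path -/

section Fast

/-- With finitely many ones the averages would tend to 0. -/
lemma frequently_of_tendsto_average {g : ℕ → ℝ} (hg : ∀ n, g n = 0 ∨ g n = 1)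
    (h : Tendsto (fun n : ℕ => (∑ j ∈ Finset.range n, g j) / n) atTop (𝓝 (1 / 2))) :
    ∃ᶠ n in atTop, g n = 1 := by
  intro hev
  obtain ⟨m, hm⟩ := eventually_atTop.1 hev
  have hbound : ∀ n, ∑ j ∈ Finset.range n, g j ≤ m := by
    intro n
    have h1 : ∀ j, g j ≤ if j < m then 1 else 0 := fun j => by
      split_ifs with hj
      · rcases hg j with e | e <;> simp [e]
      · rcases hg j with e | e
        · simp [e]
        · exact absurd e (hm j (not_lt.1 hj))
    refine (Finset.sum_le_sum fun j _ => h1 j).trans ?_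
    rw [← Finset.sum_filter, Finset.sum_const, nsmul_eq_mul, mul_one]
    have : (Finset.range n).filter (· < m) ⊆ Finset.range m := fun j hj => by
      simp only [Finset.mem_filter, Finset.mem_range] at hj ⊢
      exact hj.2
    have := Finset.card_le_card this
    rw [Finset.card_range] at this
    exact_mod_cast this
  have h0 : Tendsto (fun n : ℕ => (m : ℝ) / n) atTop (𝓝 0) :=
    tendsto_const_nhds.div_atTop tendsto_natCast_atTop_atTop
  have := le_of_tendsto_of_tendsto' h h0 fun n =>
    div_le_div_of_nonneg_right (hbound n) (Nat.cast_nonneg n)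
  norm_num at this

/-- A positive sequence of exponents that is doubled, up to a constant, half of the time, grows
like `2 ^ (n β)` for every `β < 1 / 2`. -/
lemma eventually_rpow_le_of_doubling {L g : ℕ → ℝ} {c : ℝ} (hg : ∀ n, g n = 0 ∨ g n = 1)
    (havg : Tendsto (fun n : ℕ => (∑ j ∈ Finset.range n, g j) / n) atTop (𝓝 (1 / 2)))
    (h1 : ∀ n, g n = 1 → 2 * L n - c ≤ L (n + 1)) (h0 : ∀ n, g n = 0 → L n - c ≤ L (n + 1))
    (hL : Tendsto L atTop atTop) (hc : 0 ≤ c) {β : ℝ} (hβ : β < 1 / 2) :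
    ∀ᶠ n : ℕ in atTop, (2 : ℝ) ^ ((n : ℝ) * β) ≤ L n := by
  -- The margin `1 / 2 - β = 4 * δ` is spent as follows: `δ` on the error of the averages, `δ` on
  -- absorbing the constant `c`, and `2 * δ` on the initial segment of length `m`.
  set δ := (1 / 2 - β) / 4 with hδ
  have hδ0 : 0 < δ := by rw [hδ]; linarith
  set θ : ℝ := (2 : ℝ) ^ (-δ) with hθ
  have hθ0 : 0 < θ := by positivity
  have hθ1 : θ < 1 := Real.rpow_lt_one_of_one_lt_of_neg one_lt_two (by linarith)
  obtain ⟨m, hm⟩ := eventually_atTop.1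
    ((hL.eventually_ge_atTop 1).and (hL.eventually_ge_atTop (c / (1 - θ))))
  set G : ℕ → ℝ := fun n => ∑ j ∈ Finset.range n, g j with hG
  have hG1 : ∀ n, G n ≤ n := fun n => by
    refine (Finset.sum_le_sum (g := fun _ => (1 : ℝ)) fun j _ => ?_).trans (by simp)
    rcases hg j with e | e <;> simp [e]
  -- Once `L n ≥ c / (1 - θ)`, subtracting `c` costs no more than multiplying by `θ`, so each step
  -- is multiplicative.
  have hstep : ∀ n, m ≤ n → (2 : ℝ) ^ (g n - δ) * L n ≤ L (n + 1) := by
    intro n hn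
    have hA := (div_le_iff₀ (by linarith : 0 < 1 - θ)).1 (hm n hn).2
    rw [sub_eq_add_neg, Real.rpow_add two_pos, ← hθ]
    rcases hg n with e | e
    · rw [e, Real.rpow_zero]
      linarith [h0 n e]
    · rw [e, Real.rpow_one]
      linarith [h1 n e]
  have hind : ∀ k : ℕ, (2 : ℝ) ^ (G (m + k) - G m - δ * k) ≤ L (m + k) := by
    intro k
    induction k with
    | zero => simpa using (hm m le_rfl).1
    | succ k ih =>
      refine le_trans ?_ (hstep (m + k) (by omega))
      refine le_trans (le_of_eq ?_) (mul_le_mul_of_nonneg_left ih (by positivity))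
      rw [← Real.rpow_add two_pos]
      congr 1
      have : G (m + (k + 1)) = G (m + k) + g (m + k) := Finset.sum_range_succ _ _
      rw [this]
      push_cast
      ring
  have hev : ∀ᶠ n : ℕ in atTop, 1 / 2 - δ < G n / n :=
    havg.eventually (lt_mem_nhds (by linarith))
  have hlarge : ∀ᶠ n : ℕ in atTop, (m : ℝ) / (2 * δ) ≤ n :=
    tendsto_natCast_atTop_atTop.eventually_ge_atTop _
  filter_upwards [hev, hlarge, eventually_ge_atTop m, eventually_gt_atTop 0] with n hn1 hn2 hn3 hn4
  obtain ⟨k, rfl⟩ := Nat.exists_eq_add_of_le hn3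
  refine le_trans (Real.rpow_le_rpow_of_exponent_le one_le_two ?_) (hind k)
  have hn4' : (0 : ℝ) < ((m + k : ℕ) : ℝ) := by exact_mod_cast hn4
  rw [lt_div_iff₀ hn4'] at hn1
  rw [div_le_iff₀ (by linarith)] at hn2
  have hGm := hG1 m
  push_cast at hn1 hn2 ⊢
  have hm0 : (0 : ℝ) ≤ m := Nat.cast_nonneg m
  have : β = 1 / 2 - 4 * δ := by rw [hδ]; ring
  rw [this]
  nlinarith

/-- If a nonnegative sequence tends to zero and is squared, up to a constant factor, half of the
time, then it is eventually below `2 ^ (-2 ^ (n β))` for every `β < 1 / 2`. -/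
lemma eventually_lt_of_squaring {K g : ℕ → ℝ} {C : ℝ} (hg : ∀ n, g n = 0 ∨ g n = 1)
    (havg : Tendsto (fun n : ℕ => (∑ j ∈ Finset.range n, g j) / n) atTop (𝓝 (1 / 2)))
    (hC : 1 ≤ C) (h1 : ∀ n, g n = 1 → K (n + 1) ≤ C * K n ^ 2)
    (h0 : ∀ n, g n = 0 → K (n + 1) ≤ C * K n) (hK0 : ∀ n, 0 ≤ K n)
    (hK : Tendsto K atTop (𝓝 0)) {β : ℝ} (hβ : β < 1 / 2) :
    ∀ᶠ n : ℕ in atTop, K n < (2 : ℝ) ^ (-(2 : ℝ) ^ ((n : ℝ) * β)) := by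
  -- Logarithms need positive values; a sequence that reaches zero stays there.
  by_cases hz : ∃ m, K m = 0
  · obtain ⟨m, hm⟩ := hz
    filter_upwards [eventually_ge_atTop m] with n hn
    have : K n = 0 := by
      induction n, hn using Nat.le_induction with
      | base => exact hm
      | succ n _ ih =>
        refine le_antisymm ?_ (hK0 _)
        rcases hg n with e | e
        · simpa [ih] using h0 n e
        · simpa [ih] using h1 n e
    rw [this]
    positivity
  · push Not at hz
    have hpos : ∀ n, 0 < K n := fun n => (hK0 n).lt_of_ne' (hz n)
    have hCpos : 0 < C := by linarith
    have hL : Tendsto (fun n => -Real.log (K n)) atTop atTop :=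
      tendsto_neg_atBot_atTop.comp (Real.tendsto_log_nhdsGT_zero.comp
        (tendsto_nhdsWithin_iff.2 ⟨hK, Eventually.of_forall hpos⟩))
    have key := eventually_rpow_le_of_doubling (L := fun n => -Real.log (K n)) (c := Real.log C)
      hg havg (fun n e => by
        have := Real.log_le_log (hpos _) (h1 n e)
        rw [Real.log_mul hCpos.ne' (pow_pos (hpos n) 2).ne', Real.log_pow] at this
        push_cast at this
        linarith)
      (fun n e => by
        have := Real.log_le_log (hpos _) (h0 n e)
        rw [Real.log_mul hCpos.ne' (hpos n).ne'] at this
        linarith) hL (Real.log_nonneg hC) hβ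
    filter_upwards [key] with n hn
    rw [← Real.log_lt_log_iff (hpos n) (by positivity), Real.log_rpow two_pos]
    have hp : (0 : ℝ) < (2 : ℝ) ^ ((n : ℝ) * β) := by positivity
    have hlog : Real.log 2 < 1 := by
      have := Real.log_two_lt_d9
      linarith
    nlinarith

end Fast

/-! ### Almost sure polarization -/

section Polarization

variable {Ω : Type*} [MeasurableSpace Ω] {𝒴 𝒮 : Type*}
  [Fintype 𝒴] [MeasurableSpace 𝒴] [DiscreteMeasurableSpace 𝒴]
  [Fintype 𝒮] [MeasurableSpace 𝒮] [DiscreteMeasurableSpace 𝒮]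
  {μ : Measure Ω} [IsProbabilityMeasure μ]
  {X : ℤ → Ω → ZMod 2} {Y : ℤ → Ω → 𝒴} {S : ℤ → Ω → 𝒮}
  {Ω' : Type*} [MeasurableSpace Ω'] {ν : Measure Ω'} [IsProbabilityMeasure ν]
  {B : ℕ → Ω' → Fin 2}

/-- The event that the total variation parameters with boundary states converge to zero along the
path `B`. -/
def noiseEvent (μ : Measure Ω) (X : ℤ → Ω → ZMod 2) (Y : ℤ → Ω → 𝒴) (S : ℤ → Ω → 𝒮)
    (B : ℕ → Ω' → Fin 2) : Set Ω' :=
  {ω | Tendsto (fun n => boundaryTV μ X Y S n (randomIndex B n ω)) atTop (𝓝 0)}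

lemma IsFairBits.measurableSet_noiseEvent (hB : IsFairBits ν B) :
    MeasurableSet (noiseEvent μ X Y S B) := by
  refine measurableSet_tendsto (𝓝 0) fun n => ?_
  exact (Measurable.of_discrete (f := boundaryTV μ X Y S n)).comp (hB.measurable_randomIndex n)

lemma one_sub_bit_eq_zero_or_one (b : ℕ → Fin 2) (n : ℕ) :
    1 - ((b n : ℕ) : ℝ) = 0 ∨ 1 - ((b n : ℕ) : ℝ) = 1 := by
  generalize b n = c
  fin_cases c <;> simp

lemma bit_eq_zero_or_one (b : ℕ → Fin 2) (n : ℕ) :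
    ((b n : ℕ) : ℝ) = 0 ∨ ((b n : ℕ) : ℝ) = 1 := by
  generalize b n = c
  fin_cases c <;> simp

lemma tendsto_average_one_sub_bit {b : ℕ → Fin 2}
    (h : Tendsto (fun n : ℕ => (∑ j ∈ Finset.range n, ((b j : ℕ) : ℝ)) / n) atTop (𝓝 (1 / 2))) :
    Tendsto (fun n : ℕ => (∑ j ∈ Finset.range n, (1 - ((b j : ℕ) : ℝ))) / n) atTop
      (𝓝 (1 / 2)) := by
  have h1 : Tendsto (fun n : ℕ => (1 : ℝ) - (∑ j ∈ Finset.range n, ((b j : ℕ) : ℝ)) / n) atTop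
      (𝓝 (1 - 1 / 2)) := tendsto_const_nhds.sub h
  rw [show (1 : ℝ) - 1 / 2 = 1 / 2 by norm_num] at h1
  refine h1.congr' ?_
  filter_upwards [eventually_gt_atTop 0] with n hn
  have hn' : (n : ℝ) ≠ 0 := by positivity
  rw [Finset.sum_sub_distrib]
  simp only [Finset.sum_const, Finset.card_range, nsmul_eq_mul, mul_one]
  rw [sub_div, div_self hn']

/-- The thresholds near one stay above any fixed doubly exponentially small sequence. -/
lemma eventually_rpow_le_threshold (β : ℝ) :
    ∀ᶠ n : ℕ in atTop, (2 : ℝ) ^ (-(2 : ℝ) ^ ((n : ℝ) * (1 / 4))) ≤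
      1 - (2 : ℝ) ^ (-(2 : ℝ) ^ ((n : ℝ) * β)) := by
  -- For negative `β` the threshold tends to 0, but no faster than `2 ^ (-(n * b) - 1)`.
  set b := max (-β) 0 with hb
  have hb0 : 0 ≤ b := le_max_right _ _
  have hlim := (tendsto_pow_const_div_const_pow_of_one_lt 1
    (Real.one_lt_rpow one_lt_two (by norm_num : (0 : ℝ) < 1 / 4))).const_mul (b + 1)
  rw [mul_zero] at hlim
  filter_upwards [hlim.eventually (gt_mem_nhds one_pos), eventually_gt_atTop 0] with n hn hn0
  have hn1 : (1 : ℝ) ≤ n := by exact_mod_cast hn0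
  rw [← Real.rpow_natCast ((2 : ℝ) ^ (1 / 4 : ℝ)), ← Real.rpow_mul zero_le_two,
    pow_one, ← mul_div_assoc,
    div_lt_one (by positivity), mul_comm (1 / 4 : ℝ)] at hn
  have hx : (2 : ℝ) ^ (-(n * b)) ≤ (2 : ℝ) ^ ((n : ℝ) * β) := by
    refine Real.rpow_le_rpow_of_exponent_le one_le_two ?_
    have : -β ≤ b := le_max_left _ _
    nlinarith
  have hx1 : (2 : ℝ) ^ (-(n * b)) ≤ 1 :=
    Real.rpow_le_one_of_one_le_of_nonpos one_le_two (by nlinarith)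
  -- Bernoulli's inequality: 2^{-x} ≤ 1 - x/2 for 0 ≤ x ≤ 1.
  have hbern := rpow_one_add_le_one_add_mul_self (s := -(1 / 2)) (by norm_num)
    (p := (2 : ℝ) ^ (-(n * b))) (by positivity) hx1
  have e1 : (1 + -(1 / 2) : ℝ) ^ ((2 : ℝ) ^ (-(n * b))) = (2 : ℝ) ^ (-(2 : ℝ) ^ (-(n * b))) := by
    rw [Real.rpow_neg zero_le_two ((2 : ℝ) ^ (-(n * b))), ← Real.inv_rpow zero_le_two]
    norm_num
  rw [e1] at hbern
  have h2 : (2 : ℝ) ^ (-(2 : ℝ) ^ ((n : ℝ) * β)) ≤ (2 : ℝ) ^ (-(2 : ℝ) ^ (-(n * b))) :=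
    Real.rpow_le_rpow_of_exponent_le one_le_two (neg_le_neg hx)
  have h3 : (2 : ℝ) ^ (-(2 : ℝ) ^ ((n : ℝ) * (1 / 4))) ≤ (2 : ℝ) ^ (-(n * b) - 1) :=
    Real.rpow_le_rpow_of_exponent_le one_le_two (by nlinarith)
  rw [Real.rpow_sub two_pos, Real.rpow_one] at h3
  linarith

namespace IsFAIM

lemma _root_.Polar.exists_inv_law_le (μ : Measure Ω) (S : ℤ → Ω → 𝒮) :
    ∃ C : ℝ, 1 ≤ C ∧ ∀ b, (law μ (S 0) b)⁻¹ ≤ C := by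
  refine ⟨1 + ∑ b, (law μ (S 0) b)⁻¹, ?_, fun b => ?_⟩
  · exact le_add_of_nonneg_right (Finset.sum_nonneg fun b _ => inv_nonneg.2 (law_nonneg _ _ _))
  · exact (Finset.single_le_sum (f := fun b => (law μ (S 0) b)⁻¹)
      (fun b _ => inv_nonneg.2 (law_nonneg _ _ _)) (Finset.mem_univ b)).trans
      (le_add_of_nonneg_left zero_le_one)

lemma boundaryTV_mem (h : IsFAIM μ X Y S) (n : ℕ) (i : Fin (2 ^ n)) :
    0 ≤ boundaryTV μ X Y S n i ∧ boundaryTV μ X Y S n i ≤ 1 :=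
  ⟨tvParam_nonneg _ _ _,
    tvParam_le_one (h.measurableFibers_polarU n i) (h.measurableFibers_boundaryQ n i)⟩

lemma polarEntropy_mem (h : IsFAIM μ X Y S) (n : ℕ) (i : Fin (2 ^ n)) :
    0 ≤ polarEntropy μ X Y n i ∧ polarEntropy μ X Y n i ≤ 1 :=
  ⟨condEntropy_nonneg (h.measurableFibers_polarU n i) (h.measurableFibers_polarQ n i),
    condEntropy_binary_le_one (h.measurableFibers_polarU n i) (h.measurableFibers_polarQ n i)⟩

lemma boundaryEntropy_mem (h : IsFAIM μ X Y S) (n : ℕ) (i : Fin (2 ^ n)) :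
    0 ≤ boundaryEntropy μ X Y S n i ∧ boundaryEntropy μ X Y S n i ≤ 1 :=
  ⟨condEntropy_nonneg (h.measurableFibers_polarU n i) (h.measurableFibers_boundaryQ n i),
    condEntropy_binary_le_one (h.measurableFibers_polarU n i) (h.measurableFibers_boundaryQ n i)⟩

lemma polarZ_mem (h : IsFAIM μ X Y S) (n : ℕ) (i : Fin (2 ^ n)) :
    0 ≤ polarZ μ X Y n i ∧ polarZ μ X Y n i ≤ 1 :=
  ⟨bhattacharyya_nonneg _ _ _,
    bhattacharyya_le_one (h.measurableFibers_polarU n i) (h.measurableFibers_polarQ n i)⟩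

lemma one_sub_boundaryTV_le_polarZ (h : IsFAIM μ X Y S) (n : ℕ) (i : Fin (2 ^ n)) :
    1 - boundaryTV μ X Y S n i ≤ polarZ μ X Y n i := by
  have mU := h.measurableFibers_polarU n i
  have h1 : tvParam μ (fun ω => polarU X n ω i) (polarQ X Y n i) ≤ boundaryTV μ X Y S n i :=
    tvParam_le_of_factorsThrough mU (h.measurableFibers_boundaryQ n i)
      fun _ _ e => congrArg Prod.fst e
  have h2 := one_sub_tvParam_le_bhattacharyya (μ := μ) mU (h.measurableFibers_polarQ n i)
  change _ ≤ polarZ μ X Y n i at h2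
  linarith

lemma one_sub_boundaryTV_le_boundaryEntropy (h : IsFAIM μ X Y S) (n : ℕ) (i : Fin (2 ^ n)) :
    1 - boundaryTV μ X Y S n i ≤ boundaryEntropy μ X Y S n i :=
  one_sub_tvParam_le_condEntropy (h.measurableFibers_polarU n i) (h.measurableFibers_boundaryQ n i)

lemma boundaryEntropy_le (h : IsFAIM μ X Y S) (n : ℕ) (i : Fin (2 ^ n)) :
    boundaryEntropy μ X Y S n i ≤ 2 / Real.log 2 *
      (√(1 - boundaryTV μ X Y S n i) * √(1 + boundaryTV μ X Y S n i)) := by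
  have mU := h.measurableFibers_polarU n i
  have mQ := h.measurableFibers_boundaryQ n i
  have := log_two_pos
  exact (condEntropy_le_bhattacharyya mU mQ).trans
    (mul_le_mul_of_nonneg_left (bhattacharyya_le_sqrt mU mQ) (by positivity))

/-- The total variation parameters with boundary states polarize. -/
lemma ae_boundaryTV (h : IsFAIM μ X Y S) (hB : IsFairBits ν B) :
    ∀ᵐ ω ∂ν, (ω ∉ noiseEvent μ X Y S B →
      Tendsto (fun n => boundaryTV μ X Y S n (randomIndex B n ω)) atTop (𝓝 1)) := by
  obtain ⟨ε, hε, n₀, hn₀⟩ := h.exists_pairLaw_lower_bound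
  have hne : Nonempty 𝒮 := μ.nonempty_of_neZero.map (S 0)
  have hcard : 0 < (Fintype.card 𝒮 : ℝ) := by exact_mod_cast Fintype.card_pos
  set η := ε / (4 * (Fintype.card 𝒮 : ℝ) ^ 4) with hη
  have hη0 : 0 < η := by positivity
  filter_upwards [hB.ae_exists_tendsto (f := boundaryTV μ X Y S) (R := 1)
    (fun n i => abs_le.2 ⟨by linarith [(h.boundaryTV_mem n i).1], (h.boundaryTV_mem n i).2⟩)
    (fun n i => by linarith [h.boundaryTV_childIndex_zero_le n i,
      h.boundaryTV_childIndex_one_le n i]), hB.ae_tendsto_average] with ω ⟨l, hl⟩ havg hω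
  have hl0 : 0 ≤ l := ge_of_tendsto' hl fun n => (h.boundaryTV_mem n _).1
  have hl1 : l ≤ 1 := le_of_tendsto' hl fun n => (h.boundaryTV_mem n _).2
  have hfreq : ∃ᶠ n in atTop, B n ω = 0 := by
    refine (frequently_of_tendsto_average (one_sub_bit_eq_zero_or_one _)
      (tendsto_average_one_sub_bit havg)).mono fun n hn => ?_
    generalize B n ω = b at hn
    fin_cases b
    · rfl
    · norm_num at hn
  have hlim : Tendsto (fun n => boundaryTV μ X Y S n (randomIndex B n ω) -
      boundaryTV μ X Y S (n + 1) (randomIndex B (n + 1) ω) -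
      η * (boundaryTV μ X Y S n (randomIndex B n ω) *
        (1 - boundaryTV μ X Y S n (randomIndex B n ω)))) atTop
      (𝓝 (l - l - η * (l * (1 - l)))) :=
    (hl.sub (hl.comp (tendsto_add_atTop_nat 1))).sub
      ((hl.mul (tendsto_const_nhds.sub hl)).const_mul η)
  -- The inequality between consecutive values is available at bits 0 and large `n` only; infinitely
  -- many such `n` suffice, since the limit is known to exist.
  have hge : 0 ≤ l - l - η * (l * (1 - l)) := by
    refine ge_of_tendsto_of_frequently hlim
      ((hfreq.and_eventually (eventually_ge_atTop n₀)).mono fun n ⟨hn, hn'⟩ => ?_)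
    have h1 := h.mul_one_sub_le_sub_boundaryCross hε n (randomIndex B n ω)
      (hn₀ _ (hn'.trans Nat.lt_two_pow_self.le))
    have h2 := h.boundaryTV_childIndex_zero_le n (randomIndex B n ω)
    rw [randomIndex_succ, hn]
    linarith
  have hprod : l * (1 - l) = 0 := by
    have h1 : 0 ≤ l * (1 - l) := mul_nonneg hl0 (by linarith)
    nlinarith
  rcases mul_eq_zero.1 hprod with e | e
  · rw [e] at hl
    exact absurd hl hω
  · rwa [show l = 1 by linarith] at hl

lemma ae_tendsto_boundaryEntropy (h : IsFAIM μ X Y S) (hB : IsFairBits ν B) :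
    ∀ᵐ ω ∂ν, Tendsto (fun n => boundaryEntropy μ X Y S n (randomIndex B n ω)) atTop
      (𝓝 ((noiseEvent μ X Y S B).indicator 1 ω)) := by
  filter_upwards [h.ae_boundaryTV hB] with ω hω
  by_cases hE : ω ∈ noiseEvent μ X Y S B
  · rw [Set.indicator_of_mem hE, Pi.one_apply]
    have h1 : Tendsto (fun n => 1 - boundaryTV μ X Y S n (randomIndex B n ω)) atTop (𝓝 (1 - 0)) :=
      tendsto_const_nhds.sub hE
    rw [sub_zero] at h1
    exact tendsto_of_tendsto_of_tendsto_of_le_of_le h1 tendsto_const_nhds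
      (fun n => h.one_sub_boundaryTV_le_boundaryEntropy n _) fun n => (h.boundaryEntropy_mem n _).2
  · rw [Set.indicator_of_notMem hE]
    have hk := hω hE
    have h1 : Tendsto (fun n => 2 / Real.log 2 *
        (√(1 - boundaryTV μ X Y S n (randomIndex B n ω)) *
          √(1 + boundaryTV μ X Y S n (randomIndex B n ω)))) atTop
        (𝓝 (2 / Real.log 2 * (√(1 - 1) * √(1 + 1)))) :=
      (((tendsto_const_nhds.sub hk).sqrt).mul ((tendsto_const_nhds.add hk).sqrt)).const_mul _
    simp only [sub_self, Real.sqrt_zero, zero_mul, mul_zero] at h1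
    exact tendsto_of_tendsto_of_tendsto_of_le_of_le tendsto_const_nhds h1
      (fun n => (h.boundaryEntropy_mem n _).1) fun n => h.boundaryEntropy_le n _

/-- The mean of the entropy at a random index is an average over the block, which tends to the rate;
by dominated convergence it also tends to the mean of the limiting indicator. -/
lemma real_noiseEvent (h : IsFAIM μ X Y S) (hB : IsFairBits ν B) {r : ℝ}
    (hr : Tendsto (fun N : ℕ => (1 / (N : ℝ)) * condEntropy μ (block X N) (block Y N))
      atTop (𝓝 r)) : ν.real (noiseEvent μ X Y S B) = r := by
  have h1 := tendsto_integral_of_dominated_convergence (μ := ν) (fun _ => (1 : ℝ))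
    (fun n => (hB.integrable_randomIndex n (boundaryEntropy μ X Y S n)).aestronglyMeasurable)
    (integrable_const 1) (fun n => Eventually.of_forall fun ω => by
      rw [Real.norm_eq_abs, abs_of_nonneg (h.boundaryEntropy_mem n _).1]
      exact (h.boundaryEntropy_mem n _).2) (h.ae_tendsto_boundaryEntropy hB)
  simp_rw [hB.integral_randomIndex] at h1
  rw [integral_indicator_one hB.measurableSet_noiseEvent] at h1
  exact tendsto_nhds_unique h1 (h.tendsto_average_boundaryEntropy hr)

/-- The gap `D` between the entropies without and with boundary states is nonnegative, converges
almost surely because both entropies do, and has mean tending to 0 because both averages tend to the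
rate. Its limit is therefore 0 almost surely. -/
lemma ae_tendsto_polarEntropy (h : IsFAIM μ X Y S) (hB : IsFairBits ν B) :
    ∀ᵐ ω ∂ν, Tendsto (fun n => polarEntropy μ X Y n (randomIndex B n ω)) atTop
      (𝓝 ((noiseEvent μ X Y S B).indicator 1 ω)) := by
  obtain ⟨r, hr⟩ := h.exists_entropyRate
  have hconv := hB.ae_exists_tendsto (f := polarEntropy μ X Y) (R := 1)
    (fun n i => abs_le.2 ⟨by linarith [(h.polarEntropy_mem n i).1], (h.polarEntropy_mem n i).2⟩)
    h.polarEntropy_children_le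
  set D : ℕ → Ω' → ℝ := fun n ω => polarEntropy μ X Y n (randomIndex B n ω) -
    boundaryEntropy μ X Y S n (randomIndex B n ω) with hD
  have hDm : ∀ n, AEStronglyMeasurable (D n) ν := fun n =>
    ((hB.integrable_randomIndex n (polarEntropy μ X Y n)).sub
      (hB.integrable_randomIndex n (boundaryEntropy μ X Y S n))).aestronglyMeasurable
  have hDlim : ∀ᵐ ω ∂ν, ∃ l, Tendsto (fun n => D n ω) atTop (𝓝 l) := by
    filter_upwards [hconv, h.ae_tendsto_boundaryEntropy hB] with ω ⟨l, hl⟩ hω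
    exact ⟨_, hl.sub hω⟩
  obtain ⟨d, hdm, hd⟩ := measurable_limit_of_tendsto_metrizable_ae
    (fun n => (hDm n).aemeasurable) hDlim
  have hD0 : ∀ n ω, 0 ≤ D n ω := fun n ω => sub_nonneg.2 (h.boundaryEntropy_le_polarEntropy n _)
  have hD1 : ∀ n ω, D n ω ≤ 1 := fun n ω => by
    have h1 := (h.polarEntropy_mem n (randomIndex B n ω)).2
    have h2 := (h.boundaryEntropy_mem n (randomIndex B n ω)).1
    simp only [hD]
    linarith
  have hint := tendsto_integral_of_dominated_convergence (μ := ν) (fun _ => (1 : ℝ)) hDm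
    (integrable_const 1) (fun n => Eventually.of_forall fun ω => by
      rw [Real.norm_eq_abs, abs_of_nonneg (hD0 n ω)]
      exact hD1 n ω) hd
  have hzero : Tendsto (fun n => ∫ ω, D n ω ∂ν) atTop (𝓝 (r - r)) := by
    refine ((h.tendsto_average_polarEntropy hr).sub
      (h.tendsto_average_boundaryEntropy hr)).congr fun n => ?_
    rw [← hB.integral_randomIndex, ← hB.integral_randomIndex, ← integral_sub
      (hB.integrable_randomIndex n _) (hB.integrable_randomIndex n _)]
  have hd_int : ∫ ω, d ω ∂ν = 0 := by
    rw [tendsto_nhds_unique hint hzero, sub_self]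
  have hd0 : 0 ≤ᵐ[ν] d := by
    filter_upwards [hd] with ω hω
    exact ge_of_tendsto' hω fun n => hD0 n ω
  have hd1 : ∀ᵐ ω ∂ν, ‖d ω‖ ≤ 1 := by
    filter_upwards [hd, hd0] with ω hω h0
    rw [Real.norm_eq_abs, abs_of_nonneg h0]
    exact le_of_tendsto' hω fun n => hD1 n ω
  have hdi : Integrable d ν := Integrable.of_bound hdm.aestronglyMeasurable 1 hd1
  have hdz := (integral_eq_zero_iff_of_nonneg_ae hd0 hdi).1 hd_int
  filter_upwards [hd, hdz, h.ae_tendsto_boundaryEntropy hB] with ω h1 h2 h3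
  rw [h2] at h1
  have := h1.add h3
  simpa [hD] using this

/-- On the noise event Z is squeezed by 1 - K̂ from below. Off it, the bound by √(2H) needs the
entropy without boundary states. -/
lemma ae_tendsto_polarZ (h : IsFAIM μ X Y S) (hB : IsFairBits ν B) :
    ∀ᵐ ω ∂ν, Tendsto (fun n => polarZ μ X Y n (randomIndex B n ω)) atTop
      (𝓝 ((noiseEvent μ X Y S B).indicator 1 ω)) := by
  filter_upwards [h.ae_tendsto_polarEntropy hB] with ω hω
  by_cases hE : ω ∈ noiseEvent μ X Y S B
  · rw [Set.indicator_of_mem hE, Pi.one_apply]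
    have h1 : Tendsto (fun n => 1 - boundaryTV μ X Y S n (randomIndex B n ω)) atTop (𝓝 (1 - 0)) :=
      tendsto_const_nhds.sub hE
    rw [sub_zero] at h1
    exact tendsto_of_tendsto_of_tendsto_of_le_of_le h1 tendsto_const_nhds
      (fun n => h.one_sub_boundaryTV_le_polarZ n _) fun n => (h.polarZ_mem n _).2
  · rw [Set.indicator_of_notMem hE] at hω ⊢
    have h1 : Tendsto (fun n => √(2 * polarEntropy μ X Y n (randomIndex B n ω))) atTop
        (𝓝 (√(2 * 0))) := (hω.const_mul 2).sqrt
    rw [mul_zero, Real.sqrt_zero] at h1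
    exact tendsto_of_tendsto_of_tendsto_of_le_of_le tendsto_const_nhds h1
      (fun n => (h.polarZ_mem n _).1) fun n => bhattacharyya_le_sqrt_condEntropy
        (h.measurableFibers_polarU n _) (h.measurableFibers_polarQ n _)

/-- Fast polarization to one on the event of pure noise. -/
lemma ae_eventually_boundaryTV_lt (h : IsFAIM μ X Y S) (hB : IsFairBits ν B) {β : ℝ}
    (hβ : β < 1 / 2) :
    ∀ᵐ ω ∂ν, ω ∈ noiseEvent μ X Y S B → ∀ᶠ n : ℕ in atTop,
      boundaryTV μ X Y S n (randomIndex B n ω) < (2 : ℝ) ^ (-(2 : ℝ) ^ ((n : ℝ) * β)) := by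
  obtain ⟨C, hC1, hC⟩ := exists_inv_law_le μ S
  filter_upwards [hB.ae_tendsto_average] with ω havg hω
  -- K̂ is squared at bit 0, so the squaring steps are counted by `1 - B n ω`. The constant `2 * C`
  -- covers both the squaring and the doubling, as `1 ≤ C`.
  refine eventually_lt_of_squaring (C := 2 * C) (one_sub_bit_eq_zero_or_one fun n => B n ω)
    (tendsto_average_one_sub_bit havg) (by linarith) (fun n hn => ?_) (fun n hn => ?_)
    (fun n => (h.boundaryTV_mem n _).1) hω hβ
  · have hb : B n ω = 0 := by
      generalize B n ω = b at hn
      fin_cases b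
      · rfl
      · norm_num at hn
    have h1 := h.boundaryTV_childIndex_zero_le n (randomIndex B n ω)
    have h2 := h.boundaryCross_le_sq hC n (randomIndex B n ω)
    rw [randomIndex_succ, hb]
    have h3 := mul_nonneg (by linarith : 0 ≤ C)
      (sq_nonneg (boundaryTV μ X Y S n (randomIndex B n ω)))
    linarith
  · have hb : B n ω = 1 := by
      generalize B n ω = b at hn
      fin_cases b
      · norm_num at hn
      · rfl
    have h1 := h.boundaryTV_childIndex_one_le n (randomIndex B n ω)
    have h2 := h.boundaryCross_nonneg n (randomIndex B n ω)
    have h3 := (h.boundaryTV_mem n (randomIndex B n ω)).1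
    rw [randomIndex_succ, hb]
    nlinarith

/-- Fast polarization to zero off the event of pure noise. -/
lemma ae_eventually_polarZ_lt (h : IsFAIM μ X Y S) (hB : IsFairBits ν B) {β : ℝ}
    (hβ : β < 1 / 2) :
    ∀ᵐ ω ∂ν, ω ∉ noiseEvent μ X Y S B → ∀ᶠ n : ℕ in atTop,
      polarZ μ X Y n (randomIndex B n ω) < (2 : ℝ) ^ (-(2 : ℝ) ^ ((n : ℝ) * β)) := by
  obtain ⟨C, hC1, hC⟩ := exists_inv_law_le μ S
  filter_upwards [hB.ae_tendsto_average, h.ae_tendsto_polarZ hB] with ω havg hZ hω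
  rw [Set.indicator_of_notMem hω] at hZ
  -- Z is squared at bit 1, so here the bits themselves count the squaring steps.
  refine eventually_lt_of_squaring (C := 2 * C) (bit_eq_zero_or_one fun n => B n ω)
    havg (by linarith) (fun n hn => ?_) (fun n hn => ?_) (fun n => (h.polarZ_mem n _).1) hZ hβ
  · have hb : B n ω = 1 := by
      generalize B n ω = b at hn
      fin_cases b
      · norm_num at hn
      · rfl
    have h1 := h.polarZ_childIndex_one_le hC (by linarith) n (randomIndex B n ω)
    rw [randomIndex_succ, hb]
    have h3 := mul_nonneg (by linarith : 0 ≤ C) (sq_nonneg (polarZ μ X Y n (randomIndex B n ω)))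
    linarith
  · have hb : B n ω = 0 := by
      generalize B n ω = b at hn
      fin_cases b
      · rfl
      · norm_num at hn
    rw [randomIndex_succ, hb]
    exact h.polarZ_childIndex_zero_le hC (by linarith) n (randomIndex B n ω)

/-- Almost surely the threshold events agree with the noise event from some level on, so their
probabilities converge. Off the noise event one fixed exponent, 1/4, serves all `β`: doubly
exponential decay beats even the thresholds of negative `β`. -/
lemma ae_eventually_lt_polarZ_iff (h : IsFAIM μ X Y S) (hB : IsFairBits ν B) {β : ℝ}
    (hβ : β < 1 / 2) :
    ∀ᵐ ω ∂ν, ∀ᶠ n : ℕ in atTop,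
      (ω ∈ {ω | polarZ μ X Y n (randomIndex B n ω) > 1 - (2 : ℝ) ^ (-(2 : ℝ) ^ ((n : ℝ) * β))} ↔
        ω ∈ noiseEvent μ X Y S B) := by
  filter_upwards [h.ae_eventually_boundaryTV_lt hB hβ,
    h.ae_eventually_polarZ_lt hB (β := 1 / 4) (by norm_num)] with ω h1 h0
  by_cases hE : ω ∈ noiseEvent μ X Y S B
  · filter_upwards [h1 hE] with n hn
    refine ⟨fun _ => hE, fun _ => ?_⟩
    have := h.one_sub_boundaryTV_le_polarZ n (randomIndex B n ω)
    change polarZ μ X Y n (randomIndex B n ω) > _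
    linarith
  · filter_upwards [h0 hE, eventually_rpow_le_threshold β] with n hn hn'
    refine ⟨fun hlt => ?_, fun hE' => absurd hE' hE⟩
    change polarZ μ X Y n (randomIndex B n ω) > _ at hlt
    linarith

lemma tendsto_real_lt_polarZ (h : IsFAIM μ X Y S) (hB : IsFairBits ν B) {β : ℝ}
    (hβ : β < 1 / 2) :
    Tendsto (fun n : ℕ => ν.real
      {ω | polarZ μ X Y n (randomIndex B n ω) > 1 - (2 : ℝ) ^ (-(2 : ℝ) ^ ((n : ℝ) * β))}) atTop
      (𝓝 (ν.real (noiseEvent μ X Y S B))) := by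
  refine (ENNReal.tendsto_toReal (measure_ne_top _ _)).comp
    (tendsto_measure_of_ae_tendsto_indicator_of_isFiniteMeasure atTop
      hB.measurableSet_noiseEvent (fun n => ?_) (h.ae_eventually_lt_polarZ_iff hB hβ))
  exact hB.measurable_randomIndex n (Set.toFinite {i | polarZ μ X Y n i > _}).measurableSet

lemma polarizesFastToOne (h : IsFAIM μ X Y S) (hB : IsFairBits ν B) {β : ℝ} (hβ : β < 1 / 2) :
    PolarizesFastToOne ν (bhattacharyyaProcess μ X Y B) β := by
  -- The limit Z_∞ is the indicator of the noise event.
  refine ⟨(noiseEvent μ X Y S B).indicator 1, ⟨fun n => ?_, fun n ω => h.polarZ_mem n _,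
    measurable_one.indicator hB.measurableSet_noiseEvent, fun ω => ?_, h.ae_tendsto_polarZ hB⟩, ?_⟩
  · exact (Measurable.of_discrete (f := polarZ μ X Y n)).comp (hB.measurable_randomIndex n)
  · by_cases hE : ω ∈ noiseEvent μ X Y S B <;> simp [hE]
  · have e : {ω | (noiseEvent μ X Y S B).indicator (1 : Ω' → ℝ) ω = 1} =
        noiseEvent μ X Y S B := by
      ext ω
      by_cases hE : ω ∈ noiseEvent μ X Y S B <;> simp [hE]
    rw [e]
    exact h.tendsto_real_lt_polarZ hB hβ

lemma tendsto_fraction_polarZ (h : IsFAIM μ X Y S) {r : ℝ}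
    (hr : Tendsto (fun N : ℕ => (1 / (N : ℝ)) * condEntropy μ (block X N) (block Y N))
      atTop (𝓝 r)) {β : ℝ} (hβ : β < 1 / 2) :
    Tendsto (fun n : ℕ => (1 / (2 : ℝ) ^ n) *
      ({i : Fin (2 ^ n) | polarZ μ X Y n i > 1 - (2 : ℝ) ^ (-((2 : ℝ) ^ n) ^ β)}.ncard : ℝ))
      atTop (𝓝 r) := by
  -- The claim involves no random bits; any realization turns the uniform distribution on indices
  -- into a probability.
  have hB := isFairBits_infinitePi
  rw [← h.real_noiseEvent hB hr]
  refine (h.tendsto_real_lt_polarZ hB hβ).congr fun n => ?_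
  rw [← hB.real_randomIndex_preimage, ← Real.rpow_natCast, ← Real.rpow_mul zero_le_two]
  rfl

end IsFAIM

end Polarization

end Polar

end

theorem mainTheorem1 {Ω : Type*} [MeasurableSpace Ω] (μ : Measure Ω)
    [IsProbabilityMeasure μ]
    {𝒴 : Type*} [Fintype 𝒴] [MeasurableSpace 𝒴] [DiscreteMeasurableSpace 𝒴]
    {𝒮 : Type*} [Fintype 𝒮] [MeasurableSpace 𝒮] [DiscreteMeasurableSpace 𝒮]
    (X : ℤ → Ω → ZMod 2) (Y : ℤ → Ω → 𝒴) (S : ℤ → Ω → 𝒮)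
    (hFAIM : Polar.IsFAIM μ X Y S) :
    (∀ (Ω' : Type*) [MeasurableSpace Ω'] (ν : Measure Ω') [IsProbabilityMeasure ν]
        (B : ℕ → Ω' → Fin 2), Polar.IsFairBits ν B →
        ∀ β : ℝ, 0 < β → β < 1 / 2 →
          Polar.PolarizesFastToOne ν (Polar.bhattacharyyaProcess μ X Y B) β) ∧
    ∃ entropyRate : ℝ,
      Tendsto
        (fun N : ℕ => (1 / (N : ℝ)) * Polar.condEntropy μ (Polar.block X N) (Polar.block Y N))
        atTop (𝓝 entropyRate) ∧
      ∀ β : ℝ, β < 1 / 2 →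
        Tendsto
          (fun n : ℕ => (1 / (2 : ℝ) ^ n) *
            ({i : Fin (2 ^ n) |
              Polar.polarZ μ X Y n i > 1 - (2 : ℝ) ^ (-((2 : ℝ) ^ n) ^ β)}.ncard : ℝ))
          atTop (𝓝 entropyRate) := by
  obtain ⟨r, hr⟩ := hFAIM.exists_entropyRate
  exact ⟨fun Ω' _ ν _ B hB β _ hβ => hFAIM.polarizesFastToOne hB hβ,
    r, hr, fun β hβ => hFAIM.tendsto_fraction_polarZ hr hβ⟩
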